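/- **Lemma (Generalized Mean Value Inequality).** Let $n\ge 1$, let $B_r$ denote the open ball of radius $r$ centred at the origin of $\mathbb{R}^n$, and let $\Sigma$ be a smooth hypersurface immersed in $\mathbb{R}^n$ that contains the origin; that is, $\Sigma$ is a (Hausdorff, second countable, not necessarily connected) smooth $(n-1)$-dimensional manifold, possibly with boundary, together with a smooth immersion $F:\Sigma\to\mathbb{R}^n$ and a point $0\in\Sigma$ with $F(0)=0$. We write $x$ for the position vector $F$ and $B_r\cap\Sigma$ for $F^{-1}(B_r)$, and we equip $\Sigma$ with the induced Riemannian metric, its volume measure and its Laplace--Beltrami operator $\Delta_\Sigma$; $H$ is the mean curvature vector, i.e. the trace (not normalized) of the second fundamental form. Assume that $\Sigma$ has no boundary in $B_1$: no boundary point of $\Sigma$ is mapped into $B_1$, and $\Sigma$ is proper in $B_1$, i.e. $F^{-1}(K)$ is compact for each compact $K\subset B_1$. Assume also that $\sup_{\Sigma\cap B_1}|H|<\infty$. Let $f\ge 0$ be a $C^2$ function on $B_1\cap\Sigma$ such that, almost everywhere on $B_1\cap\Sigma$, $$\Delta_\Sigma f\ge-\lambda_1 f-h$$ for some constant $\lambda_1\ge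 0$ and some function $h\in L^1(B_1\cap\Sigma)$. Suppose that there are constants $c_2,c_3\ge 0$ and $\alpha\in[0,1)$ such that $$\frac12\, r^{-n}\int_{B_r\cap\Sigma}(r^2-|x|^2)\,h\;\le\; c_2r^{-\alpha}+c_3\qquad\text{for all } r\in(0,1].$$ Then $$f(0)\;\le\;\omega_{n-1}^{-1}e^{c_1}\int_{B_1\cap\Sigma}f\;+\;\omega_{n-1}^{-1}\Big(\frac{c_2}{1-\alpha}+c_3\Big)e^{c_1},$$ where $\omega_{n-1}$ is the volume of the unit ball of $\mathbb{R}^{n-1}$ and $c_1=\sup_{\Sigma\cap B_1}|H|+\frac{\lambda_1}{2}$. (The integral of $f$ may be $+\infty$, in which case the inequality is trivial.) -/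

import Mathlib

open MeasureTheory Set Metric
open scoped Manifold ContDiff

noncomputable section

namespace Hypersurface

/-- Euclidean space `ℝᵈ` with its standard inner product. -/
abbrev Euc (d : ℕ) : Type := EuclideanSpace ℝ (Fin d)

/-! ### Local parametrizations `u : ℝᵐ → ℝᵈ` -/

section Patch

variable {m : ℕ} {V : Type*} [NormedAddCommGroup V] [NormedSpace ℝ V]

/-- The partial derivative `∂ᵢ w (y)`. -/
def pderiv (i : Fin m) (w : Euc m → V) (y : Euc m) : V :=
  fderiv ℝ w y (EuclideanSpace.single i 1)

variable {d : ℕ}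

/-- The induced metric `g_{ij} = ⟨∂ᵢ u, ∂ⱼ u⟩` in the coordinates of the parametrization `u`. -/
def metricMatrix (u : Euc m → Euc d) (y : Euc m) : Matrix (Fin m) (Fin m) ℝ :=
  Matrix.of fun i j => inner ℝ (pderiv i u y) (pderiv j u y)

/-- The Riemannian volume density `√(det g)`. -/
def volDensity (u : Euc m → Euc d) (y : Euc m) : ℝ :=
  Real.sqrt (metricMatrix u y).det

/-- The Laplace-Beltrami operator of the induced metric in coordinates:
`Δ w = (det g)^{-1/2} ∑ᵢ ∂ᵢ ((det g)^{1/2} ∑ⱼ g^{ij} ∂ⱼ w)`. -/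
def patchLaplacian (u : Euc m → Euc d) (w : Euc m → ℝ) (y : Euc m) : ℝ :=
  (volDensity u y)⁻¹ * ∑ i : Fin m,
    pderiv i (fun z => volDensity u z * ∑ j : Fin m, (metricMatrix u z)⁻¹ i j * pderiv j w z) y

/-- The component of a vector `v` normal to the image of `du(y)`. -/
def normalPart (u : Euc m → Euc d) (y : Euc m) (v : Euc d) : Euc d :=
  (LinearMap.range (fderiv ℝ u y : Euc m →ₗ[ℝ] Euc d))ᗮ.starProjection v

/-- The coefficients `A_{ij} = (∂ᵢ∂ⱼ u)^⊥` of the (vector valued) second fundamental form. -/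
def patchSecondFF (u : Euc m → Euc d) (i j : Fin m) (y : Euc m) : Euc d :=
  normalPart u y (pderiv i (pderiv j u) y)

/-- The mean curvature vector, the trace `∑ᵢⱼ g^{ij} A_{ij}` of the second fundamental form. -/
def patchMeanCurvature (u : Euc m → Euc d) (y : Euc m) : Euc d :=
  ∑ i : Fin m, ∑ j : Fin m, (metricMatrix u y)⁻¹ i j • patchSecondFF u i j y

end Patch

/-! ### Immersed manifolds `F : M → ℝᵈ` -/

section Immersed

variable {m d : ℕ} {H : Type*} [TopologicalSpace H] (I : ModelWithCorners ℝ (Euc m) H)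
  {M : Type*} [TopologicalSpace M] [ChartedSpace H M]

/-- The map `F` read in the chart of `M` at `p`. -/
def localParam (F : M → Euc d) (p : M) : Euc m → Euc d :=
  F ∘ (extChartAt I p).symm

/-- The Laplacian `Δ_Σ f` of the metric induced by `F`, at the point `p`. -/
def laplacian (F : M → Euc d) (f : M → ℝ) (p : M) : ℝ :=
  patchLaplacian (localParam I F p) (f ∘ (extChartAt I p).symm) (extChartAt I p p)

/-- The mean curvature vector of the immersion `F` at the point `p`. -/
def meanCurvature (F : M → Euc d) (p : M) : Euc d :=
  patchMeanCurvature (localParam I F p) (extChartAt I p p)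

/-- The Riemannian volume of the induced metric on the domain of the chart at `x`, as a measure
on `M` (it gives no mass to the complement of that domain): `A ↦ ∫_{φₓ(A)} √(det g) dy`. -/
def chartVolume [MeasurableSpace M] (F : M → Euc d) (x : M) : Measure M :=
  ((volume.restrict (extChartAt I x).target).withDensity
    fun y => ENNReal.ofReal (volDensity (localParam I F x) y)).map (extChartAt I x).symm

/-- The Riemannian volume measure of the metric induced by `F`. The chart volumes agree on the
overlaps of chart domains, so their least upper bound is the measure that restricts to the chart
volume on each chart domain. -/
def inducedVolume [MeasurableSpace M] (F : M → Euc d) : Measure M :=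
  ⨆ x : M, chartVolume I F x

/-- `F` is a smooth immersion: it is smooth with injective differential everywhere. -/
def IsSmoothImmersion (F : M → Euc d) : Prop :=
  ContMDiff I 𝓘(ℝ, Euc d) ∞ F ∧ ∀ p : M, Function.Injective (mfderiv I 𝓘(ℝ, Euc d) F p)

/-- The immersed manifold `F : M → ℝᵈ` has no boundary in the open set `U`: no boundary point of
`M` is mapped into `U`, and `M` does not end inside `U`, that is, the preimages of compact subsets
of `U` are compact. -/
def NoBoundaryIn (F : M → Euc d) (U : Set (Euc d)) : Prop :=
  (∀ p ∈ I.boundary M, F p ∉ U) ∧ ∀ K : Set (Euc d), K ⊆ U → IsCompact K → IsCompact (F ⁻¹' K)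

end Immersed

end Hypersurface

end

/-! Write m = n - 1, ρ = |x|², Λ = sup |H|, λ = λ₁, C = Λ + λ/2. The inequality Δf ≥ -λf - h is
tested against φ = G(|x|²) with G(ρ) = ∫_ρ^1 κ(t)(t - ρ) dt, where κ ≥ 0 is continuous and vanishes
near 0 and near 1. Thus φ is a superposition of the weights (t - |x|²)₊ that occur in the hypothesis
on h, and no integral over balls has to be differentiated in the radius. Properness makes φ
compactly supported in F⁻¹(B₁), which consists of interior points, so Green's identity
(`integral_mul_laplacian_comm`) has no boundary term and gives ∫ f(Δφ + λφ) + ∫ φh ≥ 0.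

Since G' = -∫_ρ^1 κ and G'' = κ, one has Δφ = 4κ(ρ)|xᵀ|² - 2(m + ⟨x,H⟩)∫_ρ^1 κ, which is bounded
above by 4ρκ(ρ) - 2m∫κ + 2Λ√ρ∫κ (`laplacian_radial_le`). Take 4tκ(t) = χ(t) t^(-m/2) exp(C√t), where
the cutoff χ rises from 0 to 1 on [a,b] and falls back to 0 on [c,e], with e < 1. Differentiating
the power cancels the dimension term, differentiating the exponential pays for curvature and λ, and
only χ' is left: Δφ + λφ ≤ e^C c^(-m/2) - b^(-m/2) 1_{ρ ≤ a} (`exists_weight`). For the h term,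
Fubini in t and the hypothesis at r = √t leave powers of t that are integrable at 0 because α < 1,
with total e^C (c₂/(1-α) + c₃) (`integral_radial_mul_le`).

Letting c → 1 and b → a = s² gives s^(-m) ∫_{|x| ≤ s} f ≤ e^C (∫_{B₁} f + c₂/(1-α) + c₃) for 0 < s <
1. As s → 0, f is nearly f(0) on the sheet through the base point, whose part in the ball of radius
s has volume at least (1 - o(1)) ω_m s^m (`exists_small_set_volume_ge`); other sheets through the
origin only help, as f ≥ 0. -/

noncomputable section

namespace Hypersurface

open Filter Topology Matrix

/-! ### Derivatives of determinants and inverse matrices -/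

section MatrixCalculus

variable {E : Type*} [NormedAddCommGroup E] [NormedSpace ℝ E]
  {ι : Type*} [Fintype ι] [DecidableEq ι]

lemma contDiffAt_det {n : WithTop ℕ∞} {A : E → Matrix ι ι ℝ} {y : E}
    (hA : ∀ i j, ContDiffAt ℝ n (fun z => A z i j) y) :
    ContDiffAt ℝ n (fun z => (A z).det) y := by
  simp only [Matrix.det_apply]
  exact ContDiffAt.sum fun σ _ => (contDiffAt_prod fun i _ => hA _ _).const_smul _

lemma contDiffAt_inv_apply {n : WithTop ℕ∞} {A : E → Matrix ι ι ℝ} {y : E}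
    (hA : ∀ i j, ContDiffAt ℝ n (fun z => A z i j) y) (hdet : (A y).det ≠ 0) (i j : ι) :
    ContDiffAt ℝ n (fun z => (A z)⁻¹ i j) y := by
  have hadj : ContDiffAt ℝ n (fun z => (A z).adjugate i j) y := by
    simp only [Matrix.adjugate_apply]
    refine contDiffAt_det fun k l => ?_
    by_cases hk : k = j
    · subst hk
      simpa [Matrix.updateRow_self] using contDiffAt_const
    · simpa [Matrix.updateRow_ne hk] using hA k l
  have := ((contDiffAt_det hA).inv hdet).mul hadj
  refine this.congr_of_eventuallyEq (Eventually.of_forall fun z => ?_)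
  simp [Matrix.inv_def, Ring.inverse_eq_inv']

/-- Jacobi's formula. -/
lemma hasFDerivAt_det {A : E → Matrix ι ι ℝ} {A' : ι → ι → E →L[ℝ] ℝ} {y : E}
    (hA : ∀ i j, HasFDerivAt (fun z => A z i j) (A' i j) y) :
    HasFDerivAt (fun z => (A z).det) (∑ i, ∑ j, (A y).adjugate j i • A' i j) y := by
  -- The determinant is multilinear in the rows, so its derivative is a sum of determinants with one
  -- row replaced; Cramer's rule expands each of them through the adjugate.
  let D : ContinuousMultilinearMap ℝ (fun _ : ι => ι → ℝ) ℝ :=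
    { toMultilinearMap := (Matrix.detRowAlternating (n := ι) (R := ℝ)).toMultilinearMap
      cont := Continuous.matrix_det continuous_id }
  have h1 : HasFDerivAt (fun z => fun i j => A z i j)
      (ContinuousLinearMap.pi fun i => ContinuousLinearMap.pi fun j => A' i j) y :=
    hasFDerivAt_pi.2 fun i => hasFDerivAt_pi.2 fun j => hA i j
  have h2 := (D.hasFDerivAt (fun i j => A y i j)).comp y h1
  refine h2.congr_fderiv ?_
  ext v
  simp only [ContinuousLinearMap.comp_apply, ContinuousMultilinearMap.linearDeriv_apply,
    _root_.sum_apply, _root_.smul_apply, smul_eq_mul]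
  refine Finset.sum_congr rfl fun i _ => ?_
  have : D (Function.update (fun i j => A y i j) i fun j => A' i j v)
      = ((A y).updateRow i fun j => A' i j v).det := rfl
  have h3 : ((A y).updateRow i fun j => A' i j v).det = ∑ j, (A y).adjugate j i * A' i j v := by
    rw [← Matrix.cramer_transpose_apply, Matrix.cramer_eq_adjugate_mulVec,
      ← Matrix.adjugate_transpose]
    simp [Matrix.mulVec, dotProduct]
  rw [← h3, ← this]
  rfl

end MatrixCalculus

/-! ### Orthogonal projection in terms of the Gram matrix -/

section Gram

variable {V : Type*} [NormedAddCommGroup V] [InnerProductSpace ℝ V] {m : ℕ}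

/-- Coordinates of the orthogonal projection to the span of a linearly independent family. -/
lemma starProjection_span_eq [FiniteDimensional ℝ V] {v : Fin m → V}
    (hv : LinearIndependent ℝ v) (x : V) :
    (Submodule.span ℝ (range v)).starProjection x
      = ∑ k, ∑ l, ((Matrix.gram ℝ v)⁻¹ k l * inner ℝ x (v l)) • v k := by
  have hpos : (Matrix.gram ℝ v).PosDef := Matrix.posDef_gram_of_linearIndependent hv
  have hunit : IsUnit (Matrix.gram ℝ v).det := hpos.isUnit.map Matrix.detMonoidHom
  -- It suffices that the residual is orthogonal to each `v j`, which is the identity G G⁻¹ = 1 for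
  -- the Gram matrix G.
  refine (Submodule.eq_starProjection_of_mem_of_inner_eq_zero ?_ ?_)
  · exact Submodule.sum_mem _ fun k _ => Submodule.sum_mem _ fun l _ =>
      Submodule.smul_mem _ _ (Submodule.subset_span ⟨k, rfl⟩)
  · intro w hw
    induction hw using Submodule.span_induction with
    | zero => simp
    | add a b _ _ ha hb => rw [inner_add_right, ha, hb, add_zero]
    | smul c a _ ha => rw [inner_smul_right, ha, mul_zero]
    | mem w hw =>
      obtain ⟨j, rfl⟩ := hw
      rw [inner_sub_left, sub_eq_zero]
      simp only [sum_inner, inner_smul_left, conj_trivial]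
      have h1 : ∀ l, ∑ k, (Matrix.gram ℝ v)⁻¹ k l * inner ℝ (v k) (v j) = if j = l then 1 else 0 := by
        intro l
        have := congr_fun (congr_fun (Matrix.mul_nonsing_inv _ hunit) j) l
        rw [Matrix.one_apply, Matrix.mul_apply] at this
        rw [← this]
        refine Finset.sum_congr rfl fun k _ => ?_
        rw [Matrix.gram_apply, real_inner_comm, mul_comm]
      rw [Finset.sum_comm]
      calc inner ℝ x (v j) = ∑ l, (if j = l then 1 else 0) * inner ℝ x (v l) := by simp
        _ = _ := by
          refine Finset.sum_congr rfl fun l _ => ?_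
          rw [← h1, Finset.sum_mul]
          exact Finset.sum_congr rfl fun k _ => by ring

/-- The double sum is ⟨x, Px⟩ for the orthogonal projection P onto the span. It later bounds the
squared tangential part of the position vector. -/
lemma sum_gram_inv_inner_le [FiniteDimensional ℝ V] {v : Fin m → V}
    (hv : LinearIndependent ℝ v) (x : V) :
    ∑ k, ∑ l, (Matrix.gram ℝ v)⁻¹ k l * inner ℝ x (v k) * inner ℝ x (v l) ≤ ‖x‖ ^ 2 := by
  have h := starProjection_span_eq hv x
  have h1 : inner ℝ x ((Submodule.span ℝ (range v)).starProjection x)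
      = ∑ k, ∑ l, (Matrix.gram ℝ v)⁻¹ k l * inner ℝ x (v k) * inner ℝ x (v l) := by
    rw [h]
    simp only [inner_sum, inner_smul_right]
    exact Finset.sum_congr rfl fun k _ => Finset.sum_congr rfl fun l _ => by ring
  rw [← h1]
  calc _ ≤ ‖x‖ * ‖(Submodule.span ℝ (range v)).starProjection x‖ := real_inner_le_norm _ _
    _ ≤ ‖x‖ * ‖x‖ := by
      gcongr
      exact Submodule.norm_starProjection_apply_le _ _
    _ = _ := (sq _).symm

end Gram

/-! ### Calculus in one parametrization; non-divergence form of the Laplacian -/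

section PatchCalculus

variable {m d : ℕ}

section Pderiv

variable {V : Type*} [NormedAddCommGroup V] [NormedSpace ℝ V]

lemma contDiffAt_pderiv {n k : WithTop ℕ∞} {w : Euc m → V} {y : Euc m} (hw : ContDiffAt ℝ n w y)
    (hk : k + 1 ≤ n) (i : Fin m) : ContDiffAt ℝ k (pderiv i w) y :=
  (hw.fderiv_right hk).clm_apply contDiffAt_const

lemma pderiv_congr {w w' : Euc m → V} {y : Euc m} (h : w =ᶠ[𝓝 y] w') (i : Fin m) :
    pderiv i w y = pderiv i w' y := by
  simp only [pderiv, h.fderiv_eq]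

lemma pderiv_eventuallyEq {w w' : Euc m → V} {y : Euc m} (h : w =ᶠ[𝓝 y] w') (i : Fin m) :
    pderiv i w =ᶠ[𝓝 y] pderiv i w' :=
  h.eventuallyEq_nhds.mono fun _ hz => pderiv_congr hz i

lemma pderiv_of_hasFDerivAt {w : Euc m → V} {w' : Euc m →L[ℝ] V} {y : Euc m}
    (h : HasFDerivAt w w' y) (i : Fin m) : pderiv i w y = w' (EuclideanSpace.single i 1) := by
  rw [pderiv, h.fderiv]

lemma fderiv_eq_sum_pderiv (w : Euc m → V) (y v : Euc m) :
    fderiv ℝ w y v = ∑ i, v i • pderiv i w y := by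
  conv_lhs => rw [← (EuclideanSpace.basisFun (Fin m) ℝ).sum_repr v]
  simp [pderiv]

lemma pderiv_pderiv_comm {w : Euc m → V} {y : Euc m} (hw : ContDiffAt ℝ 2 w y) (i j : Fin m) :
    pderiv i (pderiv j w) y = pderiv j (pderiv i w) y := by
  have hd : DifferentiableAt ℝ (fderiv ℝ w) y :=
    (hw.fderiv_right (m := 1) (by norm_num)).differentiableAt (by norm_num)
  have h : ∀ a b : Fin m, pderiv a (pderiv b w) y
      = fderiv ℝ (fderiv ℝ w) y (EuclideanSpace.single a 1) (EuclideanSpace.single b 1) := by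
    intro a b
    have := hd.hasFDerivAt.clm_apply (hasFDerivAt_const (EuclideanSpace.single b (1 : ℝ)) y)
    rw [pderiv, show pderiv b w = fun z => fderiv ℝ w z (EuclideanSpace.single b 1) from rfl,
      this.fderiv]
    simp
  rw [h, h]
  exact hw.isSymmSndFDerivAt (by simp) _ _

lemma pderiv_sum {ι : Type*} {s : Finset ι} {w : ι → Euc m → V} {y : Euc m}
    (hw : ∀ a ∈ s, DifferentiableAt ℝ (w a) y) (i : Fin m) :
    pderiv i (fun z => ∑ a ∈ s, w a z) y = ∑ a ∈ s, pderiv i (w a) y := by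
  simp [pderiv, fderiv_fun_sum hw]

lemma pderiv_mul {w w' : Euc m → ℝ} {y : Euc m} (hw : DifferentiableAt ℝ w y)
    (hw' : DifferentiableAt ℝ w' y) (i : Fin m) :
    pderiv i (fun z => w z * w' z) y = w y * pderiv i w' y + pderiv i w y * w' y := by
  simp [pderiv, fderiv_fun_mul hw hw', mul_comm]

lemma pderiv_inner {W : Type*} [NormedAddCommGroup W] [InnerProductSpace ℝ W]
    {w w' : Euc m → W} {y : Euc m} (hw : DifferentiableAt ℝ w y)
    (hw' : DifferentiableAt ℝ w' y) (i : Fin m) :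
    pderiv i (fun z => inner ℝ (w z) (w' z)) y
      = inner ℝ (w y) (pderiv i w' y) + inner ℝ (pderiv i w y) (w' y) := by
  simp [pderiv, fderiv_inner_apply ℝ hw hw']

end Pderiv

variable {u : Euc m → Euc d} {y : Euc m}

lemma linearIndependent_pderiv (hinj : Function.Injective (fderiv ℝ u y)) :
    LinearIndependent ℝ fun i => pderiv i u y := by
  have := (EuclideanSpace.basisFun (Fin m) ℝ).toBasis.linearIndependent.map'
    (fderiv ℝ u y : Euc m →ₗ[ℝ] Euc d) (LinearMap.ker_eq_bot.2 hinj)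
  have e : (fun i => pderiv i u y) = (fderiv ℝ u y : Euc m →ₗ[ℝ] Euc d) ∘
      (EuclideanSpace.basisFun (Fin m) ℝ).toBasis := by
    ext1 i
    simp [pderiv]
  rw [e]
  exact this

lemma range_fderiv_eq_span (u : Euc m → Euc d) (y : Euc m) :
    LinearMap.range (fderiv ℝ u y : Euc m →ₗ[ℝ] Euc d)
      = Submodule.span ℝ (range fun i => pderiv i u y) := by
  rw [LinearMap.range_eq_map, ← (EuclideanSpace.basisFun (Fin m) ℝ).toBasis.span_eq,
    Submodule.map_span, ← range_comp]
  congr 2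
  ext1 i
  simp [pderiv]

lemma det_metricMatrix_pos (hinj : Function.Injective (fderiv ℝ u y)) :
    0 < (metricMatrix u y).det :=
  (Matrix.posDef_gram_of_linearIndependent (linearIndependent_pderiv hinj)).det_pos

lemma volDensity_pos (hinj : Function.Injective (fderiv ℝ u y)) : 0 < volDensity u y :=
  Real.sqrt_pos.2 (det_metricMatrix_pos hinj)

lemma metricMatrix_comm (u : Euc m → Euc d) (y : Euc m) (i j : Fin m) :
    metricMatrix u y i j = metricMatrix u y j i :=
  real_inner_comm (pderiv j u y) (pderiv i u y)

lemma metricMatrix_inv_comm (u : Euc m → Euc d) (y : Euc m) (i j : Fin m) :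
    (metricMatrix u y)⁻¹ i j = (metricMatrix u y)⁻¹ j i := by
  have h : (metricMatrix u y)ᵀ = metricMatrix u y := by ext; exact metricMatrix_comm u y _ _
  conv_lhs => rw [← h, ← Matrix.transpose_nonsing_inv]
  rfl

lemma contDiffAt_metricMatrix {n k : WithTop ℕ∞} (hu : ContDiffAt ℝ n u y) (hk : k + 1 ≤ n)
    (i j : Fin m) : ContDiffAt ℝ k (fun z => metricMatrix u z i j) y :=
  (contDiffAt_pderiv hu hk i).inner ℝ (contDiffAt_pderiv hu hk j)

lemma contDiffAt_metricMatrix_inv {n k : WithTop ℕ∞} (hu : ContDiffAt ℝ n u y) (hk : k + 1 ≤ n)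
    (hinj : Function.Injective (fderiv ℝ u y)) (i j : Fin m) :
    ContDiffAt ℝ k (fun z => (metricMatrix u z)⁻¹ i j) y :=
  contDiffAt_inv_apply (contDiffAt_metricMatrix hu hk) (det_metricMatrix_pos hinj).ne' i j

lemma contDiffAt_volDensity {n k : WithTop ℕ∞} (hu : ContDiffAt ℝ n u y) (hk : k + 1 ≤ n)
    (hinj : Function.Injective (fderiv ℝ u y)) : ContDiffAt ℝ k (volDensity u) y :=
  (contDiffAt_det (contDiffAt_metricMatrix hu hk)).sqrt (det_metricMatrix_pos hinj).ne'

lemma pderiv_metricMatrix (hu : ContDiffAt ℝ 2 u y) (i k l : Fin m) :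
    pderiv i (fun z => metricMatrix u z k l) y
      = inner ℝ (pderiv i (pderiv k u) y) (pderiv l u y)
        + inner ℝ (pderiv i (pderiv l u) y) (pderiv k u y) := by
  have h : ∀ a, DifferentiableAt ℝ (pderiv a u) y := fun a =>
    (contDiffAt_pderiv (k := 1) hu (by norm_num) a).differentiableAt (by norm_num)
  have := pderiv_inner (h k) (h l) i
  rw [show (fun z => metricMatrix u z k l) = fun z => inner ℝ (pderiv k u z) (pderiv l u z) from rfl,
    this, real_inner_comm (pderiv i (pderiv l u) y), add_comm]

/-- Jacobi's formula gives ∂ᵢ√det g = ½ √det g · g^{kl} ∂ᵢg_{kl}; the two terms of ∂ᵢg_{kl}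
contribute equally by symmetry of g⁻¹, which removes the ½. -/
lemma pderiv_volDensity (hu : ContDiffAt ℝ 2 u y) (hinj : Function.Injective (fderiv ℝ u y))
    (i : Fin m) :
    pderiv i (volDensity u) y = volDensity u y * ∑ k, ∑ l, (metricMatrix u y)⁻¹ k l *
      inner ℝ (pderiv i (pderiv k u) y) (pderiv l u y) := by
  have hpos := det_metricMatrix_pos hinj
  have hg : ∀ k l, DifferentiableAt ℝ (fun z => metricMatrix u z k l) y := fun k l =>
    (contDiffAt_metricMatrix (k := 1) hu (by norm_num) k l).differentiableAt (by norm_num)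
  have h1 := (hasFDerivAt_det fun k l => (hg k l).hasFDerivAt).sqrt hpos.ne'
  have h2 := pderiv_of_hasFDerivAt h1 i
  rw [show (fun z => √(metricMatrix u z).det) = volDensity u from rfl] at h2
  rw [h2]
  have h3 : ∀ k l, (metricMatrix u y).adjugate l k
      = (metricMatrix u y).det * (metricMatrix u y)⁻¹ k l := by
    intro k l
    rw [metricMatrix_inv_comm, Matrix.inv_def, Ring.inverse_eq_inv']
    simp [hpos.ne']
  simp only [_root_.smul_apply, _root_.sum_apply, smul_eq_mul, h3]
  have h4 : ∀ k l, fderiv ℝ (fun z => metricMatrix u z k l) y (EuclideanSpace.single i 1) =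
    inner ℝ (pderiv i (pderiv k u) y) (pderiv l u y)
        + inner ℝ (pderiv i (pderiv l u) y) (pderiv k u y) := pderiv_metricMatrix hu i
  simp only [h4]
  have h5 : ∑ k, ∑ l, (metricMatrix u y).det * (metricMatrix u y)⁻¹ k l *
      (inner ℝ (pderiv i (pderiv k u) y) (pderiv l u y)
        + inner ℝ (pderiv i (pderiv l u) y) (pderiv k u y))
      = 2 * (metricMatrix u y).det * ∑ k, ∑ l, (metricMatrix u y)⁻¹ k l *
      inner ℝ (pderiv i (pderiv k u) y) (pderiv l u y) := by
    simp only [mul_add, Finset.sum_add_distrib]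
    rw [two_mul, add_mul]
    congr 1
    · simp only [Finset.mul_sum, mul_assoc]
    · rw [Finset.sum_comm]
      simp only [Finset.mul_sum, mul_assoc]
      refine Finset.sum_congr rfl fun k _ => Finset.sum_congr rfl fun l _ => ?_
      rw [metricMatrix_inv_comm]
  rw [h5]
  have h6 : (metricMatrix u y).det = √(metricMatrix u y).det * √(metricMatrix u y).det :=
    (Real.mul_self_sqrt hpos.le).symm
  have h7 := Real.sqrt_pos.2 hpos
  rw [volDensity]
  rw [show ∀ S : ℝ, 1 / (2 * √(metricMatrix u y).det) * (2 * (metricMatrix u y).det * S) =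
    1 / (2 * √(metricMatrix u y).det) *
      (2 * (√(metricMatrix u y).det * √(metricMatrix u y).det) * S) from fun S => by rw [← h6]]
  field_simp

/-- Differentiating g g⁻¹ = 1, valid near y because det g ≠ 0 there, gives ∂g⁻¹ = -g⁻¹ (∂g) g⁻¹. -/
lemma pderiv_metricMatrix_inv (hu : ContDiffAt ℝ 2 u y)
    (hinj : Function.Injective (fderiv ℝ u y)) (i a b : Fin m) :
    pderiv i (fun z => (metricMatrix u z)⁻¹ a b) y = -∑ k, ∑ l, (metricMatrix u y)⁻¹ a k *
      (inner ℝ (pderiv i (pderiv k u) y) (pderiv l u y)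
        + inner ℝ (pderiv i (pderiv l u) y) (pderiv k u y)) * (metricMatrix u y)⁻¹ l b := by
  have hpos := det_metricMatrix_pos hinj
  have hg : ∀ k l, DifferentiableAt ℝ (fun z => metricMatrix u z k l) y := fun k l =>
    (contDiffAt_metricMatrix (k := 1) hu (by norm_num) k l).differentiableAt (by norm_num)
  have hh : ∀ k l, DifferentiableAt ℝ (fun z => (metricMatrix u z)⁻¹ k l) y := fun k l =>
    (contDiffAt_metricMatrix_inv (k := 1) hu (by norm_num) hinj k l).differentiableAt (by norm_num)
  have hev : ∀ᶠ z in 𝓝 y, IsUnit (metricMatrix u z).det := by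
    have hc : ContinuousAt (fun z => (metricMatrix u z).det) y :=
      (contDiffAt_det (contDiffAt_metricMatrix (k := 1) hu (by norm_num))).continuousAt
    exact (hc.eventually_ne hpos.ne').mono fun z hz => isUnit_iff_ne_zero.2 hz
  have h1 : ∀ k b, ∑ l, (metricMatrix u y k l * pderiv i (fun z => (metricMatrix u z)⁻¹ l b) y
      + pderiv i (fun z => metricMatrix u z k l) y * (metricMatrix u y)⁻¹ l b) = 0 := by
    intro k b
    have e1 : (fun z => ∑ l, metricMatrix u z k l * (metricMatrix u z)⁻¹ l b)
        =ᶠ[𝓝 y] fun _ => (1 : Matrix (Fin m) (Fin m) ℝ) k b := by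
      filter_upwards [hev] with z hz
      rw [← Matrix.mul_apply, Matrix.mul_nonsing_inv _ hz]
    have e2 := pderiv_congr e1 i
    rw [pderiv_sum fun l _ => (hg k l).fun_mul (hh l b)] at e2
    simp only [pderiv_mul (hg k _) (hh _ b)] at e2
    rw [e2]
    simp [pderiv]
  have hu' : IsUnit (metricMatrix u y).det := hpos.ne'.isUnit
  let N : Matrix (Fin m) (Fin m) ℝ := Matrix.of fun l b => pderiv i (fun z => (metricMatrix u z)⁻¹ l b) y
  let B : Matrix (Fin m) (Fin m) ℝ := Matrix.of fun k l => pderiv i (fun z => metricMatrix u z k l) y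
  have h2 : metricMatrix u y * N = -(B * (metricMatrix u y)⁻¹) := by
    ext k b
    have := h1 k b
    rw [Finset.sum_add_distrib] at this
    simp only [Matrix.mul_apply, Matrix.neg_apply]
    exact eq_neg_of_add_eq_zero_left this
  have h3 : N = -((metricMatrix u y)⁻¹ * (B * (metricMatrix u y)⁻¹)) := by
    rw [← Matrix.mul_neg, ← h2, ← Matrix.mul_assoc, Matrix.nonsing_inv_mul _ hu', Matrix.one_mul]
  have h4 := congr_fun (congr_fun h3 a) b
  rw [show pderiv i (fun z => (metricMatrix u z)⁻¹ a b) y = N a b from rfl, h4]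
  simp only [Matrix.neg_apply, Matrix.mul_apply, Finset.mul_sum, ← pderiv_metricMatrix hu, mul_assoc]
  rfl

/-- The algebra behind `patchLaplacian_eq`, with h = g⁻¹, b i k l = ⟨∂ᵢ∂ₖu, ∂ₗu⟩, p = ∂w and q =
∂²w. The derivative of the volume density cancels one half of the derivative of g⁻¹ after
relabelling; the other half is the Christoffel term. -/
lemma sum_christoffel_identity {h : Fin m → Fin m → ℝ} (hsym : ∀ i j, h i j = h j i)
    {b : Fin m → Fin m → Fin m → ℝ} (hb : ∀ i k l, b i k l = b k i l) (p : Fin m → ℝ)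
    (q : Fin m → Fin m → ℝ) :
    ∑ i, (∑ j, (h i j * q i j
        + (-∑ k, ∑ l, h i k * (b i k l + b i l k) * h l j) * p j)
        + (∑ k, ∑ l, h k l * b i k l) * ∑ j, h i j * p j)
      = ∑ i, ∑ j, h i j * (q i j - ∑ k, ∑ l, h k l * b i j l * p k) := by
  have h1 : ∑ i, (∑ k, ∑ l, h k l * b i k l) * ∑ j, h i j * p j
      = ∑ i, ∑ j, ∑ k, ∑ l, h i k * b i l k * h l j * p j := by
    have e1 : ∀ i, (∑ k, ∑ l, h k l * b i k l) * ∑ j, h i j * p j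
        = ∑ k, ∑ l, ∑ j, h k l * b i k l * (h i j * p j) := fun i => by
      simp only [Finset.sum_mul]
      simp only [Finset.mul_sum]
    simp only [e1]
    rw [Finset.sum_comm]
    refine Finset.sum_congr rfl fun k _ => ?_
    have e2 : ∀ i, ∑ l, ∑ j, h k l * b i k l * (h i j * p j)
        = ∑ j, ∑ l, h k l * b i k l * (h i j * p j) := fun i => Finset.sum_comm
    simp only [e2]
    rw [Finset.sum_comm]
    refine Finset.sum_congr rfl fun j _ => ?_
    rw [Finset.sum_comm]
    refine Finset.sum_congr rfl fun l _ => Finset.sum_congr rfl fun i _ => ?_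
    rw [hb i k l]
    ring
  have h2 : ∑ i, ∑ j, h i j * ∑ k, ∑ l, h k l * b i j l * p k
      = ∑ i, ∑ j, ∑ k, ∑ l, h i k * b i k l * h l j * p j := by
    refine Finset.sum_congr rfl fun i _ => ?_
    simp only [Finset.mul_sum]
    rw [Finset.sum_comm]
    refine Finset.sum_congr rfl fun j _ => Finset.sum_congr rfl fun k _ =>
      Finset.sum_congr rfl fun l _ => ?_
    rw [hsym j l]
    ring
  simp only [mul_sub, Finset.sum_sub_distrib, Finset.sum_add_distrib]
  rw [h1, h2, add_assoc, sub_eq_add_neg]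
  congr 1
  simp only [← Finset.sum_neg_distrib, ← Finset.sum_add_distrib]
  refine Finset.sum_congr rfl fun i _ => Finset.sum_congr rfl fun j _ => ?_
  simp only [neg_mul, Finset.sum_mul, ← Finset.sum_add_distrib]
  exact Finset.sum_congr rfl fun k _ => Finset.sum_congr rfl fun l _ => by ring

/-- The non-divergence form of the Laplace-Beltrami operator. -/
lemma patchLaplacian_eq (hu : ContDiffAt ℝ 2 u y) (hinj : Function.Injective (fderiv ℝ u y))
    {w : Euc m → ℝ} (hw : ContDiffAt ℝ 2 w y) :
    patchLaplacian u w y = ∑ i, ∑ j, (metricMatrix u y)⁻¹ i j *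
      (pderiv i (pderiv j w) y - ∑ k, ∑ l, (metricMatrix u y)⁻¹ k l *
        inner ℝ (pderiv i (pderiv j u) y) (pderiv l u y) * pderiv k w y) := by
  have hD : DifferentiableAt ℝ (volDensity u) y :=
    (contDiffAt_volDensity (k := 1) hu (by norm_num) hinj).differentiableAt (by norm_num)
  have hh : ∀ k l, DifferentiableAt ℝ (fun z => (metricMatrix u z)⁻¹ k l) y := fun k l =>
    (contDiffAt_metricMatrix_inv (k := 1) hu (by norm_num) hinj k l).differentiableAt (by norm_num)
  have hp : ∀ a, DifferentiableAt ℝ (pderiv a w) y := fun a =>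
    (contDiffAt_pderiv (k := 1) hw (by norm_num) a).differentiableAt (by norm_num)
  have hDpos := volDensity_pos hinj
  set D := volDensity u y with hDdef
  have e1 : ∀ i, pderiv i (fun z => volDensity u z * ∑ j : Fin m,
      (metricMatrix u z)⁻¹ i j * pderiv j w z) y
      = D * (∑ j, ((metricMatrix u y)⁻¹ i j * pderiv i (pderiv j w) y
          + pderiv i (fun z => (metricMatrix u z)⁻¹ i j) y * pderiv j w y)
        + (∑ k, ∑ l, (metricMatrix u y)⁻¹ k l *
            inner ℝ (pderiv i (pderiv k u) y) (pderiv l u y)) *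
          ∑ j, (metricMatrix u y)⁻¹ i j * pderiv j w y) := by
    intro i
    rw [pderiv_mul hD (DifferentiableAt.fun_sum fun j _ => (hh i j).fun_mul (hp j)),
      pderiv_sum fun j _ => (hh i j).fun_mul (hp j), pderiv_volDensity hu hinj]
    simp only [pderiv_mul (hh i _) (hp _)]
    rw [← hDdef]
    ring
  rw [patchLaplacian, ← hDdef]
  simp only [e1]
  rw [← Finset.mul_sum, inv_mul_cancel_left₀ hDpos.ne']
  simp only [pderiv_metricMatrix_inv hu hinj]
  exact sum_christoffel_identity (metricMatrix_inv_comm u y)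
    (b := fun i k l => inner ℝ (pderiv i (pderiv k u) y) (pderiv l u y))
    (fun i k l => by rw [pderiv_pderiv_comm hu]) _ _

end PatchCalculus

/-! ### Invariance under reparametrization -/

section PatchInvariance

variable {m d : ℕ}

lemma pderiv_comp {V : Type*} [NormedAddCommGroup V] [NormedSpace ℝ V] {w : Euc m → V}
    {τ : Euc m → Euc m} {y : Euc m} (hw : DifferentiableAt ℝ w (τ y))
    (hτ : DifferentiableAt ℝ τ y) (i : Fin m) :
    pderiv i (w ∘ τ) y = ∑ a, pderiv i τ y a • pderiv a w (τ y) := by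
  rw [pderiv, fderiv_comp _ hw hτ, ContinuousLinearMap.comp_apply, fderiv_eq_sum_pderiv]
  rfl

lemma pderiv_smul {V : Type*} [NormedAddCommGroup V] [NormedSpace ℝ V] {c : Euc m → ℝ}
    {w : Euc m → V} {y : Euc m} (hc : DifferentiableAt ℝ c y) (hw : DifferentiableAt ℝ w y)
    (i : Fin m) :
    pderiv i (fun z => c z • w z) y = c y • pderiv i w y + pderiv i c y • w y := by
  simp [pderiv, fderiv_fun_smul hc hw]

lemma pderiv_apply {k : ℕ} {τ : Euc m → Euc k} {y : Euc m} (hτ : DifferentiableAt ℝ τ y)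
    (i : Fin m) (a : Fin k) : pderiv i (fun z => τ z a) y = pderiv i τ y a := by
  have := ((EuclideanSpace.proj (𝕜 := ℝ) a).hasFDerivAt.comp y hτ.hasFDerivAt)
  exact pderiv_of_hasFDerivAt this i

lemma pderiv_pderiv_comp {V : Type*} [NormedAddCommGroup V] [NormedSpace ℝ V] {w : Euc m → V}
    {τ : Euc m → Euc m} {y : Euc m} (hw : ContDiffAt ℝ 2 w (τ y))
    (hτ : ContDiffAt ℝ 2 τ y) (i j : Fin m) :
    pderiv i (pderiv j (w ∘ τ)) y
      = ∑ a, ∑ b, (pderiv i τ y a * pderiv j τ y b) • pderiv a (pderiv b w) (τ y)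
        + ∑ a, pderiv i (pderiv j τ) y a • pderiv a w (τ y) := by
  have hev : pderiv j (w ∘ τ) =ᶠ[𝓝 y]
      fun z => ∑ b, (fun z => pderiv j τ z b) z • (pderiv b w ∘ τ) z := by
    have h1 := hτ.continuousAt.eventually (hw.eventually (by simp))
    filter_upwards [h1, hτ.eventually (by simp)] with z hz1 hz2
    exact pderiv_comp (hz1.differentiableAt (by norm_num)) (hz2.differentiableAt (by norm_num)) j
  have d1 : DifferentiableAt ℝ (pderiv j τ) y :=
    (contDiffAt_pderiv (k := 1) hτ (by norm_num) j).differentiableAt (by norm_num)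
  have d2 : ∀ b, DifferentiableAt ℝ (fun z => pderiv j τ z b) y := fun b =>
    (EuclideanSpace.proj (𝕜 := ℝ) b).differentiableAt.comp y d1
  have d3 : ∀ b, DifferentiableAt ℝ (pderiv b w) (τ y) := fun b =>
    (contDiffAt_pderiv (k := 1) hw (by norm_num) b).differentiableAt (by norm_num)
  have dτ : DifferentiableAt ℝ τ y := hτ.differentiableAt (by norm_num)
  have d4 : ∀ b, DifferentiableAt ℝ (pderiv b w ∘ τ) y := fun b => (d3 b).comp y dτ
  rw [pderiv_congr hev, pderiv_sum fun b _ => (d2 b).fun_smul (d4 b)]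
  simp only [pderiv_smul (d2 _) (d4 _), pderiv_comp (d3 _) dτ, pderiv_apply d1]
  rw [Finset.sum_add_distrib]
  congr 1
  simp only [Finset.smul_sum, smul_smul]
  rw [Finset.sum_comm]
  exact Finset.sum_congr rfl fun a _ => Finset.sum_congr rfl fun b _ => by rw [mul_comm]

/-- The Jacobian matrix of a map. -/
def jacobian (τ : Euc m → Euc m) (y : Euc m) : Matrix (Fin m) (Fin m) ℝ :=
  Matrix.of fun a i => pderiv i τ y a

variable {u : Euc m → Euc d} {τ : Euc m → Euc m} {y : Euc m}

lemma det_jacobian (τ : Euc m → Euc m) (y : Euc m) :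
    (jacobian τ y).det = (fderiv ℝ τ y).det := by
  rw [ContinuousLinearMap.det, ← LinearMap.det_toMatrix (EuclideanSpace.basisFun (Fin m) ℝ).toBasis]
  congr 1

lemma metricMatrix_comp (hu : DifferentiableAt ℝ u (τ y)) (hτ : DifferentiableAt ℝ τ y) :
    metricMatrix (u ∘ τ) y = (jacobian τ y)ᵀ * metricMatrix u (τ y) * jacobian τ y := by
  ext i j
  simp only [metricMatrix, Matrix.of_apply, pderiv_comp hu hτ, sum_inner, inner_sum,
    inner_smul_left, inner_smul_right, Matrix.mul_apply, Matrix.transpose_apply, jacobian,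
    conj_trivial, Finset.sum_mul, Finset.mul_sum]
  exact Finset.sum_congr rfl fun a _ => Finset.sum_congr rfl fun b _ => by ring

lemma volDensity_comp (hu : DifferentiableAt ℝ u (τ y)) (hτ : DifferentiableAt ℝ τ y) :
    volDensity (u ∘ τ) y = |(fderiv ℝ τ y).det| * volDensity u (τ y) := by
  rw [volDensity, metricMatrix_comp hu hτ, Matrix.det_mul, Matrix.det_mul, Matrix.det_transpose,
    det_jacobian, volDensity, ← Real.sqrt_sq_eq_abs, ← Real.sqrt_mul (sq_nonneg _)]
  congr 1
  ring

lemma jacobian_mul_metricMatrix_inv (hu : DifferentiableAt ℝ u (τ y))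
    (hτ : DifferentiableAt ℝ τ y) (hdet : (fderiv ℝ τ y).det ≠ 0) :
    jacobian τ y * (metricMatrix (u ∘ τ) y)⁻¹ * (jacobian τ y)ᵀ = (metricMatrix u (τ y))⁻¹ := by
  have hJ : IsUnit (jacobian τ y).det := by rw [det_jacobian]; exact hdet.isUnit
  have hJ' : IsUnit (jacobian τ y)ᵀ.det := by rwa [Matrix.det_transpose]
  rw [metricMatrix_comp hu hτ, Matrix.mul_inv_rev, Matrix.mul_inv_rev, ← Matrix.mul_assoc,
    Matrix.mul_nonsing_inv _ hJ, Matrix.one_mul, Matrix.mul_assoc, Matrix.nonsing_inv_mul _ hJ',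
    Matrix.mul_one]

lemma sum_congruence {J h : Matrix (Fin m) (Fin m) ℝ} (T : Fin m → Fin m → ℝ) :
    ∑ i, ∑ j, h i j * ∑ a, ∑ b, J a i * J b j * T a b
      = ∑ a, ∑ b, (J * h * Jᵀ) a b * T a b := by
  simp only [Matrix.mul_apply, Matrix.transpose_apply, Finset.mul_sum, Finset.sum_mul]
  have e : ∀ i, ∑ j, ∑ a, ∑ b, h i j * (J a i * J b j * T a b)
      = ∑ a, ∑ b, ∑ j, h i j * (J a i * J b j * T a b) := fun i => by
    rw [Finset.sum_comm]
    exact Finset.sum_congr rfl fun a _ => Finset.sum_comm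
  simp only [e]
  rw [Finset.sum_comm]
  refine Finset.sum_congr rfl fun a _ => ?_
  rw [Finset.sum_comm]
  refine Finset.sum_congr rfl fun b _ => ?_
  rw [Finset.sum_comm]
  exact Finset.sum_congr rfl fun j _ => Finset.sum_congr rfl fun i _ => by ring

/-- The derivative of `w` along the tangential part of `v`. -/
def tangentialDeriv (u : Euc m → Euc d) (w : Euc m → ℝ) (y : Euc m) (v : Euc d) : ℝ :=
  ∑ k, ∑ l, (metricMatrix u y)⁻¹ k l * inner ℝ v (pderiv l u y) * pderiv k w y

lemma tangentialDeriv_add (u : Euc m → Euc d) (w : Euc m → ℝ) (y : Euc m) (v v' : Euc d) :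
    tangentialDeriv u w y (v + v') = tangentialDeriv u w y v + tangentialDeriv u w y v' := by
  simp only [tangentialDeriv, inner_add_left, mul_add, add_mul, Finset.sum_add_distrib]

lemma tangentialDeriv_smul (u : Euc m → Euc d) (w : Euc m → ℝ) (y : Euc m) (c : ℝ) (v : Euc d) :
    tangentialDeriv u w y (c • v) = c * tangentialDeriv u w y v := by
  simp only [tangentialDeriv, inner_smul_left, conj_trivial, Finset.mul_sum]
  exact Finset.sum_congr rfl fun k _ => Finset.sum_congr rfl fun l _ => by ring

lemma tangentialDeriv_sum {ι : Type*} (s : Finset ι) (u : Euc m → Euc d) (w : Euc m → ℝ)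
    (y : Euc m) (v : ι → Euc d) :
    tangentialDeriv u w y (∑ a ∈ s, v a) = ∑ a ∈ s, tangentialDeriv u w y (v a) :=
  map_sum (AddMonoidHom.mk' (tangentialDeriv u w y) (tangentialDeriv_add u w y)) v s

/-- The sum over l recovers the coordinates of the tangent vector ∂ₐu by g⁻¹g = 1. This is what
cancels the second derivatives of a coordinate change in `patchLaplacian_comp`. -/
lemma tangentialDeriv_pderiv (hinj : Function.Injective (fderiv ℝ u y)) (w : Euc m → ℝ)
    (a : Fin m) : tangentialDeriv u w y (pderiv a u y) = pderiv a w y := by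
  have hunit : IsUnit (metricMatrix u y).det := (det_metricMatrix_pos hinj).ne'.isUnit
  have h := Matrix.nonsing_inv_mul _ hunit
  have h1 : ∀ k, ∑ l, (metricMatrix u y)⁻¹ k l * inner ℝ (pderiv a u y) (pderiv l u y)
      = if k = a then 1 else 0 := by
    intro k
    rw [← Matrix.one_apply, ← h, Matrix.mul_apply]
    refine Finset.sum_congr rfl fun l _ => ?_
    rw [metricMatrix_comm]
    rfl
  simp only [tangentialDeriv, ← Finset.sum_mul, h1]
  simp

lemma tangentialDeriv_comp (hu : DifferentiableAt ℝ u (τ y)) (hτ : DifferentiableAt ℝ τ y)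
    (hdet : (fderiv ℝ τ y).det ≠ 0) {w : Euc m → ℝ} (hw : DifferentiableAt ℝ w (τ y)) (v : Euc d) :
    tangentialDeriv (u ∘ τ) (w ∘ τ) y v = tangentialDeriv u w (τ y) v := by
  have h := sum_congruence (J := jacobian τ y) (h := (metricMatrix (u ∘ τ) y)⁻¹)
    fun k l => inner ℝ v (pderiv l u (τ y)) * pderiv k w (τ y)
  rw [jacobian_mul_metricMatrix_inv hu hτ hdet] at h
  simp only [tangentialDeriv, pderiv_comp hu hτ, pderiv_comp hw hτ, mul_assoc]
  rw [← h]
  refine Finset.sum_congr rfl fun k _ => Finset.sum_congr rfl fun l _ => ?_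
  congr 1
  simp only [inner_sum, inner_smul_right, smul_eq_mul, Finset.mul_sum, Finset.sum_mul, jacobian,
    Matrix.of_apply]
  exact Finset.sum_congr rfl fun a _ => Finset.sum_congr rfl fun b _ => by ring

lemma patchLaplacian_eq_tangentialDeriv (hu : ContDiffAt ℝ 2 u y)
    (hinj : Function.Injective (fderiv ℝ u y)) {w : Euc m → ℝ} (hw : ContDiffAt ℝ 2 w y) :
    patchLaplacian u w y = ∑ i, ∑ j, (metricMatrix u y)⁻¹ i j *
      (pderiv i (pderiv j w) y - tangentialDeriv u w y (pderiv i (pderiv j u) y)) :=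
  patchLaplacian_eq hu hinj hw

/-- The Laplacian does not depend on the parametrization. -/
lemma patchLaplacian_comp (hu : ContDiffAt ℝ 2 u (τ y)) (hτ : ContDiffAt ℝ 2 τ y)
    (hinj : Function.Injective (fderiv ℝ u (τ y))) (hdet : (fderiv ℝ τ y).det ≠ 0)
    {w : Euc m → ℝ} (hw : ContDiffAt ℝ 2 w (τ y)) :
    patchLaplacian (u ∘ τ) (w ∘ τ) y = patchLaplacian u w (τ y) := by
  have du : DifferentiableAt ℝ u (τ y) := hu.differentiableAt (by norm_num)
  have dτ : DifferentiableAt ℝ τ y := hτ.differentiableAt (by norm_num)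
  have dw : DifferentiableAt ℝ w (τ y) := hw.differentiableAt (by norm_num)
  have hinj' : Function.Injective (fderiv ℝ (u ∘ τ) y) := by
    rw [fderiv_comp _ du dτ]
    refine hinj.comp ?_
    exact (LinearMap.equivOfDetNeZero _ hdet).injective
  rw [patchLaplacian_eq_tangentialDeriv (hu.comp y hτ) hinj' (hw.comp y hτ),
    patchLaplacian_eq_tangentialDeriv hu hinj hw]
  -- The second derivatives of τ enter ∂ᵢ∂ⱼ(w ∘ τ) and the tangential derivative along ∂ᵢ∂ⱼ(u ∘ τ)
  -- through the same sum and drop out; the rest transforms as a bilinear form.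
  simp only [tangentialDeriv_comp du dτ hdet dw, pderiv_pderiv_comp hu hτ,
    pderiv_pderiv_comp hw hτ, tangentialDeriv_add, tangentialDeriv_sum, tangentialDeriv_smul,
    tangentialDeriv_pderiv hinj, smul_eq_mul, add_sub_add_right_eq_sub]
  rw [← jacobian_mul_metricMatrix_inv du dτ hdet, ← sum_congruence]
  refine Finset.sum_congr rfl fun i _ => Finset.sum_congr rfl fun j _ => ?_
  congr 1
  simp only [← Finset.sum_sub_distrib, ← mul_sub]
  rfl

lemma patchLaplacian_congr {u' : Euc m → Euc d} {w w' : Euc m → ℝ} (hu : u =ᶠ[𝓝 y] u')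
    (hw : w =ᶠ[𝓝 y] w') : patchLaplacian u w y = patchLaplacian u' w' y := by
  have hm : metricMatrix u =ᶠ[𝓝 y] metricMatrix u' := by
    have h : ∀ᶠ z in 𝓝 y, ∀ i, pderiv i u z = pderiv i u' z :=
      eventually_all.2 fun i => pderiv_eventuallyEq hu i
    filter_upwards [h] with z hz
    ext i j
    simp only [metricMatrix, Matrix.of_apply, hz]
  have hw' : ∀ᶠ z in 𝓝 y, ∀ i, pderiv i w z = pderiv i w' z :=
      eventually_all.2 fun i => pderiv_eventuallyEq hw i
  simp only [patchLaplacian, volDensity, hm.self_of_nhds]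
  congr 1
  refine Finset.sum_congr rfl fun i _ => pderiv_congr ?_ i
  filter_upwards [hm, hw'] with z hz hz'
  simp only [hz, hz']

lemma patchLaplacian_sum {ι : Type*} {s : Finset ι} (hu : ContDiffAt ℝ 2 u y)
    (hinj : Function.Injective (fderiv ℝ u y)) {w : ι → Euc m → ℝ}
    (hw : ∀ a ∈ s, ContDiffAt ℝ 2 (w a) y) :
    patchLaplacian u (fun z => ∑ a ∈ s, w a z) y = ∑ a ∈ s, patchLaplacian u (w a) y := by
  have h1 : ∀ i, pderiv i (fun z => ∑ a ∈ s, w a z) =ᶠ[𝓝 y] fun z => ∑ a ∈ s, pderiv i (w a) z := by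
    intro i
    have : ∀ᶠ z in 𝓝 y, ∀ a ∈ s, ContDiffAt ℝ 2 (w a) z :=
      (Finset.eventually_all s).2 fun a ha => (hw a ha).eventually (by simp)
    filter_upwards [this] with z hz
    exact pderiv_sum (fun a ha => (hz a ha).differentiableAt (by norm_num)) i
  have h2 : ∀ i j, pderiv i (pderiv j (fun z => ∑ a ∈ s, w a z)) y
      = ∑ a ∈ s, pderiv i (pderiv j (w a)) y := by
    intro i j
    rw [pderiv_congr (h1 j)]
    exact pderiv_sum (fun a ha =>
      (contDiffAt_pderiv (k := 1) (hw a ha) (by norm_num) j).differentiableAt (by norm_num)) i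
  have h3 : ∀ v, tangentialDeriv u (fun z => ∑ a ∈ s, w a z) y v
      = ∑ a ∈ s, tangentialDeriv u (w a) y v := by
    intro v
    simp only [tangentialDeriv, (h1 _).self_of_nhds, Finset.mul_sum]
    symm
    rw [Finset.sum_comm]
    exact Finset.sum_congr rfl fun k _ => Finset.sum_comm
  rw [patchLaplacian_eq_tangentialDeriv hu hinj (ContDiffAt.sum hw),
    Finset.sum_congr rfl fun a ha => patchLaplacian_eq_tangentialDeriv hu hinj (hw a ha)]
  simp only [h2, h3, ← Finset.sum_sub_distrib, Finset.mul_sum]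
  symm
  rw [Finset.sum_comm]
  exact Finset.sum_congr rfl fun k _ => Finset.sum_comm

end PatchInvariance

/-! ### The Laplacian of a radial function -/

section MeanCurvature

variable {m d : ℕ} {u : Euc m → Euc d} {y : Euc m}

lemma normalPart_eq (hinj : Function.Injective (fderiv ℝ u y)) (v : Euc d) :
    normalPart u y v = v - ∑ k, ∑ l,
      ((metricMatrix u y)⁻¹ k l * inner ℝ v (pderiv l u y)) • pderiv k u y := by
  have h := starProjection_span_eq (linearIndependent_pderiv hinj) v
  have hK : ∀ (K K' : Submodule ℝ (Euc d)) [K.HasOrthogonalProjection]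
      [K'.HasOrthogonalProjection], K = K' → K.starProjection v = K'.starProjection v := by
    intro K K' _ _ hKK
    subst hKK
    rfl
  rw [normalPart, Submodule.starProjection_orthogonal_val, hK _ _ (range_fderiv_eq_span u y), h]
  rfl

/-- The Hessian of G(|u|²) contains 2G'(g_{ij} + ⟨u, ∂ᵢ∂ⱼu⟩). The Christoffel term removes the
tangential part of ∂ᵢ∂ⱼu, leaving the second fundamental form, and the trace is m + ⟨u, H⟩. The term
with G'' carries the squared length of the tangential part of u. -/
lemma patchLaplacian_comp_normSq (hu : ContDiffAt ℝ 2 u y)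
    (hinj : Function.Injective (fderiv ℝ u y)) {G G' G'' : ℝ → ℝ} (hG2 : ContDiff ℝ 2 G)
    (hG : ∀ t, HasDerivAt G (G' t) t) (hG' : ∀ t, HasDerivAt G' (G'' t) t) :
    patchLaplacian u (fun z => G (‖u z‖ ^ 2)) y
      = 2 * G' (‖u y‖ ^ 2) * (m + inner ℝ (u y) (patchMeanCurvature u y))
        + 4 * G'' (‖u y‖ ^ 2) * ∑ i, ∑ j, (metricMatrix u y)⁻¹ i j *
            inner ℝ (u y) (pderiv i u y) * inner ℝ (u y) (pderiv j u y) := by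
  have du : DifferentiableAt ℝ u y := hu.differentiableAt (by norm_num)
  have dpu : ∀ j, DifferentiableAt ℝ (pderiv j u) y := fun j =>
    (contDiffAt_pderiv (k := 1) hu (by norm_num) j).differentiableAt (by norm_num)
  have hw : ContDiffAt ℝ 2 (fun z => G (‖u z‖ ^ 2)) y :=
    hG2.contDiffAt.comp y (hu.norm_sq ℝ)
  have hcomp : ∀ {K K' : ℝ → ℝ}, (∀ t, HasDerivAt K (K' t) t) → ∀ z, DifferentiableAt ℝ u z →
      ∀ i, pderiv i (fun z => K (‖u z‖ ^ 2)) z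
        = 2 * K' (‖u z‖ ^ 2) * inner ℝ (u z) (pderiv i u z) := by
    intro K K' hK z hz i
    have := (hK (‖u z‖ ^ 2)).comp_hasFDerivAt z hz.hasFDerivAt.norm_sq
    refine (pderiv_of_hasFDerivAt this i).trans ?_
    simp [pderiv]
    ring
  have dK : DifferentiableAt ℝ (fun z => 2 * G' (‖u z‖ ^ 2)) y :=
    (((hG' (‖u y‖ ^ 2)).comp_hasFDerivAt y du.hasFDerivAt.norm_sq).const_mul 2).differentiableAt
  have h1 : ∀ i j, pderiv i (pderiv j fun z => G (‖u z‖ ^ 2)) y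
      = 4 * G'' (‖u y‖ ^ 2) * inner ℝ (u y) (pderiv i u y) * inner ℝ (u y) (pderiv j u y)
        + 2 * G' (‖u y‖ ^ 2) * (inner ℝ (u y) (pderiv i (pderiv j u) y)
          + metricMatrix u y i j) := by
    intro i j
    have : pderiv j (fun z => G (‖u z‖ ^ 2)) =ᶠ[𝓝 y]
        fun z => (2 * G' (‖u z‖ ^ 2)) * inner ℝ (u z) (pderiv j u z) := by
      filter_upwards [hu.eventually (by simp)] with z hz
      exact hcomp hG z (hz.differentiableAt (by norm_num)) j
    have e2 : pderiv i (fun z => 2 * G' (‖u z‖ ^ 2)) y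
        = 4 * G'' (‖u y‖ ^ 2) * inner ℝ (u y) (pderiv i u y) := by
      rw [hcomp (K := fun t => 2 * G' t) (K' := fun t => 2 * G'' t)
        (fun t => (hG' t).const_mul 2) y du]
      ring
    rw [pderiv_congr this, pderiv_mul dK (du.inner ℝ (dpu j)), e2, pderiv_inner du (dpu j)]
    simp only [metricMatrix, Matrix.of_apply]
    ring
  have h2 : ∀ v, tangentialDeriv u (fun z => G (‖u z‖ ^ 2)) y v
      = 2 * G' (‖u y‖ ^ 2) * (inner ℝ (u y) v - inner ℝ (u y) (normalPart u y v)) := by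
    intro v
    rw [normalPart_eq hinj, inner_sub_right, sub_sub_cancel]
    simp only [tangentialDeriv, hcomp hG y du, inner_sum, inner_smul_right, Finset.mul_sum]
    exact Finset.sum_congr rfl fun k _ => Finset.sum_congr rfl fun l _ => by ring
  have hunit : IsUnit (metricMatrix u y).det := (det_metricMatrix_pos hinj).ne'.isUnit
  have h3 : ∑ i, ∑ j, (metricMatrix u y)⁻¹ i j * metricMatrix u y i j = m := by
    have : ∑ i, ((metricMatrix u y)⁻¹ * metricMatrix u y) i i = m := by
      rw [Matrix.nonsing_inv_mul _ hunit]
      simp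
    rw [← this]
    refine Finset.sum_congr rfl fun i _ => ?_
    rw [Matrix.mul_apply]
    exact Finset.sum_congr rfl fun j _ => by rw [metricMatrix_comm]
  rw [patchLaplacian_eq_tangentialDeriv hu hinj hw, ← h3]
  simp only [h1, h2, patchMeanCurvature, patchSecondFF, inner_sum, inner_smul_right,
    Finset.mul_sum, ← Finset.sum_add_distrib]
  exact Finset.sum_congr rfl fun k _ => Finset.sum_congr rfl fun l _ => by ring

lemma sum_metricMatrix_inv_inner_le (hinj : Function.Injective (fderiv ℝ u y)) (v : Euc d) :
    ∑ i, ∑ j, (metricMatrix u y)⁻¹ i j * inner ℝ v (pderiv i u y) * inner ℝ v (pderiv j u y)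
      ≤ ‖v‖ ^ 2 :=
  sum_gram_inv_inner_le (linearIndependent_pderiv hinj) v

end MeanCurvature

/-! ### Green's identity in a parametrization -/

section Green

variable {m d : ℕ} {u : Euc m → Euc d} {Ω : Set (Euc m)}

lemma contDiffAt_flux {u : Euc m → Euc d} {y : Euc m} (hu : ContDiffAt ℝ 2 u y)
    (hinj : Function.Injective (fderiv ℝ u y)) {w : Euc m → ℝ} (hw : ContDiffAt ℝ 2 w y)
    (i : Fin m) :
    ContDiffAt ℝ 1 (fun z => volDensity u z * ∑ j, (metricMatrix u z)⁻¹ i j * pderiv j w z) y :=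
  (contDiffAt_volDensity hu (by norm_num) hinj).mul <| ContDiffAt.sum fun j _ =>
    (contDiffAt_metricMatrix_inv hu (by norm_num) hinj i j).mul
      (contDiffAt_pderiv hw (by norm_num) j)

lemma volDensity_mul_patchLaplacian {y : Euc m} (hinj : Function.Injective (fderiv ℝ u y))
    (w : Euc m → ℝ) : volDensity u y * patchLaplacian u w y = ∑ i : Fin m,
      pderiv i (fun z => volDensity u z * ∑ j, (metricMatrix u z)⁻¹ i j * pderiv j w z) y := by
  rw [patchLaplacian, mul_inv_cancel_left₀ (volDensity_pos hinj).ne']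

lemma continuousAt_patchLaplacian {y : Euc m} (hu : ContDiffAt ℝ 2 u y)
    (hinj : ∀ᶠ z in 𝓝 y, Function.Injective (fderiv ℝ u z)) {w : Euc m → ℝ}
    (hw : ContDiffAt ℝ 2 w y) : ContinuousAt (patchLaplacian u w) y :=
  ((contDiffAt_volDensity (k := 0) hu (by norm_num) hinj.self_of_nhds).continuousAt.inv₀
    (volDensity_pos hinj.self_of_nhds).ne').mul <| tendsto_finsetSum _ fun i _ =>
      (contDiffAt_pderiv (k := 0) (contDiffAt_flux hu hinj.self_of_nhds hw i)
        (by norm_num) i).continuousAt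

lemma integrable_of_tsupport_subset {k : Euc m → ℝ} (hΩ : IsOpen Ω) (hk : ContinuousOn k Ω)
    (hs : tsupport k ⊆ Ω) (hc : HasCompactSupport k) : Integrable k :=
  (hk.continuous_of_tsupport_subset hΩ hs).integrable_of_hasCompactSupport hc

lemma tsupport_pderiv_subset (ψ : Euc m → ℝ) (i : Fin m) : tsupport (pderiv i ψ) ⊆ tsupport ψ := by
  refine closure_minimal (fun y hy => ?_) (isClosed_tsupport ψ)
  refine tsupport_fderiv_subset ℝ (subset_tsupport _ ?_)
  rw [Function.mem_support] at hy ⊢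
  intro h
  exact hy (by rw [pderiv, h]; rfl)

/-- Green's second identity in a patch. -/
lemma integral_mul_patchLaplacian_comm (hΩ : IsOpen Ω) (hu : ContDiffOn ℝ 2 u Ω)
    (hinj : ∀ y ∈ Ω, Function.Injective (fderiv ℝ u y)) {ψ w : Euc m → ℝ}
    (hψ : ContDiffOn ℝ 2 ψ Ω) (hw : ContDiffOn ℝ 2 w Ω) (hs : tsupport ψ ⊆ Ω)
    (hc : HasCompactSupport ψ) :
    ∫ y, volDensity u y * (ψ y * patchLaplacian u w y)
      = ∫ y, volDensity u y * (w y * patchLaplacian u ψ y) := by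
  have hu' : ∀ y ∈ Ω, ContDiffAt ℝ 2 u y := fun y hy => hu.contDiffAt (hΩ.mem_nhds hy)
  have hψ' : ∀ y ∈ Ω, ContDiffAt ℝ 2 ψ y := fun y hy => hψ.contDiffAt (hΩ.mem_nhds hy)
  have hw' : ∀ y ∈ Ω, ContDiffAt ℝ 2 w y := fun y hy => hw.contDiffAt (hΩ.mem_nhds hy)
  -- The density-weighted gradient: its coordinate divergence is √det g times the Laplacian of v, so
  -- coordinatewise integration by parts against Lebesgue measure suffices.
  let X (v : Euc m → ℝ) (i : Fin m) (z : Euc m) : ℝ :=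
    volDensity u z * ∑ j, (metricMatrix u z)⁻¹ i j * pderiv j v z
  have hX : ∀ {v : Euc m → ℝ}, (∀ y ∈ Ω, ContDiffAt ℝ 2 v y) → ∀ i, ∀ y ∈ Ω,
      ContDiffAt ℝ 1 (X v i) y := fun hv i y hy => contDiffAt_flux (hu' y hy) (hinj y hy) (hv y hy) i
  have cX : ∀ {v : Euc m → ℝ}, (∀ y ∈ Ω, ContDiffAt ℝ 2 v y) → ∀ i, ContinuousOn (X v i) Ω :=
    fun hv i y hy => (hX hv i y hy).continuousAt.continuousWithinAt
  have cpX : ∀ {v : Euc m → ℝ}, (∀ y ∈ Ω, ContDiffAt ℝ 2 v y) → ∀ i,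
      ContinuousOn (pderiv i (X v i)) Ω := fun hv i y hy =>
    (contDiffAt_pderiv (k := 0) (hX hv i y hy) (by norm_num) i).continuousAt.continuousWithinAt
  have cp : ∀ {v : Euc m → ℝ}, (∀ y ∈ Ω, ContDiffAt ℝ 2 v y) → ∀ i,
      ContinuousOn (pderiv i v) Ω := fun hv i y hy =>
    (contDiffAt_pderiv (k := 1) (hv y hy) (by norm_num) i).continuousAt.continuousWithinAt
  have c0 : ∀ {v : Euc m → ℝ}, (∀ y ∈ Ω, ContDiffAt ℝ 2 v y) → ContinuousOn v Ω := fun hv y hy =>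
    (hv y hy).continuousAt.continuousWithinAt
  have sX : ∀ i, tsupport (X ψ i) ⊆ tsupport ψ := by
    intro i
    refine closure_minimal (fun y hy => ?_) (isClosed_tsupport ψ)
    by_contra hn
    refine hy ?_
    have : ∀ j, pderiv j ψ y = 0 := fun j =>
      image_eq_zero_of_notMem_tsupport fun h => hn (tsupport_pderiv_subset ψ j h)
    simp [X, this]
  -- continuous functions on `Ω` vanishing off the support of `ψ` are integrable
  have hint : ∀ k : Euc m → ℝ, ContinuousOn k Ω → tsupport k ⊆ tsupport ψ → Integrable k :=
    fun k hk h => integrable_of_tsupport_subset hΩ hk (h.trans hs)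
      (hc.of_isClosed_subset (isClosed_tsupport k) h)
  have hdiff : ∀ k : Euc m → ℝ, (∀ y ∈ Ω, DifferentiableAt ℝ k y) → tsupport k ⊆ tsupport ψ →
      ∀ y, DifferentiableAt ℝ k y := by
    intro k hk hk' y
    by_cases hy : y ∈ Ω
    · exact hk y hy
    · have : k =ᶠ[𝓝 y] fun _ => 0 := by
        have := (isClosed_tsupport k).isOpen_compl.mem_nhds
          (fun h => hy (hs (hk' h)) : y ∈ (tsupport k)ᶜ)
        filter_upwards [this] with z hz
        exact image_eq_zero_of_notMem_tsupport hz
      exact (differentiableAt_const _).congr_of_eventuallyEq this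
  have dXψ : ∀ i, ∀ y, DifferentiableAt ℝ (X ψ i) y := fun i =>
    hdiff _ (fun y hy => (hX hψ' i y hy).differentiableAt (by norm_num)) (sX i)
  have j1 : ∀ i, Integrable fun y => ψ y * pderiv i (X w i) y := fun i =>
    hint _ ((c0 hψ').mul (cpX hw' i)) tsupport_mul_subset_left
  have j2 : ∀ i, Integrable fun y => w y * pderiv i (X ψ i) y := fun i =>
    hint _ ((c0 hw').mul (cpX hψ' i))
      ((tsupport_mul_subset_right).trans ((tsupport_pderiv_subset _ i).trans (sX i)))
  have j3 : ∀ i, Integrable fun y => pderiv i ψ y * X w i y := fun i =>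
    hint _ ((cp hψ' i).mul (cX hw' i))
      ((tsupport_mul_subset_left).trans (tsupport_pderiv_subset ψ i))
  have j4 : ∀ i, Integrable fun y => pderiv i w y * X ψ i y := fun i =>
    hint _ ((cp hw' i).mul (cX hψ' i)) ((tsupport_mul_subset_right).trans (sX i))
  have i1 : ∀ i, ∫ y, ψ y * pderiv i (X w i) y = -∫ y, pderiv i ψ y * X w i y := by
    intro i
    refine integral_mul_fderiv_eq_neg_fderiv_mul_of_integrable ?_ ?_ ?_ ?_ ?_
    · exact j3 i
    · exact j1 i
    · exact hint _ ((c0 hψ').mul (cX hw' i)) tsupport_mul_subset_left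
    · exact fun y _ => hdiff ψ (fun z hz => (hψ' z hz).differentiableAt (by norm_num)) le_rfl y
    · exact fun y hy => (hX hw' i y (hs hy)).differentiableAt (by norm_num)
  have i2 : ∀ i, ∫ y, w y * pderiv i (X ψ i) y = -∫ y, pderiv i w y * X ψ i y := by
    intro i
    refine integral_mul_fderiv_eq_neg_fderiv_mul_of_integrable ?_ ?_ ?_ ?_ ?_
    · exact j4 i
    · exact j2 i
    · exact hint _ ((c0 hw').mul (cX hψ' i)) ((tsupport_mul_subset_right).trans (sX i))
    · exact fun y hy => (hw' y (hs (sX i hy))).differentiableAt (by norm_num)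
    · exact fun y _ => dXψ i y
  have e1 : ∀ y, volDensity u y * (ψ y * patchLaplacian u w y) = ∑ i, ψ y * pderiv i (X w i) y := by
    intro y
    by_cases hy : y ∈ Ω
    · rw [← Finset.mul_sum, ← volDensity_mul_patchLaplacian (hinj y hy)]
      ring
    · simp [image_eq_zero_of_notMem_tsupport fun h => hy (hs h)]
  have e2 : ∀ y, volDensity u y * (w y * patchLaplacian u ψ y) = ∑ i, w y * pderiv i (X ψ i) y := by
    intro y
    by_cases hy : y ∈ Ω
    · rw [← Finset.mul_sum, ← volDensity_mul_patchLaplacian (hinj y hy)]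
      ring
    · have h0 : ∀ i, pderiv i (X ψ i) y = 0 := fun i => image_eq_zero_of_notMem_tsupport
        fun h => hy (hs (sX i (tsupport_pderiv_subset _ i h)))
      have h1 : patchLaplacian u ψ y = (volDensity u y)⁻¹ * ∑ i, pderiv i (X ψ i) y := rfl
      rw [h1]
      simp [h0]
  simp only [e1, e2]
  rw [integral_finsetSum _ fun i _ => j1 i, integral_finsetSum _ fun i _ => j2 i]
  simp only [i1, i2, Finset.sum_neg_distrib]
  rw [← integral_finsetSum _ fun i _ => j3 i, ← integral_finsetSum _ fun i _ => j4 i]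
  -- Both sides have become the Dirichlet form of ψ and w, which is symmetric because g⁻¹ is.
  refine congrArg Neg.neg (integral_congr_ae (Eventually.of_forall fun y => ?_))
  simp only [X, Finset.mul_sum]
  rw [Finset.sum_comm]
  refine Finset.sum_congr rfl fun j _ => Finset.sum_congr rfl fun i _ => ?_
  rw [metricMatrix_inv_comm]
  ring

end Green

/-! ### Charts at interior points and transition maps -/

section InnerChart

variable {m d : ℕ} {H : Type*} [TopologicalSpace H] (I : ModelWithCorners ℝ (Euc m) H)
  {M : Type*} [TopologicalSpace M] [ChartedSpace H M]

/-- The part of the chart target at `x` in the interior of the model space. -/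
def innerTarget (x : M) : Set (Euc m) := interior (extChartAt I x).target

/-- The part of the chart domain at `x` consisting of interior points. -/
def innerDomain (x : M) : Set M :=
  (extChartAt I x).source ∩ extChartAt I x ⁻¹' innerTarget I x

variable {I}

lemma isOpen_innerTarget (x : M) : IsOpen (innerTarget I x) := isOpen_interior

lemma isOpen_innerDomain (x : M) : IsOpen (innerDomain I x) :=
  isOpen_extChartAt_preimage' x isOpen_interior

lemma innerTarget_subset (x : M) : innerTarget I x ⊆ (extChartAt I x).target := interior_subset

lemma extChartAt_symm_mem_innerDomain {x : M} {y : Euc m} (hy : y ∈ innerTarget I x) :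
    (extChartAt I x).symm y ∈ innerDomain I x := by
  have h := innerTarget_subset x hy
  refine ⟨(extChartAt I x).map_target h, ?_⟩
  rwa [mem_preimage, (extChartAt I x).right_inv h]

lemma extChartAt_symm_mem_innerDomain_iff {x : M} {y : Euc m} (hy : y ∈ (extChartAt I x).target) :
    (extChartAt I x).symm y ∈ innerDomain I x ↔ y ∈ innerTarget I x :=
  ⟨fun h => by simpa only [mem_preimage, (extChartAt I x).right_inv hy] using h.2,
    extChartAt_symm_mem_innerDomain⟩

lemma mem_innerDomain_self {p : M} (hp : p ∈ I.interior M) : p ∈ innerDomain I p :=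
  ⟨mem_extChartAt_source p, ModelWithCorners.isInteriorPoint_iff.1 hp⟩

lemma continuousOn_extChartAt_innerDomain (x : M) :
    ContinuousOn (extChartAt I x) (innerDomain I x) :=
  (continuousOn_extChartAt x).mono inter_subset_left

lemma continuousOn_symm_innerTarget (x : M) :
    ContinuousOn (extChartAt I x).symm (innerTarget I x) :=
  (continuousOn_extChartAt_symm x).mono (innerTarget_subset x)

lemma continuousAt_symm {x : M} {y : Euc m} (hy : y ∈ innerTarget I x) :
    ContinuousAt (extChartAt I x).symm y :=
  (continuousOn_symm_innerTarget x).continuousAt ((isOpen_innerTarget x).mem_nhds hy)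

lemma comp_symm_eventuallyEq {Z : Type*} (g : M → Z) {x x' : M} {y : Euc m}
    (hy : y ∈ innerTarget I x)
    (hx' : (extChartAt I x).symm y ∈ (extChartAt I x').source) :
    g ∘ (extChartAt I x).symm =ᶠ[𝓝 y]
      (g ∘ (extChartAt I x').symm) ∘ (extChartAt I x' ∘ (extChartAt I x).symm) := by
  have := (continuousAt_symm hy).preimage_mem_nhds
    ((isOpen_extChartAt_source (I := I) x').mem_nhds hx')
  filter_upwards [this] with z hz
  simp only [Function.comp_apply, (extChartAt I x').left_inv hz]

lemma localParam_eventuallyEq (F : M → Euc d) {x x' : M} {y : Euc m} (hy : y ∈ innerTarget I x)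
    (hx' : (extChartAt I x).symm y ∈ (extChartAt I x').source) :
    localParam I F x =ᶠ[𝓝 y] localParam I F x' ∘ (extChartAt I x' ∘ (extChartAt I x).symm) :=
  comp_symm_eventuallyEq F hy hx'

lemma laplacian_congr {p : M} {F : M → Euc d} {f g : M → ℝ} (hfg : f =ᶠ[𝓝 p] g) :
    laplacian I F f p = laplacian I F g p := by
  refine patchLaplacian_congr EventuallyEq.rfl ?_
  have h := continuousAt_extChartAt_symm (I := I) p
  rw [ContinuousAt, extChartAt_to_inv] at h
  exact h.eventually hfg

lemma laplacian_zero (F : M → Euc d) (p : M) : laplacian I F (fun _ => 0) p = 0 := by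
  have h : ∀ i : Fin m, pderiv i ((fun _ : M => (0 : ℝ)) ∘ (extChartAt I p).symm) = 0 := fun i => by
    funext y
    simp [pderiv, Function.comp_def]
  simp only [laplacian, patchLaplacian, h]
  simp [pderiv]

variable [IsManifold I ∞ M]

/-- Being an interior point does not depend on the chart. Derivatives by `fderiv` are meaningful
only on the open set `innerTarget`, so every chart computation is confined to it. -/
lemma mem_innerDomain {x p : M} (hp : p ∈ I.interior M) (hx : p ∈ (extChartAt I x).source) :
    p ∈ innerDomain I x := by
  refine ⟨hx, ?_⟩
  rw [extChartAt_source] at hx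
  exact (ModelWithCorners.isInteriorPoint_iff_of_mem_atlas (n := ∞) (by simp)
    (chart_mem_atlas H x) hx).1 hp

lemma innerDomain_subset_interior (x : M) : innerDomain I x ⊆ I.interior M := by
  intro p hp
  have hx := hp.1
  rw [extChartAt_source] at hx
  exact (ModelWithCorners.isInteriorPoint_iff_of_mem_atlas (n := ∞) (by simp)
    (chart_mem_atlas H x) hx).2 hp.2

lemma contMDiffAt_symm {n : ℕ∞} {x : M} {y : Euc m} (hy : y ∈ innerTarget I x) :
    ContMDiffAt 𝓘(ℝ, Euc m) I n (extChartAt I x).symm y := by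
  have : IsManifold I n M := IsManifold.of_le (n := ∞) (by exact_mod_cast le_top)
  exact (contMDiffOn_extChartAt_symm x).contMDiffAt (mem_interior_iff_mem_nhds.1 hy)

lemma contDiffAt_comp_symm {V : Type*} [NormedAddCommGroup V] [NormedSpace ℝ V] {n : ℕ∞}
    {f : M → V} {x : M} {y : Euc m} (hy : y ∈ innerTarget I x)
    (hf : ContMDiffAt I 𝓘(ℝ, V) n f ((extChartAt I x).symm y)) :
    ContDiffAt ℝ n (f ∘ (extChartAt I x).symm) y :=
  (ContMDiffAt.comp y hf (contMDiffAt_symm hy)).contDiffAt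

variable {F : M → Euc d}

lemma contDiffAt_localParam (hF : IsSmoothImmersion I F) {x : M} {y : Euc m}
    (hy : y ∈ innerTarget I x) : ContDiffAt ℝ ∞ (localParam I F x) y :=
  contDiffAt_comp_symm (n := ⊤) hy hF.1.contMDiffAt

lemma contDiffAt_two_localParam (hF : IsSmoothImmersion I F) {x : M} {y : Euc m}
    (hy : y ∈ innerTarget I x) : ContDiffAt ℝ 2 (localParam I F x) y :=
  (contDiffAt_localParam hF hy).of_le (WithTop.coe_le_coe.2 (le_top : (2 : ℕ∞) ≤ ⊤))

lemma injective_fderiv_localParam (hF : IsSmoothImmersion I F) {x : M} {y : Euc m}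
    (hy : y ∈ innerTarget I x) : Function.Injective (fderiv ℝ (localParam I F x) y) := by
  have hmem := mem_interior_iff_mem_nhds.1 hy
  have hI : range I ∈ 𝓝 y := Filter.mem_of_superset hmem (extChartAt_target_subset_range x)
  have h1 : MDifferentiableAt 𝓘(ℝ, Euc m) I (extChartAt I x).symm y :=
    (contMDiffAt_symm (n := 1) hy).mdifferentiableAt (by norm_num)
  have h2 : MDifferentiableAt I 𝓘(ℝ, Euc d) F ((extChartAt I x).symm y) :=
    hF.1.contMDiffAt.mdifferentiableAt (by simp)
  rw [← mfderiv_eq_fderiv, localParam, mfderiv_comp y h2 h1]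
  refine (hF.2 _).comp ?_
  have : IsManifold I 1 M := IsManifold.of_le (n := ∞) (by exact_mod_cast le_top)
  have h3 := isInvertible_mfderivWithin_extChartAt_symm (I := I) (innerTarget_subset x hy)
  rw [mfderivWithin_of_mem_nhds hI] at h3
  exact h3.injective

lemma continuousAt_volDensity_localParam (hF : IsSmoothImmersion I F) {x : M} {y : Euc m}
    (hy : y ∈ innerTarget I x) : ContinuousAt (volDensity (localParam I F x)) y :=
  (contDiffAt_volDensity (k := 0) (contDiffAt_two_localParam hF hy) (by norm_num)
    (injective_fderiv_localParam hF hy)).continuousAt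

section Transition

variable {x x' : M} {y : Euc m}

lemma contDiffAt_transition (hy : y ∈ innerTarget I x)
    (hx' : (extChartAt I x).symm y ∈ (extChartAt I x').source) :
    ContDiffAt ℝ 2 (extChartAt I x' ∘ (extChartAt I x).symm) y := by
  refine contDiffAt_comp_symm (n := 2) hy ?_
  have : IsManifold I 2 M := IsManifold.of_le (n := ∞) (WithTop.coe_le_coe.2 (le_top : (2 : ℕ∞) ≤ ⊤))
  rw [extChartAt_source] at hx'
  exact contMDiffAt_extChartAt' hx'

/-- The immersion in one chart is the immersion in the other composed with the transition map.
Injectivity of the composite derivative forces that of the transition derivative, an endomorphism of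
a finite-dimensional space. -/
lemma det_fderiv_transition_ne_zero (hF : IsSmoothImmersion I F) (hy : y ∈ innerTarget I x)
    (hx' : (extChartAt I x).symm y ∈ (extChartAt I x').source) :
    (fderiv ℝ (extChartAt I x' ∘ (extChartAt I x).symm) y).det ≠ 0 := by
  have hint := innerDomain_subset_interior x (extChartAt_symm_mem_innerDomain hy)
  have hy' : extChartAt I x' ((extChartAt I x).symm y) ∈ innerTarget I x' :=
    (mem_innerDomain hint hx').2
  have h := injective_fderiv_localParam hF hy
  rw [(localParam_eventuallyEq F hy hx').fderiv_eq,
    fderiv_comp (f := extChartAt I x' ∘ (extChartAt I x).symm) y ((contDiffAt_localParam hF hy').differentiableAt (by simp))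
      ((contDiffAt_transition hy hx').differentiableAt (by norm_num))] at h
  have h2 : Function.Injective
      (fderiv ℝ (extChartAt I x' ∘ (extChartAt I x).symm) y : Euc m →ₗ[ℝ] Euc m) :=
    Function.Injective.of_comp h
  have h3 : IsUnit (fderiv ℝ (extChartAt I x' ∘ (extChartAt I x).symm) y : Euc m →ₗ[ℝ] Euc m) :=
    (Module.End.isUnit_iff _).2 ⟨h2, LinearMap.injective_iff_surjective.1 h2⟩
  exact (h3.map LinearMap.det).ne_zero

lemma volDensity_localParam_eq (hF : IsSmoothImmersion I F) (hy : y ∈ innerTarget I x)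
    (hx' : (extChartAt I x).symm y ∈ (extChartAt I x').source) :
    volDensity (localParam I F x) y
      = |(fderiv ℝ (extChartAt I x' ∘ (extChartAt I x).symm) y).det|
        * volDensity (localParam I F x') ((extChartAt I x' ∘ (extChartAt I x).symm) y) := by
  have hint := innerDomain_subset_interior x (extChartAt_symm_mem_innerDomain hy)
  have hy' : extChartAt I x' ((extChartAt I x).symm y) ∈ innerTarget I x' :=
    (mem_innerDomain hint hx').2
  rw [← volDensity_comp ((contDiffAt_localParam hF hy').differentiableAt (by simp))
      ((contDiffAt_transition hy hx').differentiableAt (by norm_num))]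
  have h2 := fun i => pderiv_congr (localParam_eventuallyEq F hy hx') i
  simp only [volDensity, metricMatrix, h2]

end Transition

/-- The Laplacian can be computed in any chart. -/
lemma laplacian_eq_patchLaplacian (hF : IsSmoothImmersion I F) {x p : M}
    (hp : p ∈ innerDomain I x) {f : M → ℝ} (hf : ContMDiffAt I 𝓘(ℝ, ℝ) 2 f p) :
    laplacian I F f p
      = patchLaplacian (localParam I F x) (f ∘ (extChartAt I x).symm) (extChartAt I x p) := by
  have hpp := mem_innerDomain_self (innerDomain_subset_interior x hp)
  have hy := hpp.2
  have e : (extChartAt I p).symm (extChartAt I p p) = p := extChartAt_to_inv p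
  have hx' : (extChartAt I p).symm (extChartAt I p p) ∈ (extChartAt I x).source := by
    rw [e]; exact hp.1
  have e2 : (extChartAt I x ∘ (extChartAt I p).symm) (extChartAt I p p) = extChartAt I x p := by
    rw [Function.comp_apply, e]
  have e3 : (extChartAt I x).symm (extChartAt I x p) = p := (extChartAt I x).left_inv hp.1
  rw [laplacian, patchLaplacian_congr
    (localParam_eventuallyEq F hy hx')
    (comp_symm_eventuallyEq f hy hx'), patchLaplacian_comp, e2]
  · rw [e2]; exact contDiffAt_two_localParam hF hp.2
  · exact contDiffAt_transition hy hx'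
  · rw [e2]; exact injective_fderiv_localParam hF hp.2
  · exact det_fderiv_transition_ne_zero hF hy hx'
  · rw [e2]
    exact contDiffAt_comp_symm (n := 2) hp.2 (by rw [e3]; exact hf)

lemma continuousAt_laplacian (hF : IsSmoothImmersion I F) {p : M} (hp : p ∈ I.interior M)
    {f : M → ℝ} (hf : ∀ᶠ q in 𝓝 p, ContMDiffAt I 𝓘(ℝ, ℝ) 2 f q) :
    ContinuousAt (laplacian I F f) p := by
  have hpp := mem_innerDomain_self hp
  have hev : laplacian I F f =ᶠ[𝓝 p] patchLaplacian (localParam I F p)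
      (f ∘ (extChartAt I p).symm) ∘ extChartAt I p := by
    filter_upwards [hf, (isOpen_innerDomain p).mem_nhds hpp] with q hq hq'
    exact laplacian_eq_patchLaplacian hF hq' hq
  refine ContinuousAt.congr ?_ hev.symm
  refine ContinuousAt.comp ?_ (continuousAt_extChartAt p)
  refine continuousAt_patchLaplacian (contDiffAt_two_localParam hF hpp.2) ?_
    (contDiffAt_comp_symm (n := 2) hpp.2 (by rw [extChartAt_to_inv]; exact hf.self_of_nhds))
  filter_upwards [(isOpen_innerTarget p).mem_nhds hpp.2] with z hz
  exact injective_fderiv_localParam hF hz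

lemma laplacian_sum (hF : IsSmoothImmersion I F) {p : M} (hp : p ∈ I.interior M)
    {ι : Type*} {s : Finset ι} {f : ι → M → ℝ}
    (hf : ∀ a ∈ s, ContMDiffAt I 𝓘(ℝ, ℝ) 2 (f a) p) :
    laplacian I F (fun q => ∑ a ∈ s, f a q) p = ∑ a ∈ s, laplacian I F (f a) p := by
  have hpp := (mem_innerDomain_self hp).2
  exact patchLaplacian_sum (contDiffAt_two_localParam hF hpp) (injective_fderiv_localParam hF hpp)
    (w := fun a => f a ∘ (extChartAt I p).symm)
    fun a ha => contDiffAt_comp_symm (n := 2) hpp (by rw [extChartAt_to_inv]; exact hf a ha)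

end InnerChart

/-! ### The induced volume measure -/

section InducedVolume

variable {m d : ℕ} {H : Type*} [TopologicalSpace H] {I : ModelWithCorners ℝ (Euc m) H}
  {M : Type*} [TopologicalSpace M] [ChartedSpace H M]
  {F : M → Euc d}

lemma measurableSet_extChartAt_target (x : M) : MeasurableSet (extChartAt I x).target := by
  rw [extChartAt_target]
  exact (((chartAt H x).open_target.preimage I.continuous_symm).measurableSet).inter
    I.isClosed_range.measurableSet

lemma preimage_symm_inter_target_eq (x : M) {A : Set M} (hA : A ⊆ innerDomain I x) :
    (extChartAt I x).symm ⁻¹' A ∩ (extChartAt I x).target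
      = (extChartAt I x).symm ⁻¹' A ∩ innerTarget I x := by
  ext y
  refine ⟨fun h => ⟨h.1, ?_⟩, fun h => ⟨h.1, innerTarget_subset x h.2⟩⟩
  exact (extChartAt_symm_mem_innerDomain_iff h.2).1 (hA h.1)

lemma aemeasurable_volDensity [IsManifold I ∞ M] (hF : IsSmoothImmersion I F) (x : M) :
    AEMeasurable (fun y => ENNReal.ofReal (volDensity (localParam I F x) y))
      (volume.restrict (innerTarget I x)) :=
  ENNReal.measurable_ofReal.comp_aemeasurable <|
    ContinuousOn.aemeasurable (fun _ hy =>
      (continuousAt_volDensity_localParam hF hy).continuousWithinAt)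
      (isOpen_innerTarget (I := I) x).measurableSet

variable [MeasurableSpace M] [BorelSpace M]

lemma chartVolume_apply (F : M → Euc d) (x : M) {A : Set M} (hA : MeasurableSet A) :
    chartVolume I F x A = ∫⁻ y in (extChartAt I x).symm ⁻¹' A ∩ (extChartAt I x).target,
      ENNReal.ofReal (volDensity (localParam I F x) y) := by
  have hT := measurableSet_extChartAt_target (I := I) x
  have h1 : AEMeasurable (extChartAt I x).symm (volume.restrict (extChartAt I x).target) :=
    (continuousOn_extChartAt_symm x).aemeasurable hT
  rw [chartVolume, Measure.map_apply_of_aemeasurable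
    (h1.mono_ac (withDensity_absolutelyContinuous _ _)) hA, withDensity_apply',
    Measure.restrict_restrict' hT]

lemma measurableSet_preimage_symm (x : M) {A : Set M} (hA : MeasurableSet A) :
    MeasurableSet ((extChartAt I x).symm ⁻¹' A ∩ innerTarget I x) := by
  have h := (continuousOn_iff_continuous_domRestrict.1
    (continuousOn_symm_innerTarget (I := I) x)).measurable hA
  have h2 := (isOpen_innerTarget (I := I) x).measurableSet.subtype_image h
  convert h2 using 1
  ext y
  simp only [mem_inter_iff, mem_preimage, mem_image, Subtype.exists, domRestrict_apply]
  exact ⟨fun h => ⟨y, h.2, h.1, rfl⟩, fun ⟨z, hz, hz', e⟩ => e ▸ ⟨hz', hz⟩⟩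

lemma chartVolume_compl_source (F : M → Euc d) (x : M) :
    chartVolume I F x (extChartAt I x).sourceᶜ = 0 := by
  rw [chartVolume_apply F x (isOpen_extChartAt_source x).measurableSet.compl]
  have : (extChartAt I x).symm ⁻¹' (extChartAt I x).sourceᶜ ∩ (extChartAt I x).target = ∅ := by
    ext y
    simp only [mem_inter_iff, mem_preimage, mem_compl_iff, mem_empty_iff_false, iff_false, not_and]
    exact fun h hy => h ((extChartAt I x).map_target hy)
  rw [this, Measure.restrict_empty, lintegral_zero_measure]

lemma aemeasurable_symm (F : M → Euc d) (x : M) : AEMeasurable (extChartAt I x).symm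
    ((volume.restrict (innerTarget I x)).withDensity
        fun y => ENNReal.ofReal (volDensity (localParam I F x) y)) :=
  ((continuousOn_symm_innerTarget x).aemeasurable
    (isOpen_innerTarget (I := I) x).measurableSet).mono_ac (withDensity_absolutelyContinuous _ _)

variable [IsManifold I ∞ M]

/-- Change of variables along the transition map, whose Jacobian is exactly the factor relating the
two volume densities. -/
lemma chartVolume_eq_of_subset (hF : IsSmoothImmersion I F) {x x' : M} {A : Set M}
    (hA : MeasurableSet A) (hx : A ⊆ innerDomain I x) (hx' : A ⊆ innerDomain I x') :
    chartVolume I F x A = chartVolume I F x' A := by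
  rw [chartVolume_apply F x hA, chartVolume_apply F x' hA, preimage_symm_inter_target_eq x hx,
    preimage_symm_inter_target_eq x' hx']
  let τ := extChartAt I x' ∘ (extChartAt I x).symm
  have himg : (extChartAt I x').symm ⁻¹' A ∩ innerTarget I x'
      = τ '' ((extChartAt I x).symm ⁻¹' A ∩ innerTarget I x) := by
    ext z
    constructor
    · rintro ⟨hz, hz'⟩
      have hzx := hx hz
      refine ⟨extChartAt I x ((extChartAt I x').symm z), ⟨?_, hzx.2⟩, ?_⟩
      · rwa [mem_preimage, (extChartAt I x).left_inv hzx.1]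
      · simp only [τ, Function.comp_apply, (extChartAt I x).left_inv hzx.1,
          (extChartAt I x').right_inv (innerTarget_subset x' hz')]
    · rintro ⟨y, ⟨hy, hy'⟩, rfl⟩
      have hyx := hx' hy
      refine ⟨?_, hyx.2⟩
      simp only [τ, mem_preimage, Function.comp_apply, (extChartAt I x').left_inv hyx.1]
      exact hy
  have hinj : InjOn τ ((extChartAt I x).symm ⁻¹' A ∩ innerTarget I x) := by
    intro y hy z hz hyz
    have h1 := (extChartAt I x').injOn (hx' hy.1).1 (hx' hz.1).1 hyz
    exact (extChartAt I x).symm.injOn (innerTarget_subset x hy.2) (innerTarget_subset x hz.2) h1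
  rw [himg, lintegral_image_eq_lintegral_abs_det_fderiv_mul volume (measurableSet_preimage_symm x hA)
    (fun y hy => ((contDiffAt_transition hy.2 (hx' hy.1).1).differentiableAt
      (by norm_num)).hasFDerivAt.hasFDerivWithinAt) hinj]
  refine setLIntegral_congr_fun (measurableSet_preimage_symm x hA) fun y hy => ?_
  rw [← ENNReal.ofReal_mul (abs_nonneg _), volDensity_localParam_eq hF hy.2 (hx' hy.1).1]

lemma restrict_inducedVolume (hF : IsSmoothImmersion I F) (x : M) :
    (inducedVolume I F).restrict (innerDomain I x)
      = (chartVolume I F x).restrict (innerDomain I x) := by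
  have hU := (isOpen_innerDomain (I := I) x).measurableSet
  refine le_antisymm ?_ (Measure.restrict_mono le_rfl (le_iSup (chartVolume I F) x))
  -- A supremum of measures is not computed set by set, so an explicit upper bound is used: the
  -- chart volume inside, and `⊤` outside, which the restriction then discards.
  let ν : Measure M := (chartVolume I F x).restrict (innerDomain I x)
    + (⊤ : Measure M).restrict (innerDomain I x)ᶜ
  have hν : inducedVolume I F ≤ ν := by
    refine iSup_le fun x' => Measure.le_iff.2 fun A hA => ?_
    rw [← measure_inter_add_sdiff A hU, Measure.add_apply, Measure.restrict_apply hA,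
      Measure.restrict_apply hA]
    refine add_le_add ?_ (Measure.le_iff'.1 le_top _)
    have h1 : chartVolume I F x' (A ∩ innerDomain I x)
        = chartVolume I F x' (A ∩ innerDomain I x ∩ (extChartAt I x').source) := by
      rw [measure_inter_conull (chartVolume_compl_source F x')]
    rw [h1, ← chartVolume_eq_of_subset hF (x := x)]
    · exact measure_mono inter_subset_left
    · exact (hA.inter hU).inter (isOpen_extChartAt_source x').measurableSet
    · exact fun p hp => hp.1.2
    · exact fun p hp => mem_innerDomain (innerDomain_subset_interior x hp.1.2) hp.2
  refine (Measure.restrict_mono le_rfl hν).trans ?_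
  rw [Measure.restrict_add, Measure.restrict_restrict hU, Measure.restrict_restrict hU]
  simp

/-- The induced volume on a chart domain, as a pushforward. -/
lemma restrict_inducedVolume_eq_map (hF : IsSmoothImmersion I F) (x : M) :
    (inducedVolume I F).restrict (innerDomain I x)
      = ((volume.restrict (innerTarget I x)).withDensity
        fun y => ENNReal.ofReal (volDensity (localParam I F x) y)).map (extChartAt I x).symm := by
  rw [restrict_inducedVolume hF]
  have hU := (isOpen_innerDomain (I := I) x).measurableSet
  have hΩ := (isOpen_innerTarget (I := I) x).measurableSet
  have h1 : AEMeasurable (extChartAt I x).symm (volume.restrict (innerTarget I x)) :=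
    (continuousOn_symm_innerTarget x).aemeasurable hΩ
  ext A hA
  rw [Measure.restrict_apply hA, chartVolume_apply F x (hA.inter hU),
    preimage_symm_inter_target_eq x inter_subset_right, Measure.map_apply_of_aemeasurable
    (h1.mono_ac (withDensity_absolutelyContinuous _ _)) hA, withDensity_apply',
    Measure.restrict_restrict' hΩ]
  congr 2
  ext y
  exact ⟨fun h => ⟨h.1.1, h.2⟩, fun h => ⟨⟨h.1, extChartAt_symm_mem_innerDomain h.2⟩, h.2⟩⟩

/-- By compactness this is local: near an interior point the density is bounded by continuity and
the coordinates stay in a ball. -/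
lemma inducedVolume_lt_top_of_isCompact (hF : IsSmoothImmersion I F) {K : Set M}
    (hK : IsCompact K) (hKi : K ⊆ I.interior M) : inducedVolume I F K < ⊤ := by
  refine hK.measure_lt_top_of_nhdsWithin fun p hp => ?_
  have hpp := mem_innerDomain_self (hKi hp)
  have hc := continuousAt_volDensity_localParam hF hpp.2
  have hev : ∀ᶠ y in 𝓝 (extChartAt I p p),
      volDensity (localParam I F p) y < volDensity (localParam I F p) (extChartAt I p p) + 1 :=
    hc.eventually (gt_mem_nhds (lt_add_one _))
  obtain ⟨ε, hε, hball⟩ := Metric.mem_nhds_iff.1 hev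
  refine ⟨innerDomain I p ∩ extChartAt I p ⁻¹' ball (extChartAt I p p) ε, ?_, ?_⟩
  · refine mem_nhdsWithin_of_mem_nhds (inter_mem ((isOpen_innerDomain p).mem_nhds hpp) ?_)
    exact (continuousAt_extChartAt p).preimage_mem_nhds (ball_mem_nhds _ hε)
  · have hA : MeasurableSet (innerDomain I p ∩ extChartAt I p ⁻¹' ball (extChartAt I p p) ε) :=
      ((continuousOn_extChartAt_innerDomain p).isOpen_inter_preimage (isOpen_innerDomain p)
        isOpen_ball).measurableSet
    have h1 : inducedVolume I F (innerDomain I p ∩ extChartAt I p ⁻¹' ball (extChartAt I p p) ε)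
        = (inducedVolume I F).restrict (innerDomain I p)
          (innerDomain I p ∩ extChartAt I p ⁻¹' ball (extChartAt I p p) ε) := by
      rw [Measure.restrict_apply hA, inter_eq_left.2 inter_subset_left]
    rw [h1, restrict_inducedVolume hF, Measure.restrict_apply hA, inter_eq_left.2 inter_subset_left,
      chartVolume_apply F p hA, preimage_symm_inter_target_eq p inter_subset_left]
    calc _ ≤ ∫⁻ y in ball (extChartAt I p p) ε, ENNReal.ofReal
          (volDensity (localParam I F p) (extChartAt I p p) + 1) := by
          refine (lintegral_mono_set fun y hy => ?_).trans
            (setLIntegral_mono measurable_const fun y hy => ENNReal.ofReal_le_ofReal (hball hy).le)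
          have := hy.1.2
          rwa [mem_preimage, (extChartAt I p).right_inv (innerTarget_subset p hy.2)] at this
      _ < ⊤ := by
          rw [setLIntegral_const]
          exact ENNReal.mul_lt_top ENNReal.ofReal_lt_top measure_ball_lt_top

lemma integrable_inducedVolume (hF : IsSmoothImmersion I F) {W : Set M} (hW : IsOpen W)
    (hWi : W ⊆ I.interior M) {g : M → ℝ} (hg : ContinuousOn g W) (hs : tsupport g ⊆ W)
    (hc : HasCompactSupport g) : Integrable g (inducedVolume I F) := by
  have hcont := hg.continuous_of_tsupport_subset hW hs
  obtain ⟨C, hC⟩ := hc.isCompact.exists_bound_of_continuousOn hcont.continuousOn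
  have hfin := inducedVolume_lt_top_of_isCompact hF hc.isCompact (hs.trans hWi)
  have hK : MeasurableSet (tsupport g) := (isClosed_tsupport g).measurableSet
  have h : IntegrableOn g (tsupport g) (inducedVolume I F) :=
    Measure.integrableOn_of_bounded hfin.ne hcont.aestronglyMeasurable
      ((ae_restrict_iff' hK).2 (Eventually.of_forall hC))
  exact (integrableOn_iff_integrable_of_support_subset (subset_tsupport g)).1 h

/-- Integration in a chart. -/
lemma integral_inducedVolume_eq (hF : IsSmoothImmersion I F) {x : M} {g : M → ℝ}
    (hg : Continuous g) (hs : Function.support g ⊆ innerDomain I x) :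
    ∫ p, g p ∂inducedVolume I F
      = ∫ y in innerTarget I x, volDensity (localParam I F x) y * g ((extChartAt I x).symm y) := by
  have hU := (isOpen_innerDomain (I := I) x).measurableSet
  rw [← setIntegral_eq_integral_of_forall_compl_eq_zero (s := innerDomain I x)
    (fun p hp => by by_contra h; exact hp (hs h)), restrict_inducedVolume_eq_map hF,
    integral_map (aemeasurable_symm F x) hg.aestronglyMeasurable,
    integral_withDensity_eq_integral_toReal_smul₀ (aemeasurable_volDensity hF x)
      (Eventually.of_forall fun _ => ENNReal.ofReal_lt_top)]
  refine setIntegral_congr_fun (isOpen_innerTarget (I := I) x).measurableSet fun y hy => ?_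
  simp only [smul_eq_mul]
  rw [ENNReal.toReal_ofReal (volDensity_pos (injective_fderiv_localParam hF hy)).le]

end InducedVolume

/-! ### Green's identity on the immersed manifold -/

section GlobalGreen

variable {m d : ℕ} {H : Type*} [TopologicalSpace H] {I : ModelWithCorners ℝ (Euc m) H}
  {M : Type*} [TopologicalSpace M] [ChartedSpace H M] {F : M → Euc d}

lemma tsupport_laplacian_subset (F : M → Euc d) (ψ : M → ℝ) :
    tsupport (laplacian I F ψ) ⊆ tsupport ψ := by
  refine closure_minimal (fun p hp => ?_) (isClosed_tsupport ψ)
  by_contra hn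
  refine hp ?_
  rw [laplacian_congr (notMem_tsupport_iff_eventuallyEq.1 hn)]
  exact laplacian_zero F p

lemma patchLaplacian_eq_zero_of_notMem_tsupport {u : Euc m → Euc d} {w : Euc m → ℝ} {y : Euc m}
    (hy : y ∉ tsupport w) : patchLaplacian u w y = 0 := by
  rw [patchLaplacian_congr EventuallyEq.rfl (notMem_tsupport_iff_eventuallyEq.1 hy)]
  have h : ∀ i : Fin m, pderiv i (0 : Euc m → ℝ) = 0 := fun i => by
    funext z
    simp [pderiv]
  simp only [patchLaplacian, h]
  simp [pderiv]

variable [IsManifold I ∞ M]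

lemma continuousOn_laplacian (hF : IsSmoothImmersion I F) {W : Set M} (hW : IsOpen W)
    (hWi : W ⊆ I.interior M) {f : M → ℝ} (hf : ContMDiffOn I 𝓘(ℝ, ℝ) 2 f W) :
    ContinuousOn (laplacian I F f) W := fun p hp =>
  (continuousAt_laplacian hF (hWi hp) (by
    filter_upwards [hW.mem_nhds hp] with q hq
    exact hf.contMDiffAt (hW.mem_nhds hq))).continuousWithinAt

variable [MeasurableSpace M] [BorelSpace M]

lemma integral_mul_laplacian_comm_of_chart (hF : IsSmoothImmersion I F) {W : Set M}
    (hW : IsOpen W) (hWi : W ⊆ I.interior M) {f ψ : M → ℝ} (hf : ContMDiffOn I 𝓘(ℝ, ℝ) 2 f W)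
    (hψ : ContMDiffOn I 𝓘(ℝ, ℝ) 2 ψ W) (hs : tsupport ψ ⊆ W) (hc : HasCompactSupport ψ) {x : M}
    (hx : tsupport ψ ⊆ innerDomain I x) :
    ∫ p, ψ p * laplacian I F f p ∂inducedVolume I F
      = ∫ p, f p * laplacian I F ψ p ∂inducedVolume I F := by
  have hf' : ∀ p ∈ W, ContMDiffAt I 𝓘(ℝ, ℝ) 2 f p := fun p hp => hf.contMDiffAt (hW.mem_nhds hp)
  have hψ' : ∀ p ∈ W, ContMDiffAt I 𝓘(ℝ, ℝ) 2 ψ p := fun p hp => hψ.contMDiffAt (hW.mem_nhds hp)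
  set u := localParam I F x with hu
  let w : Euc m → ℝ := f ∘ (extChartAt I x).symm
  -- Off `innerTarget` the inverse chart carries no information, so ψ read in the chart is extended
  -- by zero; it stays C² because its support is compact inside.
  let v : Euc m → ℝ := (innerTarget I x).indicator (ψ ∘ (extChartAt I x).symm)
  let Ω : Set (Euc m) := innerTarget I x ∩ (extChartAt I x).symm ⁻¹' W
  have hΩ : IsOpen Ω :=
    (continuousOn_symm_innerTarget x).isOpen_inter_preimage (isOpen_innerTarget x) hW
  have hvs : tsupport v ⊆ extChartAt I x '' tsupport ψ := by
    refine closure_minimal (fun y hy => ?_) (hc.isCompact.image_of_continuousOn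
      ((continuousOn_extChartAt_innerDomain x).mono hx)).isClosed
    have hyx : y ∈ innerTarget I x := by
      by_contra hn
      exact hy (indicator_of_notMem hn _)
    refine ⟨(extChartAt I x).symm y, subset_tsupport _ ?_,
      (extChartAt I x).right_inv (innerTarget_subset x hyx)⟩
    rwa [Function.mem_support, show v y = _ from indicator_of_mem hyx _] at hy
  have hvΩ : tsupport v ⊆ Ω := by
    intro y hy
    obtain ⟨p, hp, rfl⟩ := hvs hy
    refine ⟨(hx hp).2, ?_⟩
    rw [mem_preimage, (extChartAt I x).left_inv (hx hp).1]
    exact hs hp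
  have hvc : HasCompactSupport v :=
    (hc.isCompact.image_of_continuousOn
      ((continuousOn_extChartAt_innerDomain x).mono hx)).of_isClosed_subset (isClosed_tsupport v) hvs
  have hev : ∀ y ∈ innerTarget I x, v =ᶠ[𝓝 y] ψ ∘ (extChartAt I x).symm := fun y hy => by
    filter_upwards [(isOpen_innerTarget x).mem_nhds hy] with z hz
    exact indicator_of_mem hz _
  have hgreen := integral_mul_patchLaplacian_comm (u := u) (ψ := v) (w := w) hΩ
    (fun y hy => (contDiffAt_two_localParam hF hy.1).contDiffWithinAt)
    (fun y hy => injective_fderiv_localParam hF hy.1)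
    (fun y hy => ((contDiffAt_comp_symm (n := 2) hy.1 (hψ' _ hy.2)).congr_of_eventuallyEq
      (hev y hy.1)).contDiffWithinAt)
    (fun y hy => (contDiffAt_comp_symm (n := 2) hy.1 (hf' _ hy.2)).contDiffWithinAt) hvΩ hvc
  have hlap : ∀ {k : M → ℝ}, (∀ p ∈ W, ContMDiffAt I 𝓘(ℝ, ℝ) 2 k p) → ∀ y ∈ Ω,
      laplacian I F k ((extChartAt I x).symm y)
        = patchLaplacian u (k ∘ (extChartAt I x).symm) y := by
    intro k hk y hy
    rw [laplacian_eq_patchLaplacian hF (extChartAt_symm_mem_innerDomain hy.1) (hk _ hy.2),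
      (extChartAt I x).right_inv (innerTarget_subset x hy.1)]
  have c1 : Continuous fun p => ψ p * laplacian I F f p :=
    (hψ.continuousOn.mul (continuousOn_laplacian hF hW hWi hf)).continuous_of_tsupport_subset hW
      (tsupport_mul_subset_left.trans hs)
  have c2 : Continuous fun p => f p * laplacian I F ψ p :=
    (hf.continuousOn.mul (continuousOn_laplacian hF hW hWi hψ)).continuous_of_tsupport_subset hW
      (tsupport_mul_subset_right.trans ((tsupport_laplacian_subset F ψ).trans hs))
  rw [integral_inducedVolume_eq hF c1 ((subset_tsupport _).trans
      (tsupport_mul_subset_left.trans hx)), integral_inducedVolume_eq hF c2 ((subset_tsupport _).trans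
      (tsupport_mul_subset_right.trans ((tsupport_laplacian_subset F ψ).trans hx)))]
  have hΩm := (isOpen_innerTarget (I := I) x).measurableSet
  calc _ = ∫ y in innerTarget I x, volDensity u y * (v y * patchLaplacian u w y) := by
        refine setIntegral_congr_fun hΩm fun y hy => ?_
        rw [show v y = _ from indicator_of_mem hy _]
        by_cases hyW : (extChartAt I x).symm y ∈ W
        · rw [hlap hf' y ⟨hy, hyW⟩]
          rfl
        · rw [Function.comp_apply, image_eq_zero_of_notMem_tsupport fun h => hyW (hs h)]
          ring
    _ = ∫ y, volDensity u y * (v y * patchLaplacian u w y) := by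
        refine setIntegral_eq_integral_of_forall_compl_eq_zero fun y hy => ?_
        rw [show v y = 0 from indicator_of_notMem hy _]
        simp
    _ = ∫ y, volDensity u y * (w y * patchLaplacian u v y) := hgreen
    _ = ∫ y in innerTarget I x, volDensity u y * (w y * patchLaplacian u v y) := by
        refine (setIntegral_eq_integral_of_forall_compl_eq_zero fun y hy => ?_).symm
        rw [patchLaplacian_eq_zero_of_notMem_tsupport fun h => hy (hvΩ h).1]
        simp
    _ = _ := by
        refine setIntegral_congr_fun hΩm fun y hy => ?_
        by_cases hyW : (extChartAt I x).symm y ∈ W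
        · rw [hlap hψ' y ⟨hy, hyW⟩, patchLaplacian_congr EventuallyEq.rfl (hev y hy)]
          rfl
        · rw [patchLaplacian_eq_zero_of_notMem_tsupport fun h => hyW (hvΩ h).2,
            image_eq_zero_of_notMem_tsupport fun h => hyW (hs (tsupport_laplacian_subset F ψ h))]
          simp

lemma integrable_mul_laplacian (hF : IsSmoothImmersion I F) {W : Set M}
    (hW : IsOpen W) (hWi : W ⊆ I.interior M) {f ψ : M → ℝ} (hf : ContMDiffOn I 𝓘(ℝ, ℝ) 2 f W)
    (hψ : ContMDiffOn I 𝓘(ℝ, ℝ) 2 ψ W) (hs : tsupport ψ ⊆ W) (hc : HasCompactSupport ψ) :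
    Integrable (fun p => ψ p * laplacian I F f p) (inducedVolume I F) :=
  integrable_inducedVolume hF hW hWi (hψ.continuousOn.mul (continuousOn_laplacian hF hW hWi hf))
    (tsupport_mul_subset_left.trans hs)
    (hc.of_isClosed_subset (isClosed_tsupport _) tsupport_mul_subset_left)

lemma integrable_laplacian_mul (hF : IsSmoothImmersion I F) {W : Set M}
    (hW : IsOpen W) (hWi : W ⊆ I.interior M) {f ψ : M → ℝ} (hf : ContMDiffOn I 𝓘(ℝ, ℝ) 2 f W)
    (hψ : ContMDiffOn I 𝓘(ℝ, ℝ) 2 ψ W) (hs : tsupport ψ ⊆ W) (hc : HasCompactSupport ψ) :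
    Integrable (fun p => f p * laplacian I F ψ p) (inducedVolume I F) :=
  integrable_inducedVolume hF hW hWi (hf.continuousOn.mul (continuousOn_laplacian hF hW hWi hψ))
    (tsupport_mul_subset_right.trans ((tsupport_laplacian_subset F ψ).trans hs))
    (hc.of_isClosed_subset (isClosed_tsupport _)
      (tsupport_mul_subset_right.trans (tsupport_laplacian_subset F ψ)))

/-- Green's second identity on an immersed manifold, for a compactly supported factor. -/
theorem integral_mul_laplacian_comm [T2Space M] [SecondCountableTopology M] (hF : IsSmoothImmersion I F)
    {W : Set M} (hW : IsOpen W) (hWi : W ⊆ I.interior M) {f φ : M → ℝ}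
    (hf : ContMDiffOn I 𝓘(ℝ, ℝ) 2 f W) (hφ : ContMDiffOn I 𝓘(ℝ, ℝ) 2 φ W) (hs : tsupport φ ⊆ W)
    (hc : HasCompactSupport φ) :
    ∫ p, φ p * laplacian I F f p ∂inducedVolume I F
      = ∫ p, f p * laplacian I F φ p ∂inducedVolume I F := by
  have : LocallyCompactSpace H := I.locallyCompactSpace
  have : LocallyCompactSpace M := ChartedSpace.locallyCompactSpace H M
  -- Only the compactly supported factor is cut into pieces, of which finitely many are nonzero; f,
  -- which is C² on W alone, stays whole.
  obtain ⟨η, hη⟩ := SmoothPartitionOfUnity.exists_isSubordinate I (isClosed_tsupport φ)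
    (fun x : M => innerDomain I x) (fun x => isOpen_innerDomain x)
    (fun p hp => mem_iUnion.2 ⟨p, mem_innerDomain_self (hWi (hs hp))⟩)
  have hfin := η.locallyFinite.finite_nonempty_inter_compact hc.isCompact
  let T : Finset M := hfin.toFinset
  have hsum : ∀ p, φ p = ∑ x ∈ T, η x p * φ p := by
    intro p
    by_cases hp : p ∈ tsupport φ
    · rw [← Finset.sum_mul]
      have h1 := η.sum_eq_one hp
      rw [finsum_eq_sum_of_support_subset (s := T)] at h1
      · rw [h1, one_mul]
      · intro x hx
        exact hfin.mem_toFinset.2 ⟨p, hx, hp⟩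
    · simp [image_eq_zero_of_notMem_tsupport hp]
  have hψ : ∀ x, ContMDiffOn I 𝓘(ℝ, ℝ) 2 (fun p => η x p * φ p) W := fun x =>
    (((η x).contMDiff.of_le (WithTop.coe_le_coe.2 (le_top : (2 : ℕ∞) ≤ ⊤))).contMDiffOn).mul hφ
  have hψs : ∀ x, tsupport (fun p => η x p * φ p) ⊆ tsupport φ := fun x => tsupport_mul_subset_right
  have hψc : ∀ x, HasCompactSupport (fun p => η x p * φ p) := fun x =>
    hc.of_isClosed_subset (isClosed_tsupport _) (hψs x)
  calc ∫ p, φ p * laplacian I F f p ∂inducedVolume I F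
      = ∫ p, ∑ x ∈ T, (η x p * φ p) * laplacian I F f p ∂inducedVolume I F := by
        refine integral_congr_ae (Eventually.of_forall fun p => ?_)
        simp only
        rw [← Finset.sum_mul, ← hsum]
    _ = ∑ x ∈ T, ∫ p, (η x p * φ p) * laplacian I F f p ∂inducedVolume I F :=
        integral_finsetSum _ fun x _ =>
          integrable_mul_laplacian hF hW hWi hf (hψ x) ((hψs x).trans hs) (hψc x)
    _ = ∑ x ∈ T, ∫ p, f p * laplacian I F (fun p => η x p * φ p) p ∂inducedVolume I F :=
        Finset.sum_congr rfl fun x _ => integral_mul_laplacian_comm_of_chart hF hW hWi hf (hψ x)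
          ((hψs x).trans hs) (hψc x) (tsupport_mul_subset_left.trans (hη x))
    _ = ∫ p, ∑ x ∈ T, f p * laplacian I F (fun p => η x p * φ p) p ∂inducedVolume I F :=
        (integral_finsetSum _ fun x _ =>
          integrable_laplacian_mul hF hW hWi hf (hψ x) ((hψs x).trans hs) (hψc x)).symm
    _ = _ := by
        refine integral_congr_ae (Eventually.of_forall fun p => ?_)
        simp only
        rw [← Finset.mul_sum]
        by_cases hp : p ∈ W
        · rw [← laplacian_sum hF (hWi hp) fun x _ => (hψ x).contMDiffAt (hW.mem_nhds hp)]
          simp only [← hsum]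
        · have h0 : ∀ {k : M → ℝ}, tsupport k ⊆ tsupport φ → laplacian I F k p = 0 := fun hk =>
            image_eq_zero_of_notMem_tsupport fun h => hp (hs (hk (tsupport_laplacian_subset F _ h)))
          rw [h0 le_rfl, Finset.sum_eq_zero fun x _ => h0 (hψs x)]

end GlobalGreen

/-! ### The radial weight -/

section Weight

/-- A `C¹` monotone step from `0` to `1`, together with its derivative. -/
lemma exists_step {a b : ℝ} (hab : a < b) : ∃ σ σ' : ℝ → ℝ,
    (∀ t, HasDerivAt σ (σ' t) t) ∧ Continuous σ' ∧ (∀ t, 0 ≤ σ' t) ∧ (∀ t, 0 ≤ σ t) ∧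
    (∀ t, σ t ≤ 1) ∧ (∀ t ≤ a, σ t = 0) ∧ (∀ t, b ≤ t → σ t = 1) ∧ (∀ t < a, σ' t = 0) ∧
    (∀ t, b < t → σ' t = 0) := by
  let σ : ℝ → ℝ := fun t => Real.smoothTransition ((t - a) / (b - a))
  have hba : 0 < b - a := sub_pos.2 hab
  have hσ : ContDiff ℝ 1 σ := Real.smoothTransition.contDiff.comp
    ((contDiff_id.sub contDiff_const).div_const _)
  have h0 : ∀ t ≤ a, σ t = 0 := fun t ht => Real.smoothTransition.zero_of_nonpos
    (div_nonpos_of_nonpos_of_nonneg (sub_nonpos.2 ht) hba.le)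
  have h1 : ∀ t, b ≤ t → σ t = 1 := fun t ht => Real.smoothTransition.one_of_one_le
    ((one_le_div hba).2 (by linarith))
  refine ⟨σ, deriv σ, fun t => (hσ.differentiable (by norm_num) t).hasDerivAt,
    hσ.continuous_deriv le_rfl, fun t => ?_, fun t => Real.smoothTransition.nonneg _,
    fun t => Real.smoothTransition.le_one _, h0, h1, fun t ht => ?_, fun t ht => ?_⟩
  · refine Monotone.deriv_nonneg fun s t hst => ?_
    exact Real.smoothTransition.monotone (by gcongr)
  · have : σ =ᶠ[𝓝 t] fun _ => 0 := by
      filter_upwards [gt_mem_nhds ht] with s hs using h0 s (le_of_lt hs)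
    rw [this.deriv_eq, deriv_const]
  · have : σ =ᶠ[𝓝 t] fun _ => 1 := by
      filter_upwards [lt_mem_nhds ht] with s hs using h1 s (le_of_lt hs)
    rw [this.deriv_eq, deriv_const]

lemma continuous_mul_of_vanishing {χ g : ℝ → ℝ} {a : ℝ} (ha : 0 < a) (hχ : Continuous χ)
    (h0 : ∀ t < a, χ t = 0) (hg : ∀ t, 0 < t → ContinuousAt g t) :
    Continuous fun t => χ t * g t := by
  refine continuous_iff_continuousAt.2 fun t => ?_
  rcases lt_or_ge t a with ht | ht
  · have : (fun t => χ t * g t) =ᶠ[𝓝 t] fun _ => 0 := by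
      filter_upwards [gt_mem_nhds ht] with s hs
      rw [h0 s hs, zero_mul]
    exact (continuousAt_const).congr this.symm
  · exact hχ.continuousAt.mul (hg t (ha.trans_le ht))

/-- The radial weight whose second primitive is the test function of the mean value inequality. -/
lemma exists_weight (m : ℕ) {Lam lam a b c e : ℝ} (hLam : 0 ≤ Lam) (hlam : 0 ≤ lam) (ha : 0 < a)
    (hab : a < b) (hbc : b < c) (hce : c < e) (he : e < 1) :
    ∃ κ : ℝ → ℝ, Continuous κ ∧ (∀ t, 0 ≤ κ t) ∧ (∀ t < a, κ t = 0) ∧ (∀ t, e ≤ t → κ t = 0) ∧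
      (∀ t ∈ Ioo (0 : ℝ) 1, κ t ≤ Real.exp (Lam + lam / 2) * t ^ (-(m / 2 : ℝ)) / (4 * t)) ∧
      ∀ ρ ∈ Ico (0 : ℝ) 1, 4 * ρ * κ ρ - 2 * m * (∫ t in ρ..1, κ t)
          + 2 * Lam * √ρ * (∫ t in ρ..1, κ t) + lam * (∫ t in ρ..1, κ t * (t - ρ))
        ≤ Real.exp (Lam + lam / 2) * c ^ (-(m / 2 : ℝ))
          - (if ρ ≤ a then b ^ (-(m / 2 : ℝ)) else 0) := by
  obtain ⟨σ₁, s₁, hσ₁, cs₁, ps₁, pσ₁, lσ₁, zσ₁, oσ₁, zs₁, os₁⟩ := exists_step hab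
  obtain ⟨σ₂, s₂, hσ₂, cs₂, ps₂, pσ₂, lσ₂, zσ₂, oσ₂, zs₂, os₂⟩ := exists_step hce
  set C := Lam + lam / 2 with hC
  have hC0 : 0 ≤ C := by positivity
  -- χ rises on [a,b], equals 1 on [b,c] and falls on [c,e]. Its vanishing below a makes the
  -- singularities of the power and of 1/t at 0 harmless.
  let χ : ℝ → ℝ := fun t => σ₁ t - σ₂ t
  let χ' : ℝ → ℝ := fun t => s₁ t - s₂ t
  let P : ℝ → ℝ := fun t => t ^ (-(m / 2 : ℝ))
  let g : ℝ → ℝ := fun t => P t * Real.exp (C * √t)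
  let κ : ℝ → ℝ := fun t => χ t * (g t / (4 * t))
  have hχd : ∀ t, HasDerivAt χ (χ' t) t := fun t => (hσ₁ t).sub (hσ₂ t)
  have cχ : Continuous χ := continuous_iff_continuousAt.2 fun t => (hχd t).continuousAt
  have cχ' : Continuous χ' := cs₁.sub cs₂
  have hχ0 : ∀ t < a, χ t = 0 := fun t ht => by
    simp only [χ]
    rw [zσ₁ t ht.le, zσ₂ t (by linarith), sub_zero]
  have hχ'0 : ∀ t < a, χ' t = 0 := fun t ht => by
    simp only [χ']
    rw [zs₁ t ht, zs₂ t (by linarith), sub_zero]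
  have hχe : ∀ t, e ≤ t → χ t = 0 := fun t ht => by
    simp only [χ]
    rw [oσ₁ t (by linarith), oσ₂ t ht, sub_self]
  have hχp : ∀ t, 0 ≤ χ t := fun t => by
    simp only [χ]
    rcases le_total t c with h | h
    · rw [zσ₂ t h, sub_zero]; exact pσ₁ t
    · rw [oσ₁ t (by linarith)]; linarith [lσ₂ t]
  have hχ1 : ∀ t, χ t ≤ 1 := fun t => by
    simp only [χ]
    linarith [lσ₁ t, pσ₂ t]
  have hPd : ∀ t, 0 < t → HasDerivAt P (-(m / 2 : ℝ) * P t / t) t := fun t ht => by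
    have := Real.hasDerivAt_rpow_const (p := -(m / 2 : ℝ)) (Or.inl ht.ne')
    convert this using 1
    rw [Real.rpow_sub_one ht.ne', mul_div_assoc]
  have hgd : ∀ t, 0 < t → HasDerivAt g (g t * (C / (2 * √t)) - m / 2 * g t / t) t := fun t ht => by
    have h1 := ((Real.hasDerivAt_sqrt ht.ne').const_mul C).exp
    refine ((hPd t ht).mul h1).congr_deriv ?_
    change _ = P t * Real.exp (C * √t) * (C / (2 * √t)) - m / 2 * (P t * Real.exp (C * √t)) / t
    field_simp
    ring
  have hP0 : ∀ t, 0 < t → 0 < P t := fun t ht => Real.rpow_pos_of_pos ht _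
  have hg0 : ∀ t, 0 < t → 0 < g t := fun t ht => mul_pos (hP0 t ht) (Real.exp_pos _)
  have cg : ∀ t, 0 < t → ContinuousAt g t := fun t ht => (hgd t ht).continuousAt
  have cκ : Continuous κ := continuous_mul_of_vanishing ha cχ hχ0 fun t ht =>
    (cg t ht).div (by fun_prop) (by positivity)
  have hκ0 : ∀ t, 0 ≤ κ t := fun t => by
    rcases lt_or_ge t a with h | h
    · simp [κ, hχ0 t h]
    · have := ha.trans_le h
      exact mul_nonneg (hχp t) (div_nonneg (hg0 t this).le (by linarith))
  have hκa : ∀ t < a, κ t = 0 := fun t ht => by simp [κ, hχ0 t ht]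
  have hκe : ∀ t, e ≤ t → κ t = 0 := fun t ht => by simp [κ, hχe t ht]
  have hexp : ∀ t, 0 ≤ t → t ≤ 1 → Real.exp (C * √t) ≤ Real.exp C := fun t ht ht1 => by
    refine Real.exp_le_exp.2 ?_
    have : √t ≤ 1 := Real.sqrt_le_one.2 ht1
    nlinarith
  refine ⟨κ, cκ, hκ0, hκa, hκe, fun t ht => ?_, fun ρ hρ => ?_⟩
  · have h4 : 0 < 4 * t := by linarith [ht.1]
    have : g t ≤ Real.exp C * P t := by
      rw [mul_comm]
      exact mul_le_mul_of_nonneg_left (hexp t ht.1.le ht.2.le) (hP0 t ht.1).le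
    calc κ t ≤ 1 * (g t / (4 * t)) :=
          mul_le_mul_of_nonneg_right (hχ1 t) (div_nonneg (hg0 t ht.1).le h4.le)
      _ ≤ _ := by rw [one_mul]; gcongr
  · let S : ℝ → ℝ := fun t => χ t * g t
    let S' : ℝ → ℝ := fun t => χ' t * g t + χ t * (g t * (C / (2 * √t)) - m / 2 * g t / t)
    have hS : ∀ t, HasDerivAt S (S' t) t := by
      intro t
      rcases lt_or_ge t a with h | h
      · have : S =ᶠ[𝓝 t] fun _ => 0 := by
          filter_upwards [gt_mem_nhds h] with s hs
          simp [S, hχ0 s hs]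
        have h2 : S' t = 0 := by simp [S', hχ0 t h, hχ'0 t h]
        rw [h2]
        exact (hasDerivAt_const t 0).congr_of_eventuallyEq this
      · exact (hχd t).mul (hgd t (ha.trans_le h))
    have cS' : Continuous S' := by
      refine (continuous_mul_of_vanishing ha cχ' hχ'0 cg).add
        (continuous_mul_of_vanishing ha cχ hχ0 fun t ht => ?_)
      have h1 : √t ≠ 0 := (Real.sqrt_pos.2 ht).ne'
      refine ((cg t ht).mul (continuousAt_const.div ?_ ?_)).sub
        ((continuousAt_const.mul (cg t ht)).div continuousAt_id ht.ne')
      · fun_prop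
      · positivity
    have hSκ : ∀ t, 0 ≤ t → S t = 4 * t * κ t := fun t ht => by
      rcases ht.eq_or_lt with h | h
      · subst h; simp [S, hχ0 0 ha]
      · simp only [S, κ]; field_simp
    have hS1 : S 1 = 0 := by simp [S, hχe 1 he.le]
    -- Since S(1) = 0, the term 4ρκ(ρ) is the integral of -S'. Every term on the left then becomes
    -- an integral over [ρ,1], and a pointwise comparison of integrands is enough.
    have e1 : ∫ t in ρ..1, S' t = -(4 * ρ * κ ρ) := by
      rw [intervalIntegral.integral_eq_sub_of_hasDerivAt (fun t _ => hS t)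
        (cS'.intervalIntegrable _ _), hS1, hSκ ρ hρ.1, zero_sub]
    have e2 : ∫ t in ρ..1, s₂ t = σ₂ 1 - σ₂ ρ :=
      intervalIntegral.integral_eq_sub_of_hasDerivAt (fun t _ => hσ₂ t) (cs₂.intervalIntegrable _ _)
    have e3 : ∫ t in ρ..1, s₁ t = σ₁ 1 - σ₁ ρ :=
      intervalIntegral.integral_eq_sub_of_hasDerivAt (fun t _ => hσ₁ t) (cs₁.intervalIntegrable _ _)
    have cκt : Continuous fun t => κ t * (t - ρ) := cκ.mul (by fun_prop)
    have key : ∫ t in ρ..1, (-S' t - 2 * m * κ t + 2 * Lam * √ρ * κ t + lam * (κ t * (t - ρ)))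
        ≤ ∫ t in ρ..1, (Real.exp C * P c * s₂ t - P b * s₁ t) := by
      refine intervalIntegral.integral_mono_on hρ.2.le
        (Continuous.intervalIntegrable (by fun_prop) _ _)
        (Continuous.intervalIntegrable (by fun_prop) _ _) fun t ht => ?_
      rcases lt_or_ge t a with h | h
      · have h1 : S' t = 0 := by simp [S', hχ0 t h, hχ'0 t h]
        rw [h1, hκa t h, zs₁ t h, zs₂ t (by linarith)]
        simp
      · have ht0 : 0 < t := ha.trans_le h
        have hr : 0 < √t := Real.sqrt_pos.2 ht0
        have hr1 : √t ≤ 1 := Real.sqrt_le_one.2 ht.2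
        have hrt : √t * √t = t := Real.mul_self_sqrt ht0.le
        have hρt : √ρ ≤ √t := Real.sqrt_le_sqrt ht.1
        -- The derivative of the power matches the dimension term exactly.
        have f1 : χ t * (m / 2 * g t / t) = 2 * m * κ t := by
          simp only [κ]; field_simp; ring
        have f2 : 2 * Lam * √ρ * κ t ≤ 2 * Lam * √t * κ t := by
          have := hκ0 t
          gcongr
        -- Here t - ρ ≤ t ≤ √t, as 0 ≤ ρ and t ≤ 1.
        have f3 : lam * (κ t * (t - ρ)) ≤ lam * (κ t * √t) := by
          have := hκ0 t
          have : t - ρ ≤ √t := by nlinarith [hρ.1]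
          gcongr
        -- The derivative of exp(C√t) yields 2C√t κ; matching it with 2Λ√t κ + λ√t κ fixes C = Λ +
        -- λ/2.
        have f4 : χ t * (g t * (C / (2 * √t))) = 2 * Lam * √t * κ t + lam * (κ t * √t) := by
          simp only [κ]
          rw [show g t / (4 * t) = g t / (4 * (√t * √t)) by rw [hrt], hC]
          field_simp
          ring
        -- What remains is -χ'g = g s₂ - g s₁. On the support of s₂ one has t ≥ c, which bounds g
        -- from above; on that of s₁ one has t ≤ b, which bounds g from below.
        have f5 : g t * s₂ t ≤ Real.exp C * P c * s₂ t := by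
          rcases lt_or_ge t c with h' | h'
          · simp [zs₂ t h']
          · refine mul_le_mul_of_nonneg_right ?_ (ps₂ t)
            rw [mul_comm]
            have : P t ≤ P c := Real.rpow_le_rpow_of_nonpos (by linarith) h'
              (by simp; positivity)
            exact mul_le_mul this (hexp t ht0.le ht.2) (Real.exp_pos _).le (hP0 c (by linarith)).le
        have f6 : P b * s₁ t ≤ g t * s₁ t := by
          rcases lt_or_ge b t with h' | h'
          · simp [os₁ t h']
          · refine mul_le_mul_of_nonneg_right ?_ (ps₁ t)
            have h1 : P b ≤ P t := Real.rpow_le_rpow_of_nonpos ht0 h' (by simp; positivity)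
            have h2 : 1 ≤ Real.exp (C * √t) := Real.one_le_exp (by positivity)
            calc P b ≤ P t * 1 := by rw [mul_one]; exact h1
              _ ≤ g t := mul_le_mul_of_nonneg_left h2 (hP0 t ht0).le
        have f7 : S' t = g t * s₁ t - g t * s₂ t + χ t * (g t * (C / (2 * √t)))
            - χ t * (m / 2 * g t / t) := by
          simp only [S', χ']; ring
        rw [f7, f1, f4]
        linarith
    have i0 : IntervalIntegrable κ volume ρ 1 := cκ.intervalIntegrable _ _
    have iN : IntervalIntegrable (fun t => -S' t) volume ρ 1 := cS'.neg.intervalIntegrable _ _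
    have it : IntervalIntegrable (fun t => κ t * (t - ρ)) volume ρ 1 := cκt.intervalIntegrable _ _
    rw [intervalIntegral.integral_add (((iN.sub (i0.const_mul _)).add (i0.const_mul _)))
      (it.const_mul _), intervalIntegral.integral_add (iN.sub (i0.const_mul _)) (i0.const_mul _),
      intervalIntegral.integral_sub iN (i0.const_mul _), intervalIntegral.integral_neg,
      intervalIntegral.integral_const_mul, intervalIntegral.integral_const_mul,
      intervalIntegral.integral_const_mul, e1,
      intervalIntegral.integral_sub ((cs₂.intervalIntegrable _ _).const_mul _)
        ((cs₁.intervalIntegrable _ _).const_mul _), intervalIntegral.integral_const_mul,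
      intervalIntegral.integral_const_mul, e2, e3, oσ₁ 1 (by linarith), oσ₂ 1 he.le] at key
    have g1 : Real.exp C * P c * (1 - σ₂ ρ) ≤ Real.exp C * P c := by
      have := mul_pos (Real.exp_pos C) (hP0 c (by linarith))
      nlinarith [pσ₂ ρ]
    have g2 : (if ρ ≤ a then P b else 0) ≤ P b * (1 - σ₁ ρ) := by
      have := hP0 b (by linarith)
      split_ifs with h
      · rw [zσ₁ ρ h]; simp
      · exact mul_nonneg this.le (by linarith [lσ₁ ρ])
    simp only [P] at g1 g2 key
    linarith

end Weight

/-! ### The second primitive of the weight -/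

section RadialPrimitive

variable {κ : ℝ → ℝ}

lemma hasDerivAt_integral_lower (hκ : Continuous κ) (ρ : ℝ) :
    HasDerivAt (fun ρ => ∫ t in ρ..1, κ t) (-κ ρ) ρ :=
  intervalIntegral.integral_hasDerivAt_left (hκ.intervalIntegrable _ _)
    (hκ.stronglyMeasurableAtFilter _ _) hκ.continuousAt

/-- Splitting the integral as ∫κ(t)t dt - ρ∫κ, the two endpoint contributions ∓ρκ(ρ) cancel. -/
lemma hasDerivAt_second_primitive (hκ : Continuous κ) (ρ : ℝ) :
    HasDerivAt (fun ρ => ∫ t in ρ..1, κ t * (t - ρ)) (-∫ t in ρ..1, κ t) ρ := by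
  have hκt : Continuous fun t => κ t * t := hκ.mul continuous_id
  have e : (fun ρ => ∫ t in ρ..1, κ t * (t - ρ))
      = fun ρ => (∫ t in ρ..1, κ t * t) - ρ * ∫ t in ρ..1, κ t := by
    funext ρ
    rw [← intervalIntegral.integral_const_mul, ← intervalIntegral.integral_sub
      (hκt.intervalIntegrable _ _) ((hκ.intervalIntegrable _ _).const_mul _)]
    exact intervalIntegral.integral_congr fun t _ => by ring
  rw [e]
  refine ((hasDerivAt_integral_lower hκt ρ).sub
    ((hasDerivAt_id ρ).mul (hasDerivAt_integral_lower hκ ρ))).congr_deriv ?_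
  simp only [id]
  ring

lemma contDiff_second_primitive (hκ : Continuous κ) :
    ContDiff ℝ 2 fun ρ => ∫ t in ρ..1, κ t * (t - ρ) := by
  have h1 : ∀ ρ, HasDerivAt (fun ρ => -∫ t in ρ..1, κ t) (κ ρ) ρ := fun ρ => by
    exact (hasDerivAt_integral_lower hκ ρ).fun_neg.congr_deriv (neg_neg _)
  have h2 : deriv (fun ρ => ∫ t in ρ..1, κ t * (t - ρ)) = fun ρ => -∫ t in ρ..1, κ t :=
    funext fun ρ => (hasDerivAt_second_primitive hκ ρ).deriv
  have h3 : deriv (fun ρ => -∫ t in ρ..1, κ t) = κ := funext fun ρ => (h1 ρ).deriv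
  rw [show (2 : WithTop ℕ∞) = 1 + 1 by norm_num, contDiff_succ_iff_deriv]
  refine ⟨fun ρ => (hasDerivAt_second_primitive hκ ρ).differentiableAt, by simp, ?_⟩
  rw [h2, contDiff_one_iff_deriv, h3]
  exact ⟨fun ρ => (h1 ρ).differentiableAt, hκ⟩

lemma second_primitive_eq_zero {e : ℝ} (hκe : ∀ t, e ≤ t → κ t = 0) (he : e < 1) {ρ : ℝ}
    (hρ : e ≤ ρ) : ∫ t in ρ..1, κ t * (t - ρ) = 0 := by
  refine (intervalIntegral.integral_congr fun t ht => ?_).trans intervalIntegral.integral_zero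
  have : e ≤ t := (le_min hρ he.le).trans ht.1
  simp [hκe t this]

lemma second_primitive_nonneg {e : ℝ} (hκ0 : ∀ t, 0 ≤ κ t) (hκe : ∀ t, e ≤ t → κ t = 0)
    (he : e < 1) (ρ : ℝ) : 0 ≤ ∫ t in ρ..1, κ t * (t - ρ) := by
  rcases le_total e ρ with h | h
  · rw [second_primitive_eq_zero hκe he h]
  · exact intervalIntegral.integral_nonneg (h.trans he.le) fun t ht =>
      mul_nonneg (hκ0 t) (sub_nonneg.2 ht.1)

/-- Replacing t - ρ by its positive part gives a domain of integration independent of ρ, as Fubini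
needs. -/
lemma second_primitive_eq_integral_max (hκ : Continuous κ) {ρ : ℝ} (hρ : ρ ∈ Icc (0 : ℝ) 1) :
    ∫ t in ρ..1, κ t * (t - ρ) = ∫ t in Ioc (0 : ℝ) 1, κ t * max (t - ρ) 0 := by
  have hc : Continuous fun t => κ t * max (t - ρ) 0 := by fun_prop
  rw [← intervalIntegral.integral_of_le zero_le_one,
    ← intervalIntegral.integral_add_adjacent_intervals (hc.intervalIntegrable 0 ρ)
      (hc.intervalIntegrable ρ 1)]
  have h1 : ∫ t in (0 : ℝ)..ρ, κ t * max (t - ρ) 0 = 0 := by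
    refine (intervalIntegral.integral_congr fun t ht => ?_).trans intervalIntegral.integral_zero
    rw [uIcc_of_le hρ.1] at ht
    simp [max_eq_right (sub_nonpos.2 ht.2)]
  rw [h1, zero_add]
  refine intervalIntegral.integral_congr fun t ht => ?_
  rw [uIcc_of_le hρ.2] at ht
  rw [max_eq_left (sub_nonneg.2 ht.1)]

end RadialPrimitive

/-! ### The contribution of h -/

section RadialFubini

variable {M : Type*} [MeasurableSpace M] {μ : Measure M} {R h : M → ℝ} {κ : ℝ → ℝ}

/-- The powers left after inserting the hypothesis on h at r = √t. Integrability at 0 is where α < 1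
enters, and is the source of the factor 1/(1 - α). -/
lemma integral_rpow_bound {α c₂ c₃ : ℝ} (hα : α < 1) :
    IntegrableOn (fun t : ℝ => c₂ * t ^ (-((1 + α) / 2)) + c₃ * t ^ (-(1 / 2 : ℝ))) (Ioc 0 1) ∧
    ∫ t in Ioc (0 : ℝ) 1, (c₂ * t ^ (-((1 + α) / 2)) + c₃ * t ^ (-(1 / 2 : ℝ)))
      = 2 * (c₂ / (1 - α) + c₃) := by
  have h1 : -1 < -((1 + α) / 2) := by linarith
  have i1 : IntervalIntegrable (fun t : ℝ => t ^ (-((1 + α) / 2))) volume 0 1 :=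
    intervalIntegral.intervalIntegrable_rpow' h1
  have i2 : IntervalIntegrable (fun t : ℝ => t ^ (-(1 / 2 : ℝ))) volume 0 1 :=
    intervalIntegral.intervalIntegrable_rpow' (by norm_num)
  have i3 := (i1.const_mul c₂).add (i2.const_mul c₃)
  refine ⟨(intervalIntegrable_iff_integrableOn_Ioc_of_le zero_le_one).1 i3, ?_⟩
  rw [← intervalIntegral.integral_of_le zero_le_one,
    intervalIntegral.integral_add (i1.const_mul c₂) (i2.const_mul c₃),
    intervalIntegral.integral_const_mul, intervalIntegral.integral_const_mul,
    integral_rpow (Or.inl h1), integral_rpow (Or.inl (by norm_num))]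
  have e1 : -((1 + α) / 2) + 1 = (1 - α) / 2 := by ring
  have h2 : (1 - α) / 2 ≠ 0 := by linarith
  rw [e1, Real.one_rpow, Real.zero_rpow h2, Real.one_rpow, Real.zero_rpow (by norm_num)]
  have : 1 - α ≠ 0 := by linarith
  field_simp
  norm_num

lemma weight_mul_bound_eq {m : ℕ} {E α c₂ c₃ t : ℝ} (ht : 0 < t) :
    E * t ^ (-(m / 2 : ℝ)) / (4 * t) * (2 * √t ^ (m + 1) * (c₂ * √t ^ (-α) + c₃))
      = E / 2 * (c₂ * t ^ (-((1 + α) / 2)) + c₃ * t ^ (-(1 / 2 : ℝ))) := by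
  have hs : √t = t ^ (1 / 2 : ℝ) := Real.sqrt_eq_rpow t
  have e1 : √t ^ (m + 1) = t ^ ((m + 1) / 2 : ℝ) := by
    rw [hs, ← Real.rpow_natCast, ← Real.rpow_mul ht.le]
    congr 1
    push_cast
    ring
  have e2 : √t ^ (-α) = t ^ (-(α / 2)) := by
    rw [hs, ← Real.rpow_mul ht.le]
    congr 1
    ring
  have e3 : t ^ (-(1 / 2 : ℝ)) = t ^ (-(m / 2 : ℝ)) * t ^ ((m + 1) / 2 : ℝ) / t := by
    rw [← Real.rpow_add ht, ← Real.rpow_sub_one ht.ne']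
    congr 1
    ring
  have e4 : t ^ (-((1 + α) / 2)) = t ^ (-(1 / 2 : ℝ)) * t ^ (-(α / 2)) := by
    rw [← Real.rpow_add ht]
    congr 1
    ring
  rw [e4, e3, e1, e2]
  field_simp
  ring

/-- By Fubini the left side is ∫ κ(t) (∫_{R < t} (t - R)h) dt; the inner integral is the one the
hypothesis controls, and κ is bounded by a power of t. -/
lemma integral_radial_mul_le {m : ℕ} {E e α c₂ c₃ : ℝ} (hR : Measurable R) (hR0 : ∀ p, 0 ≤ R p)
    (hh : IntegrableOn h {p | R p < 1} μ) (he : e < 1) (hfin : μ {p | R p ≤ e} < ⊤)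
    (hκ : Continuous κ) (hκ0 : ∀ t, 0 ≤ κ t) (hκe : ∀ t, e ≤ t → κ t = 0)
    (hκE : ∀ t ∈ Ioo (0 : ℝ) 1, κ t ≤ E * t ^ (-(m / 2 : ℝ)) / (4 * t))
    (hE : 0 ≤ E) (hα : α < 1) (hc₂ : 0 ≤ c₂) (hc₃ : 0 ≤ c₃)
    (hbound : ∀ t ∈ Ioo (0 : ℝ) 1, ∫ p in {p | R p < t}, (t - R p) * h p ∂μ
      ≤ 2 * √t ^ (m + 1) * (c₂ * √t ^ (-α) + c₃)) :
    ∫ p in {p | R p < 1}, (∫ t in (R p)..1, κ t * (t - R p)) * h p ∂μ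
      ≤ E * (c₂ / (1 - α) + c₃) := by
  have hme : MeasurableSet {p | R p ≤ e} := measurableSet_le hR measurable_const
  have hm1 : ∀ t, MeasurableSet {p | R p < t} := fun t => measurableSet_lt hR measurable_const
  -- Restriction to R ≤ e gives a finite measure, so Fubini applies, and loses nothing because the
  -- second primitive vanishes beyond e.
  let ν := μ.restrict {p | R p ≤ e}
  have : IsFiniteMeasure ν := ⟨by rw [Measure.restrict_apply_univ]; exact hfin⟩
  have hsub : {p | R p ≤ e} ⊆ {p | R p < 1} := fun p (hp : R p ≤ e) => hp.trans_lt he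
  have hν : Integrable h ν := hh.mono_set hsub
  let k : M → ℝ → ℝ := fun p t => κ t * max (t - R p) 0 * h p
  have hint : Integrable (Function.uncurry k) (ν.prod (volume.restrict (Ioc (0 : ℝ) 1))) := by
    obtain ⟨C, hC⟩ := isCompact_Icc.exists_bound_of_continuousOn (s := Icc (0 : ℝ) 1) hκ.continuousOn
    have h1 : Integrable (fun z : M × ℝ => h z.1) (ν.prod (volume.restrict (Ioc (0 : ℝ) 1))) :=
      hν.comp_fst _
    have hmeas : Measurable fun z : M × ℝ => κ z.2 * max (z.2 - R z.1) 0 :=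
      (hκ.measurable.comp measurable_snd).mul
        ((measurable_snd.sub (hR.comp measurable_fst)).max measurable_const)
    refine h1.bdd_mul (c := C) hmeas.aestronglyMeasurable ?_
    have hae : ∀ᵐ z ∂(ν.prod (volume.restrict (Ioc (0 : ℝ) 1))), z.2 ∈ Ioc (0 : ℝ) 1 :=
      Measure.quasiMeasurePreserving_snd.ae (ae_restrict_mem measurableSet_Ioc)
    filter_upwards [hae] with z hz
    have h2 := hC z.2 ⟨hz.1.le, hz.2⟩
    have h3 : ‖max (z.2 - R z.1) 0‖ ≤ 1 := by
      rw [Real.norm_eq_abs, abs_of_nonneg (le_max_right _ _)]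
      exact max_le (by linarith [hR0 z.1, hz.2]) zero_le_one
    rw [norm_mul]
    calc _ ≤ C * 1 := mul_le_mul h2 h3 (norm_nonneg _) ((norm_nonneg _).trans h2)
      _ = C := mul_one C
  have hinner : ∀ t ∈ Ioc (0 : ℝ) 1,
      ∫ p, k p t ∂ν = κ t * ∫ p in {p | R p < t}, (t - R p) * h p ∂μ := by
    intro t ht
    rcases le_or_gt e t with h' | h'
    · simp [k, hκe t h']
    · rw [← integral_const_mul]
      refine (setIntegral_eq_of_subset_of_forall_sdiff_eq_zero hme
        (fun p (hp : R p < t) => (hp.trans h').le) fun p hp => ?_).trans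
          (setIntegral_congr_fun (hm1 t) fun p (hp : R p < t) => ?_)
      · have : t ≤ R p := not_lt.1 hp.2
        simp [k, max_eq_right (sub_nonpos.2 this)]
      · simp only [k]
        rw [max_eq_left (by linarith)]
        ring
  calc ∫ p in {p | R p < 1}, (∫ t in (R p)..1, κ t * (t - R p)) * h p ∂μ
      = ∫ p, (∫ t in (R p)..1, κ t * (t - R p)) * h p ∂ν := by
        refine setIntegral_eq_of_subset_of_forall_sdiff_eq_zero (hm1 1) hsub fun p hp => ?_
        rw [second_primitive_eq_zero hκe he (not_le.1 hp.2).le, zero_mul]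
    _ = ∫ p, (∫ t in Ioc (0 : ℝ) 1, k p t) ∂ν := by
        refine setIntegral_congr_fun hme fun p (hp : R p ≤ e) => ?_
        simp only [k]
        rw [integral_mul_const, second_primitive_eq_integral_max hκ ⟨hR0 p, hp.trans he.le⟩]
    _ = ∫ t in Ioc (0 : ℝ) 1, (∫ p, k p t ∂ν) := integral_integral_swap hint
    _ ≤ ∫ t in Ioc (0 : ℝ) 1, E / 2 * (c₂ * t ^ (-((1 + α) / 2)) + c₃ * t ^ (-(1 / 2 : ℝ))) := by
        refine setIntegral_mono_on hint.integral_prod_right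
          ((integral_rpow_bound hα).1.const_mul _) measurableSet_Ioc fun t ht => ?_
        rw [hinner t ht]
        rcases ht.2.eq_or_lt with h1 | h1
        · rw [h1, hκe 1 he.le]
          simp only [zero_mul, Real.one_rpow]
          positivity
        · rw [← weight_mul_bound_eq (m := m) ht.1]
          have hb := hbound t ⟨ht.1, h1⟩
          have h3 : 0 ≤ 2 * √t ^ (m + 1) * (c₂ * √t ^ (-α) + c₃) := by positivity
          -- The inner integral has no sign, so it is bounded first; the bound on κ is applied only
          -- afterwards, against a nonnegative quantity.
          exact (mul_le_mul_of_nonneg_left hb (hκ0 t)).trans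
            (mul_le_mul_of_nonneg_right (hκE t ⟨ht.1, h1⟩) h3)
    _ = E * (c₂ / (1 - α) + c₃) := by
        rw [integral_const_mul, (integral_rpow_bound hα).2]
        ring

end RadialFubini

/-! ### Testing with the radial function -/

section MainInequality

variable {m d : ℕ} {H : Type*} [TopologicalSpace H] {I : ModelWithCorners ℝ (Euc m) H}
  {M : Type*} [TopologicalSpace M] [ChartedSpace H M] {F : M → Euc d}

lemma preimage_ball_subset_interior (hbd : NoBoundaryIn I F (ball 0 1)) :
    F ⁻¹' ball 0 1 ⊆ I.interior M := by
  intro p hp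
  by_contra h
  exact hbd.1 p (by rwa [← ModelWithCorners.compl_interior]) hp

lemma isCompact_preimage_closedBall (hbd : NoBoundaryIn I F (ball 0 1)) {r : ℝ} (hr : r < 1) :
    IsCompact (F ⁻¹' closedBall 0 r) :=
  hbd.2 _ (closedBall_subset_ball hr) (isCompact_closedBall _ _)

variable [IsManifold I ∞ M]

/-- The second derivative κ is nonnegative, so the tangential part of F may be replaced by F itself.
The first derivative -∫κ is nonpositive, so only a lower bound for ⟨F, H⟩ is needed, and
Cauchy–Schwarz gives one. -/
lemma laplacian_radial_le (hF : IsSmoothImmersion I F) {p : M} (hp : p ∈ I.interior M)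
    {κ : ℝ → ℝ} (hκ : Continuous κ) (hκ0 : ∀ t, 0 ≤ κ t) (hρ : ‖F p‖ ^ 2 ≤ 1) {Lam : ℝ}
    (hLam : ‖meanCurvature I F p‖ ≤ Lam) :
    laplacian I F (fun q => ∫ t in (‖F q‖ ^ 2)..1, κ t * (t - ‖F q‖ ^ 2)) p
      ≤ 4 * ‖F p‖ ^ 2 * κ (‖F p‖ ^ 2) - 2 * m * (∫ t in (‖F p‖ ^ 2)..1, κ t)
        + 2 * Lam * √(‖F p‖ ^ 2) * ∫ t in (‖F p‖ ^ 2)..1, κ t := by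
  have hpp := (mem_innerDomain_self hp).2
  have hinj := injective_fderiv_localParam hF hpp
  have e : localParam I F p (extChartAt I p p) = F p := by
    rw [localParam, Function.comp_apply, extChartAt_to_inv]
  have h := patchLaplacian_comp_normSq (contDiffAt_two_localParam hF hpp) hinj
    (contDiff_second_primitive hκ) (hasDerivAt_second_primitive hκ)
    (fun ρ => (hasDerivAt_integral_lower hκ ρ).fun_neg.congr_deriv (neg_neg _))
  have hQ := sum_metricMatrix_inv_inner_le hinj (F p)
  rw [e] at h
  have hB : 0 ≤ ∫ t in (‖F p‖ ^ 2)..1, κ t :=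
    intervalIntegral.integral_nonneg hρ fun t _ => hκ0 t
  have hin : -inner ℝ (F p) (meanCurvature I F p) ≤ Lam * ‖F p‖ := by
    refine (neg_le_abs _).trans ((abs_real_inner_le_norm _ _).trans ?_)
    rw [mul_comm]
    exact mul_le_mul_of_nonneg_right hLam (norm_nonneg _)
  rw [Real.sqrt_sq (norm_nonneg _)]
  refine h.le.trans ?_
  have h1 := mul_le_mul_of_nonneg_left hQ (mul_nonneg zero_le_four (hκ0 (‖F p‖ ^ 2)))
  have h2 := mul_le_mul_of_nonneg_left hin (mul_nonneg zero_le_two hB)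
  change 2 * (-∫ t in (‖F p‖ ^ 2)..1, κ t) * (m + inner ℝ (F p) (meanCurvature I F p)) + _ ≤ _
  linarith

variable [T2Space M] [SecondCountableTopology M] [MeasurableSpace M] [BorelSpace M]

/-- The approximate monotonicity inequality: a and b bound the inner transition of the cutoff, and c
is the start of the outer one. The limits c → 1 and b → a are taken later. -/
lemma integral_sublevel_le (hF : IsSmoothImmersion I F) (hbd : NoBoundaryIn I F (ball 0 1))
    {f : M → ℝ} (hf : ContMDiffOn I 𝓘(ℝ, ℝ) 2 f (F ⁻¹' ball 0 1))
    (hf_nonneg : ∀ p ∈ F ⁻¹' ball 0 1, 0 ≤ f p)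
    (hf_int : IntegrableOn f (F ⁻¹' ball 0 1) (inducedVolume I F))
    {Lam lam : ℝ} (hLam0 : 0 ≤ Lam) (hlam : 0 ≤ lam)
    (hLam : ∀ p ∈ F ⁻¹' ball 0 1, ‖meanCurvature I F p‖ ≤ Lam)
    {h : M → ℝ} (hh : IntegrableOn h (F ⁻¹' ball 0 1) (inducedVolume I F))
    (hlap : ∀ᵐ p ∂(inducedVolume I F).restrict (F ⁻¹' ball 0 1),
      laplacian I F f p ≥ -lam * f p - h p)
    {c₂ c₃ α : ℝ} (hc₂ : 0 ≤ c₂) (hc₃ : 0 ≤ c₃) (hα : α < 1)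
    (hbound : ∀ r ∈ Ioc (0 : ℝ) 1,
      1 / 2 * (r ^ (m + 1))⁻¹ *
          ∫ p in F ⁻¹' ball 0 r, (r ^ 2 - ‖F p‖ ^ 2) * h p ∂inducedVolume I F
        ≤ c₂ * r ^ (-α) + c₃)
    {a b c : ℝ} (ha : 0 < a) (hab : a < b) (hbc : b < c) (hc : c < 1) :
    b ^ (-(m / 2 : ℝ)) * ∫ p in {p | ‖F p‖ ^ 2 ≤ a}, f p ∂inducedVolume I F
      ≤ Real.exp (Lam + lam / 2) * c ^ (-(m / 2 : ℝ)) *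
          ∫ p in F ⁻¹' ball 0 1, f p ∂inducedVolume I F
        + Real.exp (Lam + lam / 2) * (c₂ / (1 - α) + c₃) := by
  obtain ⟨e, hce, he⟩ := exists_between hc
  obtain ⟨κ, hκ, hκ0, -, hκe, hκE, hκL⟩ := exists_weight m hLam0 hlam ha hab hbc hce he
  set μ := inducedVolume I F with hμ
  set W := F ⁻¹' ball (0 : Euc d) 1 with hWdef
  set C := Real.exp (Lam + lam / 2) with hC
  have hFc : Continuous F := hF.1.continuous
  have hW : IsOpen W := isOpen_ball.preimage hFc
  have hWi : W ⊆ I.interior M := preimage_ball_subset_interior hbd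
  have hball : ∀ t, 0 < t → F ⁻¹' ball 0 √t = {p | ‖F p‖ ^ 2 < t} := fun t ht => by
    ext p
    rw [mem_preimage, mem_ball_zero_iff, Real.lt_sqrt (norm_nonneg _)]
    rfl
  have hcball : ∀ t, 0 < t → F ⁻¹' closedBall 0 √t = {p | ‖F p‖ ^ 2 ≤ t} := fun t ht => by
    ext p
    rw [mem_preimage, mem_closedBall_zero_iff, Real.le_sqrt (norm_nonneg _) ht.le]
    rfl
  have hW1 : W = {p | ‖F p‖ ^ 2 < 1} := by
    rw [← hball 1 one_pos, Real.sqrt_one]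
  have he0 : 0 < e := by linarith
  have hKc : IsCompact {p | ‖F p‖ ^ 2 ≤ e} := by
    rw [← hcball e he0]
    exact isCompact_preimage_closedBall hbd ((Real.sqrt_lt' one_pos).2 (by simpa using he))
  have hKW : {p | ‖F p‖ ^ 2 ≤ e} ⊆ W := by
    rw [hW1]
    exact fun p (hp : ‖F p‖ ^ 2 ≤ e) => hp.trans_lt he
  let φ : M → ℝ := fun p => ∫ t in (‖F p‖ ^ 2)..1, κ t * (t - ‖F p‖ ^ 2)
  have hφ : ContMDiff I 𝓘(ℝ, ℝ) 2 φ := by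
    have h1 : ContDiff ℝ 2 fun v : Euc d => ∫ t in (‖v‖ ^ 2)..1, κ t * (t - ‖v‖ ^ 2) :=
      (contDiff_second_primitive hκ).comp (contDiff_norm_sq ℝ)
    exact h1.contMDiff.comp (hF.1.of_le (WithTop.coe_le_coe.2 (le_top : (2 : ℕ∞) ≤ ⊤)))
  have hφs : tsupport φ ⊆ {p | ‖F p‖ ^ 2 ≤ e} := by
    refine closure_minimal (fun p hp => ?_) (isClosed_le (by fun_prop) continuous_const)
    by_contra hn
    exact hp (second_primitive_eq_zero hκe he (not_le.1 hn).le)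
  have hφc : HasCompactSupport φ := hKc.of_isClosed_subset (isClosed_tsupport φ) hφs
  have hφ0 : ∀ p, 0 ≤ φ p := fun p => second_primitive_nonneg hκ0 hκe he _
  have hφW : ∀ p, p ∉ W → φ p = 0 := fun p hp =>
    image_eq_zero_of_notMem_tsupport fun h => hp (hKW (hφs h))
  have hgreen := integral_mul_laplacian_comm hF hW hWi hf hφ.contMDiffOn (hφs.trans hKW) hφc
  have i1 := integrable_mul_laplacian hF hW hWi hf hφ.contMDiffOn (hφs.trans hKW) hφc
  have i2 := integrable_laplacian_mul hF hW hWi hf hφ.contMDiffOn (hφs.trans hKW) hφc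
  have i3 : Integrable (fun p => φ p * f p) μ :=
    integrable_inducedVolume hF hW hWi (hφ.continuous.continuousOn.mul hf.continuousOn)
      (tsupport_mul_subset_left.trans (hφs.trans hKW))
      (hφc.of_isClosed_subset (isClosed_tsupport _) tsupport_mul_subset_left)
  have hWm := hW.measurableSet
  have i4 : IntegrableOn (fun p => φ p * h p) W μ := by
    obtain ⟨B, hB⟩ := hφc.exists_bound_of_continuous hφ.continuous
    exact hh.bdd_mul (c := B) hφ.continuous.aestronglyMeasurable (Eventually.of_forall hB)
  have hR : Measurable fun p => ‖F p‖ ^ 2 := (hFc.norm.pow 2).measurable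
  have hhbound : ∫ p in W, φ p * h p ∂μ ≤ C * (c₂ / (1 - α) + c₃) := by
    rw [hW1] at hh ⊢
    refine integral_radial_mul_le (m := m) (α := α) (e := e) hR (fun p => sq_nonneg _) hh he
      (inducedVolume_lt_top_of_isCompact hF hKc (hKW.trans hWi)) hκ hκ0 hκe hκE
      (Real.exp_pos _).le hα hc₂ hc₃ fun t ht => ?_
    have hr : 0 < √t := Real.sqrt_pos.2 ht.1
    have h1 := hbound √t ⟨hr, Real.sqrt_le_one.2 ht.2.le⟩
    rw [hball t ht.1, Real.sq_sqrt ht.1.le] at h1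
    have h2 : 0 < √t ^ (m + 1) := pow_pos hr _
    have h3 := mul_le_mul_of_nonneg_left h1 (mul_pos two_pos h2).le
    calc _ = 2 * √t ^ (m + 1) * (1 / 2 * (√t ^ (m + 1))⁻¹ *
          ∫ p in {p | ‖F p‖ ^ 2 < t}, (t - ‖F p‖ ^ 2) * h p ∂μ) := by field_simp
      _ ≤ _ := h3
  -- test the differential inequality with `φ`
  have hpos : 0 ≤ ∫ p in W, (φ p * laplacian I F f p + lam * (φ p * f p) + φ p * h p) ∂μ := by
    refine integral_nonneg_of_ae ?_
    filter_upwards [hlap] with p hp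
    have := mul_le_mul_of_nonneg_left (show 0 ≤ laplacian I F f p + lam * f p + h p by linarith)
      (hφ0 p)
    simp only [Pi.zero_apply]
    linarith
  have j1 : IntegrableOn (fun p => φ p * laplacian I F f p) W μ := i1.integrableOn
  have j2 : IntegrableOn (fun p => f p * laplacian I F φ p) W μ := i2.integrableOn
  have j3 : IntegrableOn (fun p => lam * (φ p * f p)) W μ := (i3.const_mul lam).integrableOn
  have s1 : ∫ p in W, φ p * laplacian I F f p ∂μ = ∫ p in W, f p * laplacian I F φ p ∂μ := by
    rw [setIntegral_eq_integral_of_forall_compl_eq_zero fun p hp => by rw [hφW p hp, zero_mul],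
      setIntegral_eq_integral_of_forall_compl_eq_zero fun p hp => ?_]
    · exact hgreen
    · rw [image_eq_zero_of_notMem_tsupport fun h =>
        hp (hKW (hφs (tsupport_laplacian_subset F φ h))), mul_zero]
  have j13 : IntegrableOn (fun p => φ p * laplacian I F f p + lam * (φ p * f p)) W μ := j1.add j3
  rw [integral_add j13 i4, integral_add j1 j3, s1, ← integral_add j2 j3] at hpos
  have haW : {p | ‖F p‖ ^ 2 ≤ a} ⊆ W := fun p (hp : ‖F p‖ ^ 2 ≤ a) =>
    hKW (show ‖F p‖ ^ 2 ≤ e by linarith)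
  have ham : MeasurableSet {p | ‖F p‖ ^ 2 ≤ a} := measurableSet_le hR measurable_const
  -- The pointwise bound on Δφ + λφ is multiplied by f ≥ 0; the indicator term produces the integral
  -- over the small sublevel set.
  have hmono : ∫ p in W, (f p * laplacian I F φ p + lam * (φ p * f p)) ∂μ
      ≤ ∫ p in W, (C * c ^ (-(m / 2 : ℝ)) * f p
        - b ^ (-(m / 2 : ℝ)) * {p | ‖F p‖ ^ 2 ≤ a}.indicator f p) ∂μ := by
    refine setIntegral_mono_on (j2.add j3) ((hf_int.const_mul _).sub
      ((hf_int.indicator ham).const_mul _)) hWm fun p hp => ?_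
    have hp1 : ‖F p‖ ^ 2 < 1 := by rw [hW1] at hp; exact hp
    have h1 := laplacian_radial_le hF (hWi hp) hκ hκ0 hp1.le (hLam p hp)
    have h2 := hκL (‖F p‖ ^ 2) ⟨sq_nonneg _, hp1⟩
    have h3 : laplacian I F φ p + lam * φ p ≤ C * c ^ (-(m / 2 : ℝ))
        - (if ‖F p‖ ^ 2 ≤ a then b ^ (-(m / 2 : ℝ)) else 0) :=
      (add_le_add_left h1 _).trans h2
    have h4 := mul_le_mul_of_nonneg_left h3 (hf_nonneg p hp)
    have h5 : f p * (if ‖F p‖ ^ 2 ≤ a then b ^ (-(m / 2 : ℝ)) else 0)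
        = b ^ (-(m / 2 : ℝ)) * {p | ‖F p‖ ^ 2 ≤ a}.indicator f p := by
      by_cases hpa : ‖F p‖ ^ 2 ≤ a
      · rw [if_pos hpa, indicator_of_mem (show p ∈ {p | ‖F p‖ ^ 2 ≤ a} from hpa), mul_comm]
      · rw [if_neg hpa, indicator_of_notMem (show p ∉ {p | ‖F p‖ ^ 2 ≤ a} from hpa), mul_zero,
          mul_zero]
    rw [mul_sub, h5] at h4
    linarith
  rw [integral_sub (hf_int.const_mul _) ((hf_int.indicator ham).const_mul _), integral_const_mul,
    integral_const_mul, setIntegral_indicator ham, inter_eq_right.2 haW] at hmono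
  linarith

end MainInequality

/-! ### Volume density at the base point -/

section Density

/-- L and T have the same Gram matrix, and for an endomorphism the density is |det T| relative to
the identity parametrization. -/
lemma volDensity_clm {m d : ℕ} (L : Euc m →L[ℝ] Euc d) (T : Euc m →L[ℝ] Euc m)
    (hT : ∀ z w, inner ℝ (T z) (T w) = inner ℝ (L z) (L w)) (y : Euc m) :
    volDensity L y = |T.det| := by
  have h1 : volDensity L y = volDensity T y := by
    simp only [volDensity, metricMatrix, pderiv, ContinuousLinearMap.fderiv, hT]
  have h2 : volDensity (id ∘ T) y = |(fderiv ℝ T y).det| * volDensity (id : Euc m → Euc m) (T y) :=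
    volDensity_comp differentiableAt_id T.differentiableAt
  have h3 : metricMatrix (id : Euc m → Euc m) (T y) = 1 := by
    ext i j
    simp [metricMatrix, pderiv, Matrix.one_apply, EuclideanSpace.inner_single_left]
  rw [h1, show (T : Euc m → Euc m) = id ∘ T from rfl, h2, volDensity, h3]
  simp

/-- The volume of an ellipsoid. -/
lemma volume_norm_le {m d : ℕ} (L : Euc m →L[ℝ] Euc d) (hL : Function.Injective L) {r : ℝ}
    (hr : 0 ≤ r) (y : Euc m) :
    volume {z | ‖L z‖ ≤ r}
      = ENNReal.ofReal ((volDensity L y)⁻¹ * r ^ m) * volume (ball (0 : Euc m) 1) := by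
  have hfr : Module.finrank ℝ (LinearMap.range (L : Euc m →ₗ[ℝ] Euc d)) = m := by
    rw [LinearMap.finrank_range_of_inj hL, finrank_euclideanSpace_fin]
  -- Composing L with an isometry of its range onto ℝᵐ gives an endomorphism T with |Tz| = |Lz|, so
  -- the ellipsoid is the preimage of a ball under T.
  let e : LinearMap.range (L : Euc m →ₗ[ℝ] Euc d) ≃ₗᵢ[ℝ] Euc m :=
    ((stdOrthonormalBasis ℝ _).reindex (finCongr hfr)).repr
  let T : Euc m →L[ℝ] Euc m := LinearMap.toContinuousLinearMap
    ((e : LinearMap.range (L : Euc m →ₗ[ℝ] Euc d) →ₗ[ℝ] Euc m) ∘ₗ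
      (L : Euc m →ₗ[ℝ] Euc d).rangeRestrict)
  have hT : ∀ z w, inner ℝ (T z) (T w) = inner ℝ (L z) (L w) := fun z w =>
    e.inner_map_map _ _
  have hTn : ∀ z, ‖T z‖ = ‖L z‖ := fun z => e.norm_map _
  have hinj : Function.Injective T := by
    refine (injective_iff_map_eq_zero T).2 fun z hz => ?_
    have := hTn z
    rw [hz, norm_zero] at this
    exact (injective_iff_map_eq_zero L).1 hL z (norm_eq_zero.1 this.symm)
  have hdet : LinearMap.det (T : Euc m →ₗ[ℝ] Euc m) ≠ 0 := by
    have : IsUnit (T : Euc m →ₗ[ℝ] Euc m) :=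
      (Module.End.isUnit_iff _).2 ⟨hinj, LinearMap.injective_iff_surjective.1 hinj⟩
    exact (this.map LinearMap.det).ne_zero
  have hset : {z | ‖L z‖ ≤ r} = (T : Euc m →ₗ[ℝ] Euc m) ⁻¹' closedBall 0 r := by
    ext z
    rw [mem_preimage, mem_closedBall_zero_iff]
    exact (iff_of_eq (congrArg (· ≤ r) (hTn z))).symm
  rw [hset, Measure.addHaar_preimage_linearMap _ hdet, Measure.addHaar_closedBall _ _ hr,
    finrank_euclideanSpace_fin, ← mul_assoc, ← ENNReal.ofReal_mul (abs_nonneg _),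
    volDensity_clm L T hT, abs_inv]

variable {m d : ℕ} {H : Type*} [TopologicalSpace H] {I : ModelWithCorners ℝ (Euc m) H}
  {M : Type*} [TopologicalSpace M] [ChartedSpace H M] [IsManifold I ∞ M] {F : M → Euc d}

/-- The differentiability error is o(|y - y₀|), and |y - y₀| is controlled by |du(y - y₀)| because
an injective linear map in finite dimension is bounded below. -/
lemma eventually_norm_le {u : Euc m → Euc d} {y₀ : Euc m} (hu : DifferentiableAt ℝ u y₀)
    (hinj : Function.Injective (fderiv ℝ u y₀)) (h0 : u y₀ = 0) {δ : ℝ} (hδ : 0 < δ) :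
    ∀ᶠ y in 𝓝 y₀, ‖u y‖ ≤ (1 + δ) * ‖fderiv ℝ u y₀ (y - y₀)‖ := by
  obtain ⟨K, hK, hKL⟩ := (fderiv ℝ u y₀ : Euc m →ₗ[ℝ] Euc d).exists_antilipschitzWith
    (LinearMap.ker_eq_bot.2 hinj)
  have hK0 : (0 : ℝ) < K := hK
  have h1 := hu.hasFDerivAt.isLittleO.def (div_pos hδ hK0)
  filter_upwards [h1] with y hy
  rw [h0, sub_zero] at hy
  have h2 : ‖y - y₀‖ ≤ K * ‖fderiv ℝ u y₀ (y - y₀)‖ := by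
    have := hKL.le_mul_dist (y - y₀) 0
    simpa using this
  have h3 : δ / K * ‖y - y₀‖ ≤ δ * ‖fderiv ℝ u y₀ (y - y₀)‖ := by
    calc _ ≤ δ / K * (K * ‖fderiv ℝ u y₀ (y - y₀)‖) := by gcongr
      _ = _ := by field_simp
  have h4 := norm_le_norm_add_norm_sub' (u y) (fderiv ℝ u y₀ (y - y₀))
  linarith

lemma exists_forall_norm_fderiv_le_mem {u : Euc m → Euc d} {y₀ : Euc m}
    (hinj : Function.Injective (fderiv ℝ u y₀)) {N : Set (Euc m)} (hN : N ∈ 𝓝 y₀) :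
    ∃ s₀ > 0, ∀ y, ‖fderiv ℝ u y₀ (y - y₀)‖ ≤ s₀ → y ∈ N := by
  obtain ⟨K, hK, hKL⟩ := (fderiv ℝ u y₀ : Euc m →ₗ[ℝ] Euc d).exists_antilipschitzWith
    (LinearMap.ker_eq_bot.2 hinj)
  have hK0 : (0 : ℝ) < K := hK
  obtain ⟨ε, hε, hball⟩ := Metric.mem_nhds_iff.1 hN
  refine ⟨ε / (2 * K), by positivity, fun y hy => hball ?_⟩
  have h2 : ‖y - y₀‖ ≤ K * ‖fderiv ℝ u y₀ (y - y₀)‖ := by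
    have := hKL.le_mul_dist (y - y₀) 0
    simpa using this
  rw [mem_ball, dist_eq_norm]
  calc ‖y - y₀‖ ≤ K * (ε / (2 * K)) := h2.trans (by gcongr)
    _ = ε / 2 := by field_simp
    _ < ε := half_lt_self hε

variable [MeasurableSpace M] [BorelSpace M]

/-- Lower bound for the volume of small extrinsic balls around a point of the hypersurface. -/
lemma exists_small_set_volume_ge (hF : IsSmoothImmersion I F) {p₀ : M} (hp₀ : p₀ ∈ I.interior M)
    (hF0 : F p₀ = 0) {N : Set M} (hN : N ∈ 𝓝 p₀) :
    ∃ D₀ > 0, ∀ δ > 0, δ < D₀ → ∃ s₀ > 0, ∀ s, 0 < s → s ≤ s₀ →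
      ∃ A ⊆ N, MeasurableSet A ∧ (∀ p ∈ A, ‖F p‖ ≤ s) ∧
        ENNReal.ofReal ((D₀ - δ) * (D₀⁻¹ * (s / (1 + δ)) ^ m)) * volume (ball (0 : Euc m) 1)
          ≤ inducedVolume I F A := by
  have hpp := mem_innerDomain_self hp₀
  set u := localParam I F p₀ with hu
  set y₀ := extChartAt I p₀ p₀ with hy₀
  have hinj : Function.Injective (fderiv ℝ u y₀) := injective_fderiv_localParam hF hpp.2
  have hdiff : DifferentiableAt ℝ u y₀ :=
    (contDiffAt_two_localParam hF hpp.2).differentiableAt (by norm_num)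
  have hu0 : u y₀ = 0 := by rw [hu, localParam, Function.comp_apply, hy₀, extChartAt_to_inv, hF0]
  refine ⟨volDensity u y₀, volDensity_pos hinj, fun δ hδ hδD => ?_⟩
  have hNy : (extChartAt I p₀).symm ⁻¹' N ∈ 𝓝 y₀ := by
    refine (continuousAt_extChartAt_symm p₀).preimage_mem_nhds ?_
    rwa [extChartAt_to_inv]
  have hev : ∀ᶠ y in 𝓝 y₀, y ∈ innerTarget I p₀ ∧ (extChartAt I p₀).symm y ∈ N ∧
      ‖u y‖ ≤ (1 + δ) * ‖fderiv ℝ u y₀ (y - y₀)‖ ∧ volDensity u y₀ - δ < volDensity u y := by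
    filter_upwards [(isOpen_innerTarget p₀).mem_nhds hpp.2, hNy,
      eventually_norm_le hdiff hinj hu0 hδ,
      (continuousAt_volDensity_localParam hF hpp.2).eventually (lt_mem_nhds (sub_lt_self _ hδ))]
      with y h1 h2 h3 h4 using ⟨h1, h2, h3, h4⟩
  obtain ⟨s₀, hs₀, hmem⟩ := exists_forall_norm_fderiv_le_mem hinj hev
  refine ⟨s₀, hs₀, fun s hs hss => ?_⟩
  -- An ellipsoid adapted to du, shrunk by 1 + δ so that u maps it into the ball of radius s. Its
  -- volume carries D₀⁻¹, which compensates the density, at least D₀ - δ on it.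
  let E : Set (Euc m) := {y | ‖fderiv ℝ u y₀ (y - y₀)‖ ≤ s / (1 + δ)}
  have hδ1 : 0 < 1 + δ := by linarith
  have hE : ∀ y ∈ E, y ∈ innerTarget I p₀ ∧ (extChartAt I p₀).symm y ∈ N ∧
      ‖u y‖ ≤ (1 + δ) * ‖fderiv ℝ u y₀ (y - y₀)‖ ∧ volDensity u y₀ - δ < volDensity u y :=
    fun y hy => hmem y (le_trans hy ((div_le_self hs.le (by linarith)).trans hss))
  have hEm : MeasurableSet E := (isClosed_le (by fun_prop) continuous_const).measurableSet
  let A : Set M := innerDomain I p₀ ∩ extChartAt I p₀ ⁻¹' E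
  have hinv : ∀ p ∈ A, (extChartAt I p₀).symm (extChartAt I p₀ p) = p := fun p hp =>
    (extChartAt I p₀).left_inv hp.1.1
  have hA : MeasurableSet A := by
    have h := (continuousOn_iff_continuous_domRestrict.1
      (continuousOn_extChartAt_innerDomain (I := I) p₀)).measurable hEm
    have h2 := (isOpen_innerDomain (I := I) p₀).measurableSet.subtype_image h
    convert h2 using 1
    ext p
    simp only [A, mem_inter_iff, mem_preimage, mem_image, Subtype.exists, domRestrict_apply]
    exact ⟨fun h => ⟨p, h.1, h.2, rfl⟩, fun ⟨z, hz, hz', e⟩ => e ▸ ⟨hz, hz'⟩⟩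
  refine ⟨A, fun p hp => ?_, hA, fun p hp => ?_, ?_⟩
  · rw [← hinv p hp]
    exact (hE _ hp.2).2.1
  · have h1 : u (extChartAt I p₀ p) = F p := by
      rw [hu, localParam, Function.comp_apply, hinv p hp]
    rw [← h1]
    calc _ ≤ (1 + δ) * ‖fderiv ℝ u y₀ (extChartAt I p₀ p - y₀)‖ := (hE _ hp.2).2.2.1
      _ ≤ (1 + δ) * (s / (1 + δ)) := mul_le_mul_of_nonneg_left hp.2 hδ1.le
      _ = s := by field_simp
  · have h1 : inducedVolume I F A = chartVolume I F p₀ A := by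
      have := congrArg (fun ν : Measure M => ν A) (restrict_inducedVolume hF p₀)
      simp only [Measure.restrict_apply hA] at this
      rwa [inter_eq_left.2 (inter_subset_left : A ⊆ innerDomain I p₀)] at this
    have h2 : (extChartAt I p₀).symm ⁻¹' A ∩ innerTarget I p₀ = E := by
      ext y
      constructor
      · rintro ⟨hy, hy'⟩
        have := hy.2
        rwa [mem_preimage, (extChartAt I p₀).right_inv (innerTarget_subset p₀ hy')] at this
      · intro hy
        have hy' := (hE y hy).1
        refine ⟨⟨extChartAt_symm_mem_innerDomain hy', ?_⟩, hy'⟩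
        rwa [mem_preimage, (extChartAt I p₀).right_inv (innerTarget_subset p₀ hy')]
    have h3 : volume E = ENNReal.ofReal ((volDensity u y₀)⁻¹ * (s / (1 + δ)) ^ m)
        * volume (ball (0 : Euc m) 1) := by
      have e1 : E = (fun y => y + -y₀) ⁻¹' {z | ‖fderiv ℝ u y₀ z‖ ≤ s / (1 + δ)} := by
        simp only [← sub_eq_add_neg]; rfl
      have e2 : volDensity (fderiv ℝ u y₀) y₀ = volDensity u y₀ := by
        simp only [volDensity, metricMatrix, pderiv, ContinuousLinearMap.fderiv]
      rw [e1, measure_preimage_add_right, volume_norm_le _ hinj (div_pos hs hδ1).le y₀, e2]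
    rw [h1, chartVolume_apply F p₀ hA, preimage_symm_inter_target_eq p₀ inter_subset_left, h2,
      ENNReal.ofReal_mul (by linarith), mul_assoc, ← h3, ← setLIntegral_const]
    exact setLIntegral_mono' hEm fun y hy => ENNReal.ofReal_le_ofReal (hE y hy).2.2.2.le

/-- On a small piece of the sheet through `p₀` one has f > f(p₀) - η, so the integral over the
sublevel set is at least (f(p₀) - η) times the volume of that piece. After division by s^m, let δ →
0 and then η → 0. -/
lemma le_of_forall_integral_le (hF : IsSmoothImmersion I F)
    (hbd : NoBoundaryIn I F (ball 0 1)) {p₀ : M} (hF0 : F p₀ = 0) {f : M → ℝ}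
    (hf : ContinuousOn f (F ⁻¹' ball 0 1)) (hf_nonneg : ∀ p ∈ F ⁻¹' ball 0 1, 0 ≤ f p)
    (hf_int : IntegrableOn f (F ⁻¹' ball 0 1) (inducedVolume I F)) {Q : ℝ} (hQ0 : 0 ≤ Q)
    (hQ : ∀ s ∈ Ioo (0 : ℝ) 1, ∫ p in {p | ‖F p‖ ^ 2 ≤ s ^ 2}, f p ∂inducedVolume I F ≤ s ^ m * Q) :
    (volume (ball (0 : Euc m) 1)).toReal * f p₀ ≤ Q := by
  have hFc : Continuous F := hF.1.continuous
  have hW : IsOpen (F ⁻¹' ball (0 : Euc d) 1) := isOpen_ball.preimage hFc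
  have hp₀ : p₀ ∈ F ⁻¹' ball (0 : Euc d) 1 := by simp [hF0]
  set w₀ := (volume (ball (0 : Euc m) 1)).toReal with hw
  have hw0 : 0 ≤ w₀ := ENNReal.toReal_nonneg
  obtain hf0 | hf0 := (hf_nonneg p₀ hp₀).eq_or_lt
  · rw [← hf0, mul_zero]; exact hQ0
  have key : ∀ η, 0 < η → η < f p₀ → ∃ D₀ > 0, ∀ δ > 0, δ < D₀ →
      (f p₀ - η) * ((D₀ - δ) * (D₀⁻¹ * (1 / (1 + δ)) ^ m) * w₀) ≤ Q := by
    intro η hη hηf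
    have hN : F ⁻¹' ball 0 1 ∩ {p | f p₀ - η < f p} ∈ 𝓝 p₀ :=
      inter_mem (hW.mem_nhds hp₀)
        ((hf.continuousAt (hW.mem_nhds hp₀)).eventually (lt_mem_nhds (sub_lt_self _ hη)))
    obtain ⟨D₀, hD₀, hvol⟩ := exists_small_set_volume_ge hF
      (preimage_ball_subset_interior hbd hp₀) hF0 hN
    refine ⟨D₀, hD₀, fun δ hδ hδD => ?_⟩
    obtain ⟨s₀, hs₀, hs⟩ := hvol δ hδ hδD
    -- A single radius suffices for given η and δ; the 1/2 keeps it below 1, as `hQ` requires.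
    have hs1 : 0 < min s₀ (1 / 2) := lt_min hs₀ (by norm_num)
    have hs2 : min s₀ (1 / 2) < 1 := (min_le_right _ _).trans_lt (by norm_num)
    obtain ⟨A, hAN, hA, hAs, hAv⟩ := hs _ hs1 (min_le_left _ _)
    set s := min s₀ (1 / 2) with hsdef
    have hsub : A ⊆ {p | ‖F p‖ ^ 2 ≤ s ^ 2} := fun p hp =>
      pow_le_pow_left₀ (norm_nonneg _) (hAs p hp) 2
    have hsW : {p | ‖F p‖ ^ 2 ≤ s ^ 2} ⊆ F ⁻¹' ball 0 1 := fun p hp => by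
      rw [mem_preimage, mem_ball_zero_iff]
      exact (pow_le_pow_iff_left₀ (norm_nonneg _) hs1.le two_ne_zero).1 hp |>.trans_lt hs2
    have hsm : MeasurableSet {p | ‖F p‖ ^ 2 ≤ s ^ 2} :=
      measurableSet_le (hFc.norm.pow 2).measurable measurable_const
    have hfin : inducedVolume I F A < ⊤ := by
      refine (measure_mono fun p hp => ?_).trans_lt (inducedVolume_lt_top_of_isCompact hF
        (isCompact_preimage_closedBall hbd hs2) ((preimage_mono (closedBall_subset_ball hs2)).trans
          (preimage_ball_subset_interior hbd)))
      rw [mem_preimage, mem_closedBall_zero_iff]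
      exact hAs p hp
    have h1 : (f p₀ - η) * (inducedVolume I F A).toReal ≤ ∫ p in A, f p ∂inducedVolume I F :=
      setIntegral_ge_of_const_le_real hA hfin.ne (fun p hp => (hAN hp).2.le)
        (hf_int.mono_set (hsub.trans hsW))
    have h2 : ∫ p in A, f p ∂inducedVolume I F
        ≤ ∫ p in {p | ‖F p‖ ^ 2 ≤ s ^ 2}, f p ∂inducedVolume I F :=
      setIntegral_mono_set (hf_int.mono_set hsW)
        ((ae_restrict_iff' hsm).2 (Eventually.of_forall fun p hp => hf_nonneg p (hsW hp)))
        hsub.eventuallyLE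
    have h3 : (D₀ - δ) * (D₀⁻¹ * (s / (1 + δ)) ^ m) * w₀ ≤ (inducedVolume I F A).toReal := by
      have := ENNReal.toReal_mono hfin.ne hAv
      rwa [ENNReal.toReal_mul, ENNReal.toReal_ofReal] at this
      have : 0 < D₀ - δ := by linarith
      positivity
    have h4 := (mul_le_mul_of_nonneg_left h3 (sub_pos.2 hηf).le).trans
      (h1.trans (h2.trans (hQ s ⟨hs1, hs2⟩)))
    have hsm0 : 0 < s ^ m := pow_pos hs1 m
    refine le_of_mul_le_mul_left (le_trans (le_of_eq ?_) h4) hsm0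
    rw [div_pow, div_pow, one_pow]
    ring
  have key2 : ∀ η, 0 < η → η < f p₀ → (f p₀ - η) * w₀ ≤ Q := by
    intro η hη hηf
    obtain ⟨D₀, hD₀, h⟩ := key η hη hηf
    -- As δ → 0 the factor (D₀ - δ) D₀⁻¹ (1 + δ)^(-m) tends to 1, so the unknown density D₀
    -- disappears.
    have hc : ContinuousAt (fun δ : ℝ => (f p₀ - η) * ((D₀ - δ) * (D₀⁻¹ * (1 / (1 + δ)) ^ m) * w₀)) 0 := by
      have : (1 : ℝ) + 0 ≠ 0 := by norm_num
      fun_prop (disch := assumption)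
    have ht := hc.tendsto.mono_left (nhdsWithin_le_nhds (s := Ioi 0))
    have h5 := le_of_tendsto ht (b := Q) (by
      filter_upwards [Ioo_mem_nhdsGT hD₀] with δ hδ using h δ hδ.1 hδ.2)
    simpa [hD₀.ne'] using h5
  have hc : ContinuousAt (fun η : ℝ => (f p₀ - η) * w₀) 0 := by fun_prop
  have ht := hc.tendsto.mono_left (nhdsWithin_le_nhds (s := Ioi 0))
  have h5 := le_of_tendsto ht (b := Q) (by
    filter_upwards [Ioo_mem_nhdsGT hf0] with η hη using key2 η hη.1 hη.2)
  rw [sub_zero] at h5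
  rwa [mul_comm]

end Density

/-! ### Passage to the limit and the mean value inequality -/

section MeanValue

variable {m : ℕ} {H : Type*} [TopologicalSpace H] {I : ModelWithCorners ℝ (Euc m) H}
  {M : Type*} [TopologicalSpace M] [T2Space M] [SecondCountableTopology M]
  [ChartedSpace H M] [IsManifold I ∞ M] [MeasurableSpace M] [BorelSpace M] {F : M → Euc (m + 1)}

/-- The mean value inequality for functions that are integrable on the unit ball. -/
lemma volume_ball_mul_le (hF : IsSmoothImmersion I F) (hbd : NoBoundaryIn I F (ball 0 1))
    {p₀ : M} (hp₀ : F p₀ = 0) {f : M → ℝ} (hf : ContMDiffOn I 𝓘(ℝ, ℝ) 2 f (F ⁻¹' ball 0 1))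
    (hf_nonneg : ∀ p ∈ F ⁻¹' ball 0 1, 0 ≤ f p)
    (hf_int : IntegrableOn f (F ⁻¹' ball 0 1) (inducedVolume I F))
    {Lam lam : ℝ} (hLam0 : 0 ≤ Lam) (hlam : 0 ≤ lam)
    (hLam : ∀ p ∈ F ⁻¹' ball 0 1, ‖meanCurvature I F p‖ ≤ Lam)
    {h : M → ℝ} (hh : IntegrableOn h (F ⁻¹' ball 0 1) (inducedVolume I F))
    (hlap : ∀ᵐ p ∂(inducedVolume I F).restrict (F ⁻¹' ball 0 1),
      laplacian I F f p ≥ -lam * f p - h p)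
    {c₂ c₃ α : ℝ} (hc₂ : 0 ≤ c₂) (hc₃ : 0 ≤ c₃) (hα : α < 1)
    (hbound : ∀ r ∈ Ioc (0 : ℝ) 1,
      1 / 2 * (r ^ (m + 1))⁻¹ *
          ∫ p in F ⁻¹' ball 0 r, (r ^ 2 - ‖F p‖ ^ 2) * h p ∂inducedVolume I F
        ≤ c₂ * r ^ (-α) + c₃) :
    (volume (ball (0 : Euc m) 1)).toReal * f p₀
      ≤ Real.exp (Lam + lam / 2) *
        (∫ p in F ⁻¹' ball 0 1, f p ∂inducedVolume I F + (c₂ / (1 - α) + c₃)) := by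
  set μ := inducedVolume I F with hμ
  have hW : MeasurableSet (F ⁻¹' ball (0 : Euc (m + 1)) 1) :=
    (isOpen_ball.preimage hF.1.continuous).measurableSet
  have hint : 0 ≤ ∫ p in F ⁻¹' ball 0 1, f p ∂μ := setIntegral_nonneg hW hf_nonneg
  have h1α : 0 < 1 - α := sub_pos.2 hα
  refine le_of_forall_integral_le hF hbd hp₀ hf.continuousOn hf_nonneg hf_int (by positivity)
    fun s hs => ?_
  have hs0 : 0 < s ^ 2 := pow_pos hs.1 2
  have hs1 : s ^ 2 < 1 := pow_lt_one₀ hs.1.le hs.2 two_ne_zero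
  have hb : ∀ b, s ^ 2 < b → b < 1 →
      b ^ (-(m / 2 : ℝ)) * ∫ p in {p | ‖F p‖ ^ 2 ≤ s ^ 2}, f p ∂μ
        ≤ Real.exp (Lam + lam / 2) * ∫ p in F ⁻¹' ball 0 1, f p ∂μ
          + Real.exp (Lam + lam / 2) * (c₂ / (1 - α) + c₃) := by
    intro b hab hb1
    -- First limit, c → 1 from below: the outer cutoff moves to the unit sphere and c^(-m/2) → 1.
    have hc : ContinuousAt (fun c : ℝ => Real.exp (Lam + lam / 2) * c ^ (-(m / 2 : ℝ)) *
        ∫ p in F ⁻¹' ball 0 1, f p ∂μ + Real.exp (Lam + lam / 2) * (c₂ / (1 - α) + c₃)) 1 := by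
      have : ContinuousAt (fun c : ℝ => c ^ (-(m / 2 : ℝ))) 1 :=
        Real.continuousAt_rpow_const _ _ (Or.inl one_ne_zero)
      fun_prop
    have ht := ge_of_tendsto (hc.tendsto.mono_left (nhdsWithin_le_nhds (s := Iio 1)))
      (b := b ^ (-(m / 2 : ℝ)) * ∫ p in {p | ‖F p‖ ^ 2 ≤ s ^ 2}, f p ∂μ) (by
        filter_upwards [Ioo_mem_nhdsLT hb1] with c hc
        exact integral_sublevel_le hF hbd hf hf_nonneg hf_int hLam0 hlam hLam hh hlap hc₂ hc₃ hα
          hbound hs0 hab hc.1 hc.2)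
    rwa [Real.one_rpow, mul_one] at ht
  -- Second limit, b → s² from above, which turns b^(-m/2) into s^(-m).
  have hc : ContinuousAt (fun b : ℝ => b ^ (-(m / 2 : ℝ)) *
      ∫ p in {p | ‖F p‖ ^ 2 ≤ s ^ 2}, f p ∂μ) (s ^ 2) :=
    (Real.continuousAt_rpow_const _ _ (Or.inl hs0.ne')).mul continuousAt_const
  have ht := le_of_tendsto (hc.tendsto.mono_left (nhdsWithin_le_nhds (s := Ioi (s ^ 2)))) (by
    filter_upwards [Ioo_mem_nhdsGT hs1] with b hb' using hb b hb'.1 hb'.2)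
  have hpow : (s ^ 2) ^ (-(m / 2 : ℝ)) = (s ^ m)⁻¹ := by
    rw [← Real.rpow_natCast s 2, ← Real.rpow_mul hs.1.le, ← Real.rpow_natCast s m,
      ← Real.rpow_neg hs.1.le]
    congr 1
    push_cast
    ring
  rwa [hpow, ← mul_add, inv_mul_le_iff₀ (pow_pos hs.1 m)] at ht

end MeanValue

end Hypersurface

end

theorem mainTheorem5 {m : ℕ}
    {H : Type*} [TopologicalSpace H] (I : ModelWithCorners ℝ (Hypersurface.Euc m) H)
    {M : Type*} [TopologicalSpace M] [T2Space M] [SecondCountableTopology M]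
    [ChartedSpace H M] [IsManifold I ∞ M] [MeasurableSpace M] [BorelSpace M]
    (F : M → Hypersurface.Euc (m + 1))
    (hF : Hypersurface.IsSmoothImmersion I F)
    (hbd : Hypersurface.NoBoundaryIn I F (ball 0 1))
    (p₀ : M) (hp₀ : F p₀ = 0)
    (f : M → ℝ)
    (hf : ContMDiffOn I 𝓘(ℝ, ℝ) 2 f (F ⁻¹' ball 0 1))
    (hf_nonneg : ∀ p ∈ F ⁻¹' ball 0 1, 0 ≤ f p)
    (lam₁ : ℝ) (hlam₁ : 0 ≤ lam₁)
    (h : M → ℝ)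
    (hh : IntegrableOn h (F ⁻¹' ball 0 1) (Hypersurface.inducedVolume I F))
    (hlap : ∀ᵐ p ∂(Hypersurface.inducedVolume I F).restrict (F ⁻¹' ball 0 1),
      Hypersurface.laplacian I F f p ≥ -lam₁ * f p - h p)
    (c₂ c₃ α : ℝ) (hc₂ : 0 ≤ c₂) (hc₃ : 0 ≤ c₃) (hα : α ∈ Ico (0 : ℝ) 1)
    (hbound : ∀ r ∈ Ioc (0 : ℝ) 1,
      1 / 2 * (r ^ (m + 1))⁻¹ *
          ∫ p in F ⁻¹' ball 0 r, (r ^ 2 - ‖F p‖ ^ 2) * h p ∂Hypersurface.inducedVolume I F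
        ≤ c₂ * r ^ (-α) + c₃)
    (hH : BddAbove ((fun p => ‖Hypersurface.meanCurvature I F p‖) '' (F ⁻¹' ball 0 1)))
    (c₁ : ℝ)
    (hc₁ : c₁ = sSup ((fun p => ‖Hypersurface.meanCurvature I F p‖) '' (F ⁻¹' ball 0 1))
      + lam₁ / 2)
    (ω_m : ℝ) (hω_m : ω_m = (volume (ball (0 : Hypersurface.Euc m) 1)).toReal) :
    ENNReal.ofReal (f p₀) ≤
      ENNReal.ofReal (ω_m⁻¹ * Real.exp c₁) *
          ∫⁻ p in F ⁻¹' ball 0 1, ENNReal.ofReal (f p) ∂Hypersurface.inducedVolume I F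
        + ENNReal.ofReal (ω_m⁻¹ * (c₂ / (1 - α) + c₃) * Real.exp c₁) := by
  have hW : MeasurableSet (F ⁻¹' ball (0 : Hypersurface.Euc (m + 1)) 1) :=
    (isOpen_ball.preimage hF.1.continuous).measurableSet
  have hLam : ∀ p ∈ F ⁻¹' ball 0 1, ‖Hypersurface.meanCurvature I F p‖ ≤ sSup
      ((fun p => ‖Hypersurface.meanCurvature I F p‖) '' (F ⁻¹' ball 0 1)) :=
    fun p hp => le_csSup hH (mem_image_of_mem _ hp)
  -- The supremum is nonnegative because it dominates a norm, namely that of the mean curvature at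
  -- `p₀`.
  have hLam0 := (norm_nonneg _).trans (hLam p₀ (by simp [hp₀]))
  have hω : 0 < ω_m := by
    rw [hω_m]
    exact ENNReal.toReal_pos (measure_ball_pos _ _ one_pos).ne' measure_ball_lt_top.ne
  have h1α : 0 < 1 - α := sub_pos.2 hα.2
  have hK : 0 < ω_m⁻¹ * Real.exp c₁ := by positivity
  -- If the integral of f is infinite, so is the right side, the coefficient being positive;
  -- otherwise f is integrable and the Bochner version applies.
  by_cases htop : ∫⁻ p in F ⁻¹' ball 0 1, ENNReal.ofReal (f p) ∂Hypersurface.inducedVolume I F = ⊤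
  · rw [htop, ENNReal.mul_top (ENNReal.ofReal_pos.2 hK).ne', top_add]
    exact le_top
  have hpos : 0 ≤ᵐ[(Hypersurface.inducedVolume I F).restrict (F ⁻¹' ball 0 1)] f :=
    (ae_restrict_iff' hW).2 (Filter.Eventually.of_forall hf_nonneg)
  have hf_int : IntegrableOn f (F ⁻¹' ball 0 1) (Hypersurface.inducedVolume I F) :=
    ⟨hf.continuousOn.aestronglyMeasurable hW,
      (hasFiniteIntegral_iff_ofReal hpos).2 (lt_top_iff_ne_top.2 htop)⟩
  have key := Hypersurface.volume_ball_mul_le hF hbd hp₀ hf hf_nonneg hf_int hLam0 hlam₁ hLam hh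
    hlap hc₂ hc₃ hα.2 hbound
  rw [← hω_m, ← hc₁, mul_comm, ← le_div_iff₀ hω] at key
  rw [← ofReal_integral_eq_lintegral_ofReal hf_int hpos, ← ENNReal.ofReal_mul hK.le,
    ← ENNReal.ofReal_add (mul_nonneg hK.le (integral_nonneg_of_ae hpos)) (by positivity)]
  refine ENNReal.ofReal_le_ofReal (key.trans_eq ?_)
  rw [div_eq_mul_inv]
  ring
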